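/- Let $G$ be a finite simple plane graph (drawn in $\mathbb{R}^2$ without crossings, its edges being simple polygonal curves). Let $F$ be the subgraph of $G$ formed by the vertices and edges contained in the boundary of the outer (unbounded) face, and let $P$ be a path contained in $F$ that has at most two edges (possibly none, in which case $P$ is a single vertex of $F$). Let $L$ be a list assignment for $G$, that is, a function that assigns to each vertex $v$ a set $L(v)$ of colors, such that (i) $|L(v)|\ge 5$ for every $v\in V(G)\setminus V(F)$; (ii) $|L(v)|\ge 3$ for every $v\in V(F)\setminus V(P)$; (iii) $|L(v)|=1$ for every $v\in V(P)$; (iv) no two vertices with lists of size three are adjacent in $G$; (v) $L$ gives a proper coloring of the subgraph of $G$ induced by $V(P)$, that is, $L(u)\ne L(v)$ for any two vertices $u,v$ of $P$ that are adjacent in $G$; and (vi) if $P=uvw$ has length two and $x$ is a common neighbor of $u$, $v$ and $w$, then $L(x)\neq L(u)\cup L(v)\cup L(w)$. Then $G$ is $L$-colorable, that is, one can choose a color $c(v)\in L(v)$ for every vertex $v$ so that adjacent vertices receive distinct colors. -/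

import Mathlib

/-- The Euclidean plane. -/
abbrev Plane : Type := EuclideanSpace ℝ (Fin 2)

/-- `IsPolygonalArc a b s`: the set `s` is (the trace of) a simple polygonal curve with the two
distinct ends `a` and `b`, that is, a non-degenerate segment, or a non-degenerate segment followed
by a simple polygonal curve that it meets only in their common end. -/
inductive IsPolygonalArc : Plane → Plane → Set Plane → Prop
  | single {a b : Plane} (hab : a ≠ b) : IsPolygonalArc a b (segment ℝ a b)
  | cons {a b c : Plane} {s : Set Plane} (hab : a ≠ b) (hs : IsPolygonalArc b c s)
      (hmeet : segment ℝ a b ∩ s = {b}) : IsPolygonalArc a c (segment ℝ a b ∪ s)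

/-- A crossing-free drawing of `G` in the plane; a graph together with such a drawing is a
plane graph. -/
structure PlaneDrawing {V : Type*} (G : SimpleGraph V) where
  /-- the point that represents a vertex -/
  point : V → Plane
  /-- the curve that represents an edge -/
  arc : G.edgeSet → Set Plane
  /-- distinct vertices are distinct points -/
  point_injective : Function.Injective point
  /-- the edge `uv` is a simple polygonal curve whose ends are the points of `u` and `v`
  (the curve may be traversed in both directions, so the order of `u` and `v` is immaterial) -/
  isPolygonalArc : ∀ (u v : V) (h : G.Adj u v),
    IsPolygonalArc (point u) (point v) (arc ⟨s(u, v), h⟩)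
  /-- the only vertices on the curve of an edge are the ends of this edge -/
  mem_of_point_mem_arc : ∀ (e : G.edgeSet) (w : V), point w ∈ arc e → w ∈ (e : Sym2 V)
  /-- distinct edges meet only in vertices -/
  arc_inter_subset : ∀ e f : G.edgeSet, e ≠ f → arc e ∩ arc f ⊆ Set.range point

namespace PlaneDrawing

variable {V : Type*} {G : SimpleGraph V}

/-- The set of all points of the drawing. -/
def carrier (D : PlaneDrawing G) : Set Plane :=
  Set.range D.point ∪ ⋃ e : G.edgeSet, D.arc e

/-- The outer face: the unbounded connected component of the complement of the drawing. (The
drawing of a finite graph is bounded, so there is exactly one such component.) -/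
def outerFace (D : PlaneDrawing G) : Set Plane :=
  {x | x ∈ D.carrierᶜ ∧ ¬ Bornology.IsBounded (connectedComponentIn D.carrierᶜ x)}

/-- The boundary of the outer face as a subgraph of `G`: the vertices and edges that are drawn
in the topological boundary of the outer face. -/
def outerBoundary (D : PlaneDrawing G) : G.Subgraph where
  verts := {v | D.point v ∈ frontier D.outerFace}
  Adj u v := D.point u ∈ frontier D.outerFace ∧ D.point v ∈ frontier D.outerFace ∧
    ∃ h : G.Adj u v, D.arc ⟨s(u, v), h⟩ ⊆ frontier D.outerFace
  adj_sub := fun h => h.2.2.1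
  edge_vert := fun h => h.1
  symm := ⟨by
    rintro u v ⟨hu, hv, h, hs⟩
    have he : (⟨s(v, u), h.symm⟩ : G.edgeSet) = ⟨s(u, v), h⟩ := Subtype.ext Sym2.eq_swap
    exact ⟨hv, hu, h.symm, by rw [he]; exact hs⟩⟩

end PlaneDrawing

/-- `G` is `L`-colorable: one can choose a color from the list of each vertex such that adjacent
vertices receive distinct colors. -/
def SimpleGraph.IsListColorable {V C : Type*} (G : SimpleGraph V) (L : V → Set C) : Prop :=
  ∃ c : G.Coloring C, ∀ v, c v ∈ L v

/-! Planarity enters only through excluded minors. Add an apex, drawn in the outer face, and join it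
to all vertices of the outer boundary: the result has no minor K₅ or K₃,₃. This property of a pair
`(W, S)` of vertex sets (`IsDisk`) is all that is kept of the drawing. It survives the deletion of
outer vertices, whose neighbors become outer, and the contraction into the apex of connected sets
that meet `S`.

The exclusion of the two minors uses no Jordan curve theorem, only a count modulo 2. For two
disjoint polygonal lines, the number of passages of one line above an end of the other has a parity
fixed by the left-to-right order of the four ends (`aboveLine_parity`). Summing over all pairs of
nonadjacent edges of K₅ or K₃,₃ gives `1 = 0`. Left to right means lexicographic order, so that
vertical segments are no exception.

The coloring theorem is proved for disk graphs with a precolored star `P` of at most three outer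
vertices (`Precolored.extends`), a form closed under the reductions. In a minimal counterexample `W`
is as small as possible and then `P` as large as possible. An edge between outer vertices does not
separate the graph (`subset_of_chord`); hence an outer vertex has at most two outer neighbors
(`outer_degree_le_two`), `P` is an induced path `u v w`, and no vertex is adjacent to all of it.
Moreover an edge `y₁ y₂` of outer vertices has at most one common inner neighbor, and this one sees
no further outer vertex (`inner_neighbor_unique`, `no_third_outer_neighbor`; both need a connected
set around `P` next to `y₁`).

Now follow the outer boundary from `w` along `s₁, s₂, s₃, s₄`. Coloring and deleting one or two of
these vertices gives a smaller instance unless their lists have at least 4, exactly 3, exactly 4 and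
exactly 3 colors. In that case `s₁` and `s₃` can receive the same color: the deleted vertices use
only two colors, inner vertices keep three of their five, and the structure above shows that lists
of size three remain independent. -/

/-! ### Parity of crossings of polygonal curves -/

namespace Plane

/-- The lexicographic order of the plane. -/
def LexLT (a b : Plane) : Prop := a 0 < b 0 ∨ (a 0 = b 0 ∧ a 1 < b 1)

theorem LexLT.asymm {a b : Plane} (h : LexLT a b) : ¬ LexLT b a := by
  unfold LexLT at *
  rintro (h' | ⟨h1, h2⟩) <;> rcases h with h | ⟨h3, h4⟩ <;> linarith

theorem LexLT.trans {a b c : Plane} (h : LexLT a b) (h' : LexLT b c) : LexLT a c := by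
  unfold LexLT at *
  rcases h with h | ⟨h3, h4⟩ <;> rcases h' with h' | ⟨h5, h6⟩
  · exact Or.inl (h.trans h')
  · exact Or.inl (by linarith)
  · exact Or.inl (by linarith)
  · exact Or.inr ⟨by linarith, by linarith⟩

theorem ext_coord {a b : Plane} (h0 : a 0 = b 0) (h1 : a 1 = b 1) : a = b := by
  ext i; fin_cases i
  · exact h0
  · exact h1

theorem lexLT_or_lexLT {a b : Plane} (h : a ≠ b) : LexLT a b ∨ LexLT b a := by
  unfold LexLT
  rcases lt_trichotomy (a 0) (b 0) with h0 | h0 | h0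
  · exact Or.inl (Or.inl h0)
  · rcases lt_trichotomy (a 1) (b 1) with h1 | h1 | h1
    · exact Or.inl (Or.inr ⟨h0, h1⟩)
    · exact absurd (ext_coord h0 h1) h
    · exact Or.inr (Or.inr ⟨h0.symm, h1⟩)
  · exact Or.inr (Or.inl h0)

/-- Twice the signed area of the triangle `x y a`. -/
def orient (x y a : Plane) : ℝ := (y 0 - x 0) * (a 1 - x 1) - (y 1 - x 1) * (a 0 - x 0)

/-- A nontrivial nonnegative combination of lexicographically positive vectors does not vanish. -/
theorem lex_comb_ne_zero {a₁ b₁ a₂ b₂ a₃ b₃ : Plane} {c₁ c₂ c₃ : ℝ} (hc₁ : 0 < c₁) (hc₂ : 0 ≤ c₂)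
    (hc₃ : 0 ≤ c₃) (h₁ : LexLT a₁ b₁) (h₂ : LexLT a₂ b₂) (h₃ : LexLT a₃ b₃)
    (e : ∀ i : Fin 2, c₁ * (b₁ i - a₁ i) + c₂ * (b₂ i - a₂ i) + c₃ * (b₃ i - a₃ i) = 0) :
    False := by
  have le0 : ∀ {a b : Plane}, LexLT a b → 0 ≤ b 0 - a 0 := by
    rintro a b (h | h) <;> linarith
  have e0 := e 0
  have e1 := e 1
  have p1 := mul_nonneg hc₁.le (le0 h₁)
  have p2 := mul_nonneg hc₂ (le0 h₂)
  have p3 := mul_nonneg hc₃ (le0 h₃)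
  have key : ∀ {a b : Plane} {c : ℝ}, LexLT a b → 0 ≤ c → c * (b 0 - a 0) = 0 →
      0 ≤ c * (b 1 - a 1) := by
    rintro a b c h hc h0
    rcases mul_eq_zero.mp h0 with h0 | h0
    · simp [h0]
    · rcases h with h | h
      · linarith
      · exact mul_nonneg hc (by linarith)
  have q2 := key h₂ hc₂ (by linarith)
  have q3 := key h₃ hc₃ (by linarith)
  rcases h₁ with h | h
  · have := mul_pos hc₁ (sub_pos.mpr h)
    linarith
  · have := mul_pos hc₁ (sub_pos.mpr h.2)
    linarith

theorem mem_segment_of_coord {a b z : Plane} {s t : ℝ} (hs : 0 ≤ s) (ht : 0 ≤ t) (hst : s + t = 1)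
    (e : ∀ i : Fin 2, s * a i + t * b i = z i) : z ∈ segment ℝ a b := by
  refine ⟨s, t, hs, ht, hst, ?_⟩
  ext i
  simpa using e i

/-- Division by the common weight `A + B` turns the dependency into a common point of the segments.
-/
theorem not_disjoint_of_dependency {a b x y : Plane} {A B X Y : ℝ}
    (hA : 0 ≤ A) (hB : 0 ≤ B) (hX : 0 ≤ X) (hY : 0 ≤ Y) (hpos : 0 < A + B) (hsum : A + B = X + Y)
    (e : ∀ i : Fin 2, A * a i + B * b i = X * x i + Y * y i) :
    ¬ Disjoint (segment ℝ a b) (segment ℝ x y) := by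
  rw [Set.not_disjoint_iff]
  have hpos' : 0 < X + Y := hsum ▸ hpos
  have hne := hpos.ne'
  refine ⟨(A / (A + B)) • a + (B / (A + B)) • b, ⟨_, _, by positivity, by positivity, by field_simp, rfl⟩,
    ⟨X / (A + B), Y / (A + B), by positivity, by positivity, ?_, ?_⟩⟩
  · rw [← add_div, ← hsum]; field_simp
  · ext i
    have := e i
    simp only [PiLp.add_apply, PiLp.smul_apply, smul_eq_mul]
    field_simp
    linarith

/-- Cramer's rule: the signed areas of the triangles on three of the four points are the
coefficients of an affine dependency, whose sum vanishes by `orient_sum`. The signs of the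
coefficients decide whether the segments meet. -/
theorem orient_dependency (a b x y : Plane) (i : Fin 2) :
    orient b x y * a i - orient a x y * b i + orient a b y * x i - orient a b x * y i = 0 := by
  fin_cases i <;> simp only [orient, Fin.zero_eta, Fin.mk_one] <;> ring

theorem orient_sum (a b x y : Plane) :
    orient b x y - orient a x y + orient a b y - orient a b x = 0 := by
  simp only [orient]; ring

theorem mem_segment_of_orient_eq_zero {a b x : Plane} (h : orient a b x = 0) (h1 : LexLT a x)
    (h2 : LexLT x b) : x ∈ segment ℝ a b := by
  unfold orient at h
  have hab := h1.trans h2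
  rcases hab with h0 | ⟨h0, h0'⟩
  · have hp : 0 < b 0 - a 0 := by linarith
    have hxa : a 0 ≤ x 0 := by rcases h1 with h | h <;> linarith
    have hxb : x 0 ≤ b 0 := by rcases h2 with h | h <;> linarith
    refine mem_segment_of_coord (s := (b 0 - x 0) / (b 0 - a 0)) (t := (x 0 - a 0) / (b 0 - a 0))
      (div_nonneg (by linarith) hp.le) (div_nonneg (by linarith) hp.le) ?_ ?_
    · field_simp; ring
    · intro i
      fin_cases i <;> simp only [Fin.zero_eta, Fin.mk_one] <;> field_simp <;> linarith
  · have hxa : a 0 = x 0 := by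
      rcases h1 with h | h <;> rcases h2 with h' | h' <;> linarith
    have hxa1 : a 1 < x 1 := by rcases h1 with h | h <;> linarith
    have hxb1 : x 1 < b 1 := by rcases h2 with h | h <;> linarith
    have hp : 0 < b 1 - a 1 := by linarith
    refine mem_segment_of_coord (s := (b 1 - x 1) / (b 1 - a 1)) (t := (x 1 - a 1) / (b 1 - a 1))
      (div_nonneg (by linarith) hp.le) (div_nonneg (by linarith) hp.le) ?_ ?_
    · field_simp; ring
    · intro i
      fin_cases i <;> simp only [Fin.zero_eta, Fin.mk_one] <;> field_simp
      · rw [← h0, ← hxa]; ring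
      · ring

/-- Suppose that `x` and `y` were on different sides. A wrong sign of one of the other two areas
would write zero as a nontrivial nonnegative combination of lexicographically positive differences;
with the right signs the dependency yields a common point. -/
theorem orient_lt_zero_imp {a b x y : Plane} (hd : Disjoint (segment ℝ a b) (segment ℝ x y))
    (hax : LexLT a x) (hay : LexLT a y) (hxb : LexLT x b) (hyb : LexLT y b)
    (h : orient a b x < 0) : orient a b y < 0 := by
  by_contra h'
  push Not at h'
  have hs := orient_sum a b x y
  have hv := orient_dependency a b x y
  have hA : orient b x y ≤ 0 := by
    by_contra hA
    push Not at hA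
    refine lex_comb_ne_zero (c₁ := - orient a b x) (c₂ := orient b x y) (c₃ := orient a b y)
      (by linarith) hA.le h' hyb (hax.trans hxb) hxb fun i => ?_
    linear_combination (b i) * hs - hv i
  have hB : 0 ≤ orient a x y := by
    by_contra hB
    push Not at hB
    refine lex_comb_ne_zero (c₁ := - orient a b x) (c₂ := - orient a x y) (c₃ := orient a b y)
      (by linarith) (by linarith) h' hay (hax.trans hxb) hax fun i => ?_
    linear_combination hv i - (a i) * hs
  refine not_disjoint_of_dependency (A := - orient b x y) (B := orient a x y) (X := orient a b y)
    (Y := - orient a b x) (by linarith) hB h' (by linarith) (by linarith) (by linarith)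
    (fun i => ?_) hd
  linear_combination - hv i

/-- For interleaved ends exactly one segment passes above the enclosed end of the other. If both or
neither did, the elimination of signs used for `orient_lt_zero_imp` would again leave a dependency
that produces a common point. -/
theorem orient_interleaved {a b x y : Plane} (hd : Disjoint (segment ℝ a b) (segment ℝ x y))
    (hax : LexLT a x) (hxb : LexLT x b) (hby : LexLT b y) :
    ¬ (orient x y b < 0) ↔ orient a b x < 0 := by
  have hs := orient_sum a b x y
  have hv := orient_dependency a b x y
  have hcyc : orient x y b = orient b x y := by simp only [orient]; ring
  have hx0 : orient a b x ≠ 0 := fun h0 =>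
    Set.disjoint_left.mp hd (mem_segment_of_orient_eq_zero h0 hax hxb) (left_mem_segment ℝ x y)
  have hb0 : orient x y b ≠ 0 := fun h0 =>
    Set.disjoint_left.mp hd (right_mem_segment ℝ a b) (mem_segment_of_orient_eq_zero h0 hxb hby)
  rw [hcyc] at hb0 ⊢
  have hab := hax.trans hxb
  have hay := hab.trans hby
  have hxy := hxb.trans hby
  constructor
  · intro hA
    by_contra hY
    have hA' : 0 < orient b x y := lt_of_le_of_ne (not_lt.mp hA) hb0.symm
    have hY' : 0 < orient a b x := lt_of_le_of_ne (not_lt.mp hY) hx0.symm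
    have hX : orient a b y ≤ 0 := by
      by_contra hX
      push Not at hX
      rcases le_total 0 (- orient a x y) with hB | hB
      · refine lex_comb_ne_zero (c₁ := orient b x y) (c₂ := - orient a x y) (c₃ := orient a b y)
          hA' hB hX.le hay hby hxy fun i => ?_
        linear_combination y i * hs - hv i
      · refine lex_comb_ne_zero (c₁ := orient b x y) (c₂ := orient a x y) (c₃ := orient a b x)
          hA' (by linarith) hY'.le hax hxb hxy fun i => ?_
        linear_combination x i * hs - hv i
    have hB : 0 ≤ - orient a x y := by
      by_contra hB
      push Not at hB
      refine lex_comb_ne_zero (c₁ := orient a b x) (c₂ := orient a x y) (c₃ := - orient a b y)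
        hY' (by linarith) (by linarith) hay hab hax fun i => ?_
      linear_combination a i * hs - hv i
    refine not_disjoint_of_dependency (A := orient b x y) (B := - orient a x y)
      (X := - orient a b y) (Y := orient a b x) hA'.le hB (by linarith) hY'.le (by linarith)
      (by linarith) (fun i => ?_) hd
    linear_combination hv i
  · intro hY hA
    have hX : 0 ≤ orient a b y := by
      by_contra hX
      push Not at hX
      rcases le_total 0 (orient a x y) with hB | hB
      · refine lex_comb_ne_zero (c₁ := - orient b x y) (c₂ := orient a x y) (c₃ := - orient a b y)
          (by linarith) hB (by linarith) hay hby hxy fun i => ?_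
        linear_combination hv i - y i * hs
      · refine lex_comb_ne_zero (c₁ := - orient b x y) (c₂ := - orient a x y)
          (c₃ := - orient a b x) (by linarith) (by linarith) (by linarith) hax hxb hxy fun i => ?_
        linear_combination hv i - x i * hs
    have hB : 0 ≤ orient a x y := by
      by_contra hB
      push Not at hB
      refine lex_comb_ne_zero (c₁ := - orient a b x) (c₂ := - orient a x y) (c₃ := orient a b y)
        (by linarith) (by linarith) (by linarith) hay hab hax fun i => ?_
      linear_combination hv i - a i * hs
    refine not_disjoint_of_dependency (A := - orient b x y) (B := orient a x y)
      (X := orient a b y) (Y := - orient a b x) (by linarith) hB hX (by linarith) (by linarith)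
      (by linarith) (fun i => ?_) hd
    linear_combination - hv i

open scoped Classical in
/-- `1` if the segment with ends `x` and `y` passes above `a`, and `0` otherwise. -/
noncomputable def above (a x y : Plane) : ZMod 2 :=
  if (LexLT x a ∧ LexLT a y ∧ orient x y a < 0) ∨ (LexLT y a ∧ LexLT a x ∧ orient y x a < 0)
  then 1 else 0

open scoped Classical in
/-- `1` if `a` precedes `b` lexicographically, and `0` otherwise. -/
noncomputable def precedes (a b : Plane) : ZMod 2 := if LexLT a b then 1 else 0

theorem above_of_between {a b x : Plane} (h1 : LexLT a x) (h2 : LexLT x b) :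
    above x a b = if orient a b x < 0 then 1 else 0 := by
  unfold above
  by_cases hc : orient a b x < 0
  · rw [if_pos (Or.inl ⟨h1, h2, hc⟩), if_pos hc]
  · rw [if_neg hc, if_neg]
    rintro (h' | h')
    · exact hc h'.2.2
    · exact h1.asymm h'.2.1

theorem above_comm (a x y : Plane) : above a x y = above a y x := by
  unfold above; congr 1; rw [or_comm]

theorem precedes_swap {a b : Plane} (h : a ≠ b) : precedes b a = 1 + precedes a b := by
  unfold precedes
  rcases lexLT_or_lexLT h with h | h
  · rw [if_neg h.asymm, if_pos h]; decide
  · rw [if_pos h, if_neg h.asymm]; decide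

/-- The parity defect of two segments. -/
noncomputable def parity (a b x y : Plane) : ZMod 2 :=
  above a x y + above b x y + above x a b + above y a b +
    precedes a x + precedes a y + precedes b x + precedes b y

/-- Count by the position of `b`. Before `x`: no passage, four precedences. Between `x` and `y`: one
passage, three precedences. After both: zero or two passages, two precedences. The sum is always
even. -/
theorem parity_eq_zero_of_lt {a b x y : Plane} (hd : Disjoint (segment ℝ a b) (segment ℝ x y))
    (hxy : x = y ∨ LexLT x y) (hax : LexLT a x) :
    parity a b x y = 0 := by
  have hay : LexLT a y := by
    rcases hxy with rfl | h
    · exact hax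
    · exact hax.trans h
  have hbx : b ≠ x := by
    rintro rfl
    exact Set.disjoint_left.mp hd (right_mem_segment ℝ a b) (left_mem_segment ℝ b y)
  have hby : b ≠ y := by
    rintro rfl
    exact Set.disjoint_left.mp hd (right_mem_segment ℝ a b) (right_mem_segment ℝ x b)
  have hua : above a x y = 0 := by
    unfold above; rw [if_neg]; rintro (h | h)
    · exact h.1.asymm hax
    · exact h.1.asymm hay
  have hpa : precedes a x = 1 := if_pos hax
  have hpa' : precedes a y = 1 := if_pos hay
  unfold parity
  rcases lexLT_or_lexLT hbx with h | h
  · have hb_y : LexLT b y := by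
      rcases hxy with rfl | h'
      · exact h
      · exact h.trans h'
    have hub : above b x y = 0 := by
      unfold above; rw [if_neg]; rintro (h' | h')
      · exact h'.1.asymm h
      · exact h'.1.asymm hb_y
    have hux : above x a b = 0 := by
      unfold above; rw [if_neg]; rintro (h' | h')
      · exact h'.2.1.asymm h
      · exact h'.2.1.asymm hax
    have huy : above y a b = 0 := by
      unfold above; rw [if_neg]; rintro (h' | h')
      · exact h'.2.1.asymm hb_y
      · exact h'.2.1.asymm hay
    have hpb : precedes b x = 1 := if_pos h
    have hpb' : precedes b y = 1 := if_pos hb_y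
    rw [hua, hub, hux, huy, hpa, hpa', hpb, hpb']; decide
  · have hpb : precedes b x = 0 := if_neg h.asymm
    have hux : above x a b = if orient a b x < 0 then 1 else 0 :=
        above_of_between hax h
    rcases lexLT_or_lexLT hby with h2 | h2
    · have hpb' : precedes b y = 1 := if_pos h2
      have huy : above y a b = 0 := by
        unfold above; rw [if_neg]; rintro (h' | h')
        · exact h'.2.1.asymm h2
        · exact h'.2.1.asymm hay
      have hub : above b x y = if orient x y b < 0 then 1 else 0 :=
        above_of_between h h2
      have key := orient_interleaved hd hax h h2
      rw [hua, hub, hux, huy, hpa, hpa', hpb, hpb']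
      by_cases hc : orient a b x < 0
      · rw [if_pos hc, if_neg (key.mpr hc)]; decide
      · rw [if_neg hc, if_pos (by_contra fun h' => hc (key.mp h'))]; decide
    · have hpb' : precedes b y = 0 := if_neg h2.asymm
      have hub : above b x y = 0 := by
        unfold above; rw [if_neg]; rintro (h' | h')
        · exact h'.2.1.asymm h2
        · exact h'.2.1.asymm h
      have huy : above y a b = if orient a b y < 0 then 1 else 0 :=
        above_of_between hay h2
      have key := orient_lt_zero_imp hd hax hay h h2
      have key' := orient_lt_zero_imp (hd.mono_right (segment_symm ℝ y x).le) hay hax h2 h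
      rw [hua, hub, hux, huy, hpa, hpa', hpb, hpb']
      by_cases hc : orient a b x < 0
      · rw [if_pos hc, if_pos (key hc)]; decide
      · rw [if_neg hc, if_neg fun h' => hc (key' h')]; decide

theorem parity_swap_right (a b x y : Plane) : parity a b x y = parity a b y x := by
  unfold parity; rw [above_comm a x y, above_comm b x y]; ring

theorem parity_swap_left (a b x y : Plane) : parity a b x y = parity b a x y := by
  unfold parity; rw [above_comm x a b, above_comm y a b]; ring

/-- The defect is symmetric in the ends of each segment, and exchanging the segments reverses four
precedences, a change by `4 = 0`. So `a` may be assumed to come first. -/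
theorem parity_eq_zero {a b x y : Plane} (hd : Disjoint (segment ℝ a b) (segment ℝ x y)) :
    parity a b x y = 0 := by
  wlog hab : a = b ∨ LexLT a b generalizing a b
  · rw [parity_swap_left]
    push Not at hab
    exact this (hd.mono_left (segment_symm ℝ b a).le)
      (Or.inr ((lexLT_or_lexLT hab.1).resolve_left hab.2))
  wlog hxy : x = y ∨ LexLT x y generalizing x y
  · rw [parity_swap_right]
    push Not at hxy
    exact this (hd.mono_right (segment_symm ℝ y x).le)
      (Or.inr ((lexLT_or_lexLT hxy.1).resolve_left hxy.2))
  have ne : ∀ {p q : Plane}, p ∈ segment ℝ a b → q ∈ segment ℝ x y → p ≠ q := by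
    rintro p q hp hq rfl
    exact Set.disjoint_left.mp hd hp hq
  have hax : a ≠ x := ne (left_mem_segment ℝ a b) (left_mem_segment ℝ x y)
  have hay : a ≠ y := ne (left_mem_segment ℝ a b) (right_mem_segment ℝ x y)
  have hbx : b ≠ x := ne (right_mem_segment ℝ a b) (left_mem_segment ℝ x y)
  have hby : b ≠ y := ne (right_mem_segment ℝ a b) (right_mem_segment ℝ x y)
  rcases lexLT_or_lexLT hax with h | h
  · exact parity_eq_zero_of_lt hd hxy h
  · have := parity_eq_zero_of_lt hd.symm hab h
    unfold parity at this ⊢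
    rw [precedes_swap hax, precedes_swap hay, precedes_swap hbx, precedes_swap hby] at this
    rw [← this]
    have h4 : (4 : ZMod 2) = 0 := by decide
    linear_combination - h4

/-! ### Polygonal lines and their parity -/

/-- The union of the segments of the polygonal line through the points of a list. -/
def polyTrace : Plane → List Plane → Set Plane
  | a, [] => {a}
  | a, b :: l => segment ℝ a b ∪ polyTrace b l

/-- The parity of the number of segments of a polygonal line that pass above `z`. -/
noncomputable def aboveLine (z : Plane) : Plane → List Plane → ZMod 2
  | _, [] => 0
  | a, b :: l => above z a b + aboveLine z b l

theorem mem_polyTrace (a : Plane) (l : List Plane) : a ∈ polyTrace a l := by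
  cases l with
  | nil => simp [polyTrace]
  | cons b l => exact Or.inl (left_mem_segment ℝ a b)

theorem two_eq_zero' : (2 : ZMod 2) = 0 := by decide

/-- Each inner corner of the line is an end of two consecutive segments, so its terms cancel modulo
2 when the defects of the segments are added. -/
theorem aboveLine_parity_segment (l : List Plane) (a x y : Plane)
    (hd : Disjoint (polyTrace a l) (segment ℝ x y)) :
    above a x y + above (l.getLastD a) x y + aboveLine x a l + aboveLine y a l +
      precedes a x + precedes a y + precedes (l.getLastD a) x + precedes (l.getLastD a) y = 0 := by
  induction l generalizing a with
  | nil =>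
    simp only [List.getLastD_nil, aboveLine]
    linear_combination (above a x y + precedes a x + precedes a y) * two_eq_zero'
  | cons b l ih =>
    simp only [polyTrace, Set.disjoint_union_left] at hd
    have h1 := ih b hd.2
    have h2 := parity_eq_zero hd.1
    unfold parity at h2
    rw [List.getLastD_cons]
    simp only [aboveLine]
    linear_combination h1 + h2 -
      (above b x y + precedes b x + precedes b y) * two_eq_zero'

theorem aboveLine_parity (l m : List Plane) (a x : Plane)
    (hd : Disjoint (polyTrace a l) (polyTrace x m)) :
    aboveLine a x m + aboveLine (l.getLastD a) x m + aboveLine x a l +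
      aboveLine (m.getLastD x) a l + precedes a x + precedes a (m.getLastD x) +
      precedes (l.getLastD a) x + precedes (l.getLastD a) (m.getLastD x) = 0 := by
  induction m generalizing x with
  | nil =>
    simp only [List.getLastD_nil, aboveLine]
    linear_combination (aboveLine x a l + precedes a x + precedes (l.getLastD a) x) * two_eq_zero'
  | cons y m ih =>
    simp only [polyTrace, Set.disjoint_union_right] at hd
    have h1 := ih y hd.2
    have h2 := aboveLine_parity_segment l a x y hd.1
    rw [List.getLastD_cons]
    simp only [aboveLine]
    linear_combination h1 + h2 -
      (aboveLine y a l + precedes a y + precedes (l.getLastD a) y) * two_eq_zero'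

/-- The points `a` and `b` are joined by a polygonal line inside `X`. -/
def PolyJoined (X : Set Plane) (a b : Plane) : Prop :=
  ∃ l : List Plane, l.getLastD a = b ∧ polyTrace a l ⊆ X

theorem PolyJoined.refl {X : Set Plane} {a : Plane} (h : a ∈ X) : PolyJoined X a a :=
  ⟨[], rfl, by simpa [polyTrace] using h⟩

theorem PolyJoined.mono {X Y : Set Plane} {a b : Plane} (h : PolyJoined X a b) (hXY : X ⊆ Y) :
    PolyJoined Y a b :=
  let ⟨l, hl, hs⟩ := h
  ⟨l, hl, hs.trans hXY⟩

theorem PolyJoined.cons {X : Set Plane} {a b c : Plane} (h : segment ℝ a b ⊆ X)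
    (h' : PolyJoined X b c) : PolyJoined X a c :=
  let ⟨l, hl, hs⟩ := h'
  ⟨b :: l, by rw [List.getLastD_cons, hl], Set.union_subset h hs⟩

theorem PolyJoined.trans {X : Set Plane} {a b c : Plane} (h : PolyJoined X a b)
    (h' : PolyJoined X b c) : PolyJoined X a c := by
  obtain ⟨l, hl, hs⟩ := h
  induction l generalizing a with
  | nil => obtain rfl : a = b := hl; exact h'
  | cons d l ih =>
    simp only [polyTrace, Set.union_subset_iff] at hs
    rw [List.getLastD_cons] at hl
    exact PolyJoined.cons hs.1 (ih hl hs.2)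

theorem PolyJoined.of_segment {X : Set Plane} {a b : Plane} (h : segment ℝ a b ⊆ X) :
    PolyJoined X a b :=
  PolyJoined.cons h (PolyJoined.refl (h (right_mem_segment ℝ a b)))

theorem PolyJoined.symm {X : Set Plane} {a b : Plane} (h : PolyJoined X a b) :
    PolyJoined X b a := by
  obtain ⟨l, hl, hs⟩ := h
  induction l generalizing a with
  | nil => obtain rfl : a = b := hl; exact PolyJoined.refl (hs (mem_polyTrace a []))
  | cons d l ih =>
    simp only [polyTrace, Set.union_subset_iff] at hs
    rw [List.getLastD_cons] at hl
    exact (ih hl hs.2).trans (PolyJoined.of_segment ((segment_symm ℝ d a).le.trans hs.1))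

/-! ### Nonplanarity of K₅ and K₃,₃ -/

/-- The parity functions of polygonal lines in a family of sets. -/
theorem PolyJoined.exists_parity {ι : Type*} {X : ι → Set Plane} {s t : ι → Plane}
    (h : ∀ i, PolyJoined (X i) (s i) (t i)) :
    ∃ u : ι → Plane → ZMod 2, ∀ i j, Disjoint (X i) (X j) →
      u j (s i) + u j (t i) + u i (s j) + u i (t j) + precedes (s i) (s j) + precedes (s i) (t j) +
        precedes (t i) (s j) + precedes (t i) (t j) = 0 := by
  choose l hl hs using h
  refine ⟨fun i z => aboveLine z (s i) (l i), fun i j hd => ?_⟩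
  have := aboveLine_parity (l i) (l j) (s i) (s j) (hd.mono (hs i) (hs j))
  rwa [hl, hl] at this

/-- The complete graph on five vertices is not planar: it has no drawing by polygonal lines in
which nonadjacent edges are disjoint. -/
theorem not_polyJoined_complete_five (q : Fin 5 → Plane) (X : Fin 5 → Fin 5 → Set Plane)
    (h : ∀ i j, PolyJoined (X i j) (q i) (q j))
    (hd : ∀ i j k l, i ≠ k → i ≠ l → j ≠ k → j ≠ l → Disjoint (X i j) (X k l)) : False := by
  obtain ⟨u, hu⟩ := PolyJoined.exists_parity (ι := Fin 5 × Fin 5) (X := fun p => X p.1 p.2)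
    (s := fun p => q p.1) (t := fun p => q p.2) fun p => h p.1 p.2
  -- The sets on the diagonal serve only to show that the five points are distinct.
  have mem : ∀ i, q i ∈ X i i := fun i =>
    let ⟨l, _, hs⟩ := h i i
    hs (mem_polyTrace _ l)
  have ne : ∀ i j, i ≠ j → q i ≠ q j := fun i j hij e =>
    Set.disjoint_left.mp (hd i i j j hij hij hij hij) (mem i) (e ▸ mem j)
  have sw : ∀ i j, i ≠ j → precedes (q j) (q i) = 1 + precedes (q i) (q j) := fun i j hij =>
    precedes_swap (ne i j hij)
  have eq : ∀ i j k l, i ≠ k → i ≠ l → j ≠ k → j ≠ l →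
      u (k, l) (q i) + u (k, l) (q j) + u (i, j) (q k) + u (i, j) (q l) +
        precedes (q i) (q k) + precedes (q i) (q l) + precedes (q j) (q k) +
        precedes (q j) (q l) = 0 :=
    fun i j k l h1 h2 h3 h4 => hu (i, j) (k, l) (hd i j k l h1 h2 h3 h4)
  have e0 := eq 0 1 2 3 (by decide) (by decide) (by decide) (by decide)
  have e1 := eq 0 1 2 4 (by decide) (by decide) (by decide) (by decide)
  have e2 := eq 0 1 3 4 (by decide) (by decide) (by decide) (by decide)
  have e3 := eq 0 2 1 3 (by decide) (by decide) (by decide) (by decide)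
  have e4 := eq 0 2 1 4 (by decide) (by decide) (by decide) (by decide)
  have e5 := eq 0 2 3 4 (by decide) (by decide) (by decide) (by decide)
  have e6 := eq 0 3 1 2 (by decide) (by decide) (by decide) (by decide)
  have e7 := eq 0 3 1 4 (by decide) (by decide) (by decide) (by decide)
  have e8 := eq 0 3 2 4 (by decide) (by decide) (by decide) (by decide)
  have e9 := eq 0 4 1 2 (by decide) (by decide) (by decide) (by decide)
  have e10 := eq 0 4 1 3 (by decide) (by decide) (by decide) (by decide)
  have e11 := eq 0 4 2 3 (by decide) (by decide) (by decide) (by decide)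
  have e12 := eq 1 2 3 4 (by decide) (by decide) (by decide) (by decide)
  have e13 := eq 1 3 2 4 (by decide) (by decide) (by decide) (by decide)
  have e14 := eq 1 4 2 3 (by decide) (by decide) (by decide) (by decide)
  -- In the sum over the fifteen pairs of nonadjacent edges each value of `u` occurs twice, and each
  -- precedence occurs six times once its indices are put in increasing order. Fifteen reorderings
  -- are needed, each of which adds `1`.
  have key : (1 : ZMod 2) = 0 := by
    linear_combination e0 + e1 + e2 + e3 + e4 + e5 + e6 + e7 + e8 + e9 + e10 + e11 + e12 + e13 + e14 - 2 * sw 1 2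
      (by decide) - 2 * sw 1 3 (by decide) - 3 * sw 2 3 (by decide) - 2 * sw 1 4 (by decide) - 3
      * sw 2 4 (by decide) - 3 * sw 3 4 (by decide) - (u (0, 1) (q 2) + u (0, 1) (q 3) + u (0,
      1) (q 4) + u (0, 2) (q 1) + u (0, 2) (q 3) + u (0, 2) (q 4) + u (0, 3) (q 1) + u (0, 3) (q
      2) + u (0, 3) (q 4) + u (0, 4) (q 1) + u (0, 4) (q 2) + u (0, 4) (q 3) + u (1, 2) (q 0) +
      u (1, 2) (q 3) + u (1, 2) (q 4) + u (1, 3) (q 0) + u (1, 3) (q 2) + u (1, 3) (q 4) + u (1,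
      4) (q 0) + u (1, 4) (q 2) + u (1, 4) (q 3) + u (2, 3) (q 0) + u (2, 3) (q 1) + u (2, 3) (q
      4) + u (2, 4) (q 0) + u (2, 4) (q 1) + u (2, 4) (q 3) + u (3, 4) (q 0) + u (3, 4) (q 1) +
      u (3, 4) (q 2) + 3 * precedes (q 0) (q 1) + 3 * precedes (q 0) (q 2) + 3 * precedes (q 0)
      (q 3) + 3 * precedes (q 0) (q 4) + 3 * precedes (q 1) (q 2) + 3 * precedes (q 1) (q 3) + 3
      * precedes (q 1) (q 4) + 3 * precedes (q 2) (q 3) + 3 * precedes (q 2) (q 4) + 3 *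
      precedes (q 3) (q 4) + 7) * two_eq_zero'
  exact absurd key (by decide)

/-- The complete bipartite graph with parts of size three is not planar: it has no drawing by
polygonal lines in which nonadjacent edges are disjoint. -/
theorem not_polyJoined_bipartite_three_three (a b : Fin 3 → Plane) (X : Fin 3 → Fin 3 → Set Plane)
    (h : ∀ i j, PolyJoined (X i j) (a i) (b j))
    (hd : ∀ i j k l, i ≠ k → j ≠ l → Disjoint (X i j) (X k l)) : False := by
  obtain ⟨u, hu⟩ := PolyJoined.exists_parity (ι := Fin 3 × Fin 3) (X := fun p => X p.1 p.2)
    (s := fun p => a p.1) (t := fun p => b p.2) fun p => h p.1 p.2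
  have mem : ∀ i j, a i ∈ X i j := fun i j =>
    let ⟨l, _, hs⟩ := h i j
    hs (mem_polyTrace _ l)
  have mem' : ∀ i j, b j ∈ X i j := fun i j =>
    let ⟨l, _, hs⟩ := (h i j).symm
    hs (mem_polyTrace _ l)
  have sa : ∀ i k, i ≠ k → precedes (a k) (a i) = 1 + precedes (a i) (a k) := fun i k hik =>
    precedes_swap fun e =>
      Set.disjoint_left.mp (hd i 0 k 1 hik (by decide)) (mem i 0) (e ▸ mem k 1)
  have sb : ∀ i k, i ≠ k → precedes (b k) (b i) = 1 + precedes (b i) (b k) := fun i k hik =>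
    precedes_swap fun e =>
      Set.disjoint_left.mp (hd 0 i 1 k (by decide) hik) (mem' 0 i) (e ▸ mem' 1 k)
  have ne1 : ∀ i : Fin 3, i ≠ i + 1 := by decide
  have sc : ∀ i j, precedes (b j) (a i) = 1 + precedes (a i) (b j) := fun i j =>
    precedes_swap fun e =>
      Set.disjoint_left.mp (hd i (j + 1) (i + 1) j (ne1 i) (ne1 j).symm)
        (mem i (j + 1)) (e ▸ mem' (i + 1) j)
  have eq : ∀ i j k l, i ≠ k → j ≠ l →
      u (k, l) (a i) + u (k, l) (b j) + u (i, j) (a k) + u (i, j) (b l) +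
        precedes (a i) (a k) + precedes (a i) (b l) + precedes (b j) (a k) +
        precedes (b j) (b l) = 0 :=
    fun i j k l h1 h2 => hu (i, j) (k, l) (hd i j k l h1 h2)
  have e0 := eq 0 0 1 1 (by decide) (by decide)
  have e1 := eq 0 0 1 2 (by decide) (by decide)
  have e2 := eq 0 0 2 1 (by decide) (by decide)
  have e3 := eq 0 0 2 2 (by decide) (by decide)
  have e4 := eq 0 1 1 0 (by decide) (by decide)
  have e5 := eq 0 1 1 2 (by decide) (by decide)
  have e6 := eq 0 1 2 0 (by decide) (by decide)
  have e7 := eq 0 1 2 2 (by decide) (by decide)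
  have e8 := eq 0 2 1 0 (by decide) (by decide)
  have e9 := eq 0 2 1 1 (by decide) (by decide)
  have e10 := eq 0 2 2 0 (by decide) (by decide)
  have e11 := eq 0 2 2 1 (by decide) (by decide)
  have e12 := eq 1 0 2 1 (by decide) (by decide)
  have e13 := eq 1 0 2 2 (by decide) (by decide)
  have e14 := eq 1 1 2 0 (by decide) (by decide)
  have e15 := eq 1 1 2 2 (by decide) (by decide)
  have e16 := eq 1 2 2 0 (by decide) (by decide)
  have e17 := eq 1 2 2 1 (by decide) (by decide)
  -- Now there are eighteen pairs. The values of `u` occur twice, the precedences within a class six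
  -- times and those between the classes four times; 27 reorderings contribute the odd rest.
  have key : (1 : ZMod 2) = 0 := by
    linear_combination e0 + e1 + e2 + e3 + e4 + e5 + e6 + e7 + e8 + e9 + e10 + e11 + e12 + e13 + e14 + e15 + e16
      + e17 - 2 * sc 1 0 - 4 * sc 2 0 - 2 * sc 1 1 - 3 * sb 0 1 (by decide) - 4 * sc 2 1 - 2 *
      sc 1 2 - 3 * sb 0 2 (by decide) - 3 * sb 1 2 (by decide) - 4 * sc 2 2 - (u (0, 0) (a 1) +
      u (0, 0) (a 2) + u (0, 0) (b 1) + u (0, 0) (b 2) + u (0, 1) (a 1) + u (0, 1) (a 2) + u (0,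
      1) (b 0) + u (0, 1) (b 2) + u (0, 2) (a 1) + u (0, 2) (a 2) + u (0, 2) (b 0) + u (0, 2) (b
      1) + u (1, 0) (a 0) + u (1, 0) (a 2) + u (1, 0) (b 1) + u (1, 0) (b 2) + u (1, 1) (a 0) +
      u (1, 1) (a 2) + u (1, 1) (b 0) + u (1, 1) (b 2) + u (1, 2) (a 0) + u (1, 2) (a 2) + u (1,
      2) (b 0) + u (1, 2) (b 1) + u (2, 0) (a 0) + u (2, 0) (a 1) + u (2, 0) (b 1) + u (2, 0) (b
      2) + u (2, 1) (a 0) + u (2, 1) (a 1) + u (2, 1) (b 0) + u (2, 1) (b 2) + u (2, 2) (a 0) +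
      u (2, 2) (a 1) + u (2, 2) (b 0) + u (2, 2) (b 1) + 3 * precedes (a 0) (a 1) + 3 * precedes
      (a 0) (a 2) + 2 * precedes (a 0) (b 0) + 2 * precedes (a 0) (b 1) + 2 * precedes (a 0) (b
      2) + 3 * precedes (a 1) (a 2) + 2 * precedes (a 1) (b 0) + 2 * precedes (a 1) (b 1) + 2 *
      precedes (a 1) (b 2) + 2 * precedes (a 2) (b 0) + 2 * precedes (a 2) (b 1) + 2 * precedes
      (a 2) (b 2) + 3 * precedes (b 0) (b 1) + 3 * precedes (b 0) (b 2) + 3 * precedes (b 1) (b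
      2) + 13) * two_eq_zero'
  exact absurd key (by decide)

end Plane

/-! ### Minors and disk graphs -/

namespace SimpleGraph

variable {α β ι V : Type*}

/-- The set `X` is nonempty and induces a connected subgraph: no nonempty proper subset of it is
closed under adjacency in it. -/
def IsConnSet (K : SimpleGraph α) (X : Set α) : Prop :=
  X.Nonempty ∧ ∀ A ⊆ X, A.Nonempty → (∀ a ∈ A, ∀ b ∈ X, K.Adj a b → b ∈ A) → X ⊆ A

theorem isConnSet_singleton (K : SimpleGraph α) (x : α) : K.IsConnSet {x} := by
  refine ⟨⟨x, rfl⟩, fun A hA ⟨a, ha⟩ _ => ?_⟩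
  obtain rfl : a = x := hA ha
  simpa using ha

/-- A closed subset contains every `φ x` that it meets, so the `x` with `φ x` inside it form a
closed subset of `X`. -/
theorem IsConnSet.iUnion {K : SimpleGraph α} {K' : SimpleGraph β} {X : Set α} {φ : α → Set β}
    (h : K.IsConnSet X) (hφ : ∀ x ∈ X, K'.IsConnSet (φ x))
    (hadj : ∀ x ∈ X, ∀ y ∈ X, K.Adj x y → ∃ a ∈ φ x, ∃ b ∈ φ y, K'.Adj a b) :
    K'.IsConnSet (⋃ x ∈ X, φ x) := by
  obtain ⟨x₀, hx₀⟩ := h.1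
  obtain ⟨b₀, hb₀⟩ := (hφ x₀ hx₀).1
  refine ⟨⟨b₀, Set.mem_biUnion hx₀ hb₀⟩, fun A hA ⟨a, ha⟩ hcl => ?_⟩
  have full : ∀ x ∈ X, (φ x ∩ A).Nonempty → φ x ⊆ A := fun x hx hne =>
    ((hφ x hx).2 (φ x ∩ A) Set.inter_subset_left hne fun c hc d hd hcd =>
      ⟨hd, hcl c hc.2 d (Set.mem_biUnion hx hd) hcd⟩).trans Set.inter_subset_right
  have key : X ⊆ {x | x ∈ X ∧ φ x ⊆ A} := by
    refine h.2 _ (fun x hx => hx.1) ?_ ?_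
    · obtain ⟨x, hx, hax⟩ := Set.mem_iUnion₂.mp (hA ha)
      exact ⟨x, hx, full x hx ⟨a, hax, ha⟩⟩
    · rintro x ⟨hx, hxA⟩ y hy hxy
      obtain ⟨c, hc, d, hd, hcd⟩ := hadj x hx y hy hxy
      exact ⟨hy, full y hy ⟨d, hd, hcl c (hxA hc) d (Set.mem_biUnion hy hd) hcd⟩⟩
  exact Set.iUnion₂_subset fun x hx => (key hx).2

theorem IsConnSet.union {K : SimpleGraph α} {X Y : Set α} (hX : K.IsConnSet X)
    (hY : K.IsConnSet Y) {x y : α} (hx : x ∈ X) (hy : y ∈ Y) (hxy : K.Adj x y) :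
    K.IsConnSet (X ∪ Y) := by
  refine ⟨hX.1.inl, fun A hA hne hcl => ?_⟩
  have fX : (X ∩ A).Nonempty → X ⊆ A := fun hne =>
    (hX.2 (X ∩ A) Set.inter_subset_left hne fun c hc d hd hcd =>
      ⟨hd, hcl c hc.2 d (Or.inl hd) hcd⟩).trans Set.inter_subset_right
  have fY : (Y ∩ A).Nonempty → Y ⊆ A := fun hne =>
    (hY.2 (Y ∩ A) Set.inter_subset_left hne fun c hc d hd hcd =>
      ⟨hd, hcl c hc.2 d (Or.inr hd) hcd⟩).trans Set.inter_subset_right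
  obtain ⟨a, ha⟩ := hne
  rcases hA ha with h | h
  · have h1 := fX ⟨a, h, ha⟩
    exact Set.union_subset h1 (fY ⟨y, hy, hcl x (h1 hx) y (Or.inr hy) hxy⟩)
  · have h1 := fY ⟨a, h, ha⟩
    exact Set.union_subset (fX ⟨x, hx, hcl y (h1 hy) x (Or.inl hx) hxy.symm⟩) h1

theorem IsConnSet.insert {K : SimpleGraph α} {X : Set α} (hX : K.IsConnSet X) {x y : α}
    (hx : x ∈ X) (hxy : K.Adj x y) : K.IsConnSet (insert y X) := by
  have := hX.union (K.isConnSet_singleton y) hx rfl hxy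
  rwa [Set.union_singleton] at this

/-- `H` is a minor of the subgraph of `K` induced by `D`. -/
def MinorIn (H : SimpleGraph ι) (K : SimpleGraph α) (D : Set α) : Prop :=
  ∃ B : ι → Set α, (∀ i, K.IsConnSet (B i)) ∧ (∀ i, B i ⊆ D) ∧
    (∀ i j, i ≠ j → Disjoint (B i) (B j)) ∧
    ∀ i j, H.Adj i j → ∃ x ∈ B i, ∃ y ∈ B j, K.Adj x y

/-- A minor of a minor is a minor: every vertex of a branch set is replaced by its own branch set `φ
d`. -/
theorem MinorIn.transfer {H : SimpleGraph ι} {K : SimpleGraph α} {K' : SimpleGraph β} {D : Set α}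
    {D' : Set β} (h : MinorIn H K D) (φ : α → Set β) (hconn : ∀ d ∈ D, K'.IsConnSet (φ d))
    (hsub : ∀ d ∈ D, φ d ⊆ D') (hdisj : ∀ d ∈ D, ∀ e ∈ D, d ≠ e → Disjoint (φ d) (φ e))
    (hadj : ∀ d ∈ D, ∀ e ∈ D, K.Adj d e → ∃ x ∈ φ d, ∃ y ∈ φ e, K'.Adj x y) :
    MinorIn H K' D' := by
  obtain ⟨B, hB1, hB2, hB3, hB4⟩ := h
  refine ⟨fun i => ⋃ x ∈ B i, φ x, fun i => ?_, fun i => ?_, fun i j hij => ?_,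
    fun i j hij => ?_⟩
  · exact (hB1 i).iUnion (fun x hx => hconn x (hB2 i hx))
      fun x hx y hy => hadj x (hB2 i hx) y (hB2 i hy)
  · exact Set.iUnion₂_subset fun x hx => hsub x (hB2 i hx)
  · simp only [Set.disjoint_iUnion_left, Set.disjoint_iUnion_right]
    exact fun x hx y hy => hdisj _ (hB2 _ ‹_›) _ (hB2 _ ‹_›)
      (by rintro rfl; exact Set.disjoint_left.mp (hB3 i j hij) ‹_› ‹_›)
  · obtain ⟨x, hx, y, hy, hxy⟩ := hB4 i j hij
    obtain ⟨a, ha, b, hb, hab⟩ := hadj x (hB2 i hx) y (hB2 j hy) hxy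
    exact ⟨a, Set.mem_biUnion hx ha, b, Set.mem_biUnion hy hb, hab⟩

/-- The graph `G` with a new vertex `none` that is adjacent to the vertices in `S`. -/
def cone (G : SimpleGraph V) (S : Set V) : SimpleGraph (Option V) where
  Adj a b := match a, b with
    | some x, some y => G.Adj x y
    | none, some s => s ∈ S
    | some s, none => s ∈ S
    | none, none => False
  symm := ⟨by rintro (_ | x) (_ | y) h <;> first | exact h | exact SimpleGraph.Adj.symm h⟩
  loopless := ⟨by rintro (_ | x) h <;> first | exact h | exact G.loopless.irrefl _ h⟩

/-- The vertices in `W` and the apex of the cone. -/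
def coneSet (W : Set V) : Set (Option V) := insert none (some '' W)

@[simp] theorem none_mem_coneSet (W : Set V) : none ∈ coneSet W := Or.inl rfl

@[simp] theorem some_mem_coneSet {W : Set V} {x : V} : some x ∈ coneSet W ↔ x ∈ W := by
  simp [coneSet]

theorem IsConnSet.cone {G : SimpleGraph V} {X : Set V} (h : G.IsConnSet X) (S : Set V) :
    (G.cone S).IsConnSet (some '' X) := by
  have := h.iUnion (K' := G.cone S) (φ := fun x => {some x})
    (fun x _ => isConnSet_singleton _ _) fun x _ y _ hxy => ⟨_, rfl, _, rfl, hxy⟩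
  convert this using 1; ext; simp [eq_comm]

end SimpleGraph

/-! ### Drawings in the plane have no forbidden minors -/

namespace Plane

/-- Balls are convex, so the points of `U` that are joined to `x` and those that are not both form
open sets. -/
theorem polyJoined_of_isPreconnected {U : Set Plane} (hU : IsOpen U) (hc : IsPreconnected U)
    {x y : Plane} (hx : x ∈ U) (hy : y ∈ U) : PolyJoined U x y := by
  have loc : ∀ z ∈ U, ∃ ε > 0, ∀ w ∈ Metric.ball z ε, PolyJoined U z w := fun z hz => by
    obtain ⟨ε, hε, hb⟩ := Metric.isOpen_iff.mp hU z hz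
    exact ⟨ε, hε, fun w hw => .of_segment
      (((convex_ball z ε).segment_subset (Metric.mem_ball_self hε) hw).trans hb)⟩
  have h1 : IsOpen {z | z ∈ U ∧ PolyJoined U x z} := by
    refine Metric.isOpen_iff.mpr fun z hz => ?_
    obtain ⟨ε, hε, hb⟩ := loc z hz.1
    obtain ⟨δ, hδ, hd⟩ := Metric.isOpen_iff.mp hU z hz.1
    exact ⟨min ε δ, lt_min hε hδ, fun w hw => ⟨hd (Metric.ball_subset_ball (min_le_right _ _) hw),
      hz.2.trans (hb w (Metric.ball_subset_ball (min_le_left _ _) hw))⟩⟩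
  have h2 : IsOpen {z | z ∈ U ∧ ¬ PolyJoined U x z} := by
    refine Metric.isOpen_iff.mpr fun z hz => ?_
    obtain ⟨ε, hε, hb⟩ := loc z hz.1
    obtain ⟨δ, hδ, hd⟩ := Metric.isOpen_iff.mp hU z hz.1
    exact ⟨min ε δ, lt_min hε hδ, fun w hw => ⟨hd (Metric.ball_subset_ball (min_le_right _ _) hw),
      fun h => hz.2 (h.trans (hb w (Metric.ball_subset_ball (min_le_left _ _) hw)).symm)⟩⟩
  have := hc.subset_left_of_subset_union h1 h2
    (Set.disjoint_left.mpr fun z hz hz' => hz'.2 hz.2)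
    (fun z hz => by
      by_cases h : PolyJoined U x z
      · exact Or.inl ⟨hz, h⟩
      · exact Or.inr ⟨hz, h⟩)
    ⟨x, hx, hx, .refl hx⟩
  exact (this hy).2

theorem one_lt_rank : 1 < Module.rank ℝ Plane := by
  rw [← Module.finrank_eq_rank, finrank_euclideanSpace, Fintype.card_fin]
  norm_num

/-- The radial push `x ↦ (1 + R / ‖x‖) x` maps the punctured plane, which is connected, onto this
set. -/
theorem isPreconnected_norm_gt {R : ℝ} (hR : 0 ≤ R) : IsPreconnected {x : Plane | R < ‖x‖} := by
  have h := (isConnected_compl_singleton_of_one_lt_rank one_lt_rank (0 : Plane)).isPreconnected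
  have him : (fun x : Plane => (1 + R / ‖x‖) • x) '' {0}ᶜ = {x : Plane | R < ‖x‖} := by
    ext y
    constructor
    · rintro ⟨x, hx, rfl⟩
      have hx' : 0 < ‖x‖ := norm_pos_iff.mpr hx
      simp only [Set.mem_ofPred_eq, norm_smul, Real.norm_eq_abs]
      rw [abs_of_pos (by positivity)]
      field_simp
      linarith
    · intro hy
      have hy' : R < ‖y‖ := hy
      have hy0 : 0 < ‖y‖ := hR.trans_lt hy'
      have hs : 0 < (‖y‖ - R) / ‖y‖ := div_pos (by linarith) hy0
      refine ⟨((‖y‖ - R) / ‖y‖) • y, ?_, ?_⟩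
      · exact smul_ne_zero hs.ne' (norm_pos_iff.mp hy0)
      · have hn : ‖((‖y‖ - R) / ‖y‖) • y‖ = ‖y‖ - R := by
          rw [norm_smul, Real.norm_eq_abs, abs_of_pos hs]; field_simp
        have hne : ‖y‖ - R ≠ 0 := by linarith
        simp only [hn]
        rw [smul_smul]
        have : (1 + R / (‖y‖ - R)) * ((‖y‖ - R) / ‖y‖) = 1 := by field_simp; ring
        rw [this, one_smul]
  rw [← him]
  refine h.image _ (ContinuousOn.smul (continuousOn_const.add
    (continuousOn_const.div continuous_norm.continuousOn fun x hx => ?_)) continuousOn_id)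
  exact (norm_pos_iff.mpr hx).ne'

end Plane

theorem IsPolygonalArc.isCompact {a b : Plane} {s : Set Plane} (h : IsPolygonalArc a b s) :
    IsCompact s := by
  have hseg : ∀ a b : Plane, IsCompact (segment ℝ a b) := fun a b => by
    rw [segment_eq_image]
    exact isCompact_Icc.image (by fun_prop)
  induction h with
  | single _ => exact hseg _ _
  | cons _ _ _ ih => exact (hseg _ _).union ih

theorem IsPolygonalArc.polyJoined {a b : Plane} {s : Set Plane} (h : IsPolygonalArc a b s) :
    Plane.PolyJoined s a b := by
  induction h with
  | single _ => exact .of_segment subset_rfl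
  | cons _ _ _ ih => exact .cons Set.subset_union_left (ih.mono Set.subset_union_right)

namespace SimpleGraph

variable {α : Type*}

/-- A map of the vertices of `K` to the plane together with regions for the sets of vertices,
such that disjoint sets of vertices have disjoint regions, and adjacent vertices are joined by a
polygonal line in their region. -/
structure PlaneRealization (K : SimpleGraph α) where
  /-- the position of a vertex -/
  pos : α → Plane
  /-- the region of a set of vertices -/
  region : Set α → Set Plane
  region_mono : Monotone region
  pos_mem : ∀ d, pos d ∈ region {d}
  disjoint_region : ∀ B B', Disjoint B B' → Disjoint (region B) (region B')
  joined : ∀ d e, K.Adj d e → Plane.PolyJoined (region {d, e}) (pos d) (pos e)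

namespace PlaneRealization

variable {K : SimpleGraph α}

theorem joined_of_mem (R : K.PlaneRealization) {B : Set α} {d e : α} (hd : d ∈ B) (he : e ∈ B) (h : K.Adj d e) :
    Plane.PolyJoined (R.region B) (R.pos d) (R.pos e) :=
  (R.joined d e h).mono (R.region_mono (by rintro x (rfl | rfl) <;> assumption))

theorem joined_of_isConnSet (R : K.PlaneRealization) {B : Set α} (hB : K.IsConnSet B) {d e : α} (hd : d ∈ B)
    (he : e ∈ B) : Plane.PolyJoined (R.region B) (R.pos d) (R.pos e) := by
  have := hB.2 {x | x ∈ B ∧ Plane.PolyJoined (R.region B) (R.pos d) (R.pos x)} (fun x hx => hx.1)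
    ⟨d, hd, .refl (R.region_mono (by simpa using hd) (R.pos_mem d))⟩
    fun a ha b hb hab => ⟨hb, ha.2.trans (R.joined_of_mem ha.1 hb hab)⟩
  exact (this he).2

theorem joined_of_adj (R : K.PlaneRealization) {B B' : Set α} (hB : K.IsConnSet B) (hB' : K.IsConnSet B') {d d' e e' : α}
    (hd : d ∈ B) (hd' : d' ∈ B) (he : e ∈ B') (he' : e' ∈ B') (h : K.Adj d' e') :
    Plane.PolyJoined (R.region (B ∪ B')) (R.pos d) (R.pos e) :=
  ((R.joined_of_isConnSet hB hd hd').mono (R.region_mono Set.subset_union_left)).trans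
    ((R.joined_of_mem (Or.inl hd') (Or.inr he') h).trans
      ((R.joined_of_isConnSet hB' he' he).mono (R.region_mono Set.subset_union_right)))

/-- Represent each branch set by one of its points and draw the edge between two branch sets in the
region of their union. Edges with a common end may overlap, but nonadjacent ones lie in disjoint
regions, and no more is required. -/
theorem not_minorIn_complete_five (R : K.PlaneRealization) (D : Set α) : ¬ MinorIn (⊤ : SimpleGraph (Fin 5)) K D := by
  rintro ⟨B, hc, -, hd, ha⟩
  choose q hq using fun i => (hc i).1
  refine Plane.not_polyJoined_complete_five (fun i => R.pos (q i))
    (fun i j => R.region (B i ∪ B j)) (fun i j => ?_) fun i j k l h1 h2 h3 h4 => ?_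
  · by_cases hij : i = j
    · subst hij
      exact (R.joined_of_isConnSet (hc i) (hq i) (hq i)).mono
        (R.region_mono Set.subset_union_left)
    · obtain ⟨x, hx, y, hy, hxy⟩ := ha i j hij
      exact R.joined_of_adj (hc i) (hc j) (hq i) hx (hq j) hy hxy
  · refine R.disjoint_region _ _ ?_
    simp only [Set.disjoint_union_left, Set.disjoint_union_right]
    exact ⟨⟨hd _ _ h1, hd _ _ h3⟩, hd _ _ h2, hd _ _ h4⟩

theorem not_minorIn_bipartite_three_three (R : K.PlaneRealization) (D : Set α) :
    ¬ MinorIn (completeBipartiteGraph (Fin 3) (Fin 3)) K D := by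
  rintro ⟨B, hc, -, hd, ha⟩
  choose q hq using fun i => (hc i).1
  refine Plane.not_polyJoined_bipartite_three_three (fun i => R.pos (q (Sum.inl i)))
    (fun i => R.pos (q (Sum.inr i)))
    (fun i j => R.region (B (Sum.inl i) ∪ B (Sum.inr j))) (fun i j => ?_) fun i j k l h1 h2 => ?_
  · obtain ⟨x, hx, y, hy, hxy⟩ := ha (Sum.inl i) (Sum.inr j) (by simp)
    exact R.joined_of_adj (hc _) (hc _) (hq _) hx (hq _) hy hxy
  · refine R.disjoint_region _ _ ?_
    simp only [Set.disjoint_union_left, Set.disjoint_union_right]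
    exact ⟨⟨hd _ _ (by simpa using h1), hd _ _ (by simp)⟩, hd _ _ (by simp),
      hd _ _ (by simpa using h2)⟩

end PlaneRealization

/-- The cone over `S` of the subgraph of `G` induced by `W` has none of the two forbidden minors
of planar graphs. -/
structure IsDisk {V : Type*} (G : SimpleGraph V) (W S : Set V) : Prop where
  not_complete : ¬ MinorIn (⊤ : SimpleGraph (Fin 5)) (G.cone S) (coneSet W)
  not_bipartite : ¬ MinorIn (completeBipartiteGraph (Fin 3) (Fin 3)) (G.cone S) (coneSet W)

end SimpleGraph

namespace PlaneDrawing

variable {V : Type*} {G : SimpleGraph V} (D : PlaneDrawing G)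

theorem isCompact_arc (e : G.edgeSet) : IsCompact (D.arc e) := by
  obtain ⟨e, he⟩ := e
  induction e with
  | h u v => exact (D.isPolygonalArc u v he).isCompact

/-- The region of a set of vertices of the cone over the outer vertices, where the balls around
the vertices have radius `ε`. -/
def coneRegion (ε : ℝ) (B : Set (Option V)) : Set Plane :=
  (D.point '' {x | some x ∈ B}) ∪
    (⋃ e ∈ {e : G.edgeSet | ∀ x ∈ (e : Sym2 V), some x ∈ B}, D.arc e) ∪
    {p | none ∈ B ∧ (p ∈ D.outerFace ∨ ∃ s, some s ∈ B ∧ p ∈ Metric.ball (D.point s) ε)}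

theorem coneRegion_mono (ε : ℝ) : Monotone (D.coneRegion ε) := by
  rintro B B' h p ((⟨x, hx, rfl⟩ | hp) | ⟨hn, hp⟩)
  · exact Or.inl (Or.inl ⟨x, h hx, rfl⟩)
  · obtain ⟨e, he, hp⟩ := Set.mem_iUnion₂.mp hp
    exact Or.inl (Or.inr (Set.mem_iUnion₂.mpr ⟨e, fun x hx => h (he x hx), hp⟩))
  · refine Or.inr ⟨h hn, hp.imp_right ?_⟩
    rintro ⟨s, hs, hp⟩
    exact ⟨s, h hs, hp⟩

/-- Arcs meet only in a common end, which would belong to both sets; the ball at `s` meets no other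
vertex and only arcs that end in `s`; the outer face avoids the drawing. Only one of the two sets
can contain the apex, so overlaps of balls with each other or with the outer face do no harm. -/
theorem disjoint_coneRegion {ε : ℝ} (hε : ∀ s : V,
    (∀ v, v ≠ s → D.point v ∉ Metric.ball (D.point s) ε) ∧
    ∀ e : G.edgeSet, s ∉ (e : Sym2 V) → Disjoint (Metric.ball (D.point s) ε) (D.arc e))
    (B B' : Set (Option V)) (h : Disjoint B B') :
    Disjoint (D.coneRegion ε B) (D.coneRegion ε B') := by
  have hB : ∀ {x}, x ∈ B → x ∉ B' := fun hx => Set.disjoint_left.mp h hx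
  have not_mem : ∀ {C C' : Set (Option V)}, Disjoint C C' → ∀ {e : G.edgeSet},
      (∀ x ∈ (e : Sym2 V), some x ∈ C) → ∀ {x}, some x ∈ C' → x ∉ (e : Sym2 V) :=
    fun hC e he x hx hxe => Set.disjoint_left.mp hC (he x hxe) hx
  have outer : ∀ {p}, p ∈ D.outerFace → p ∉ D.carrier := fun hp => hp.1
  rw [Set.disjoint_left]
  rintro p ((⟨x, hx, rfl⟩ | hp) | ⟨hn, hp⟩) ((⟨y, hy, hxy⟩ | hp') | ⟨hn', hp'⟩)
  · exact hB hx (D.point_injective hxy ▸ hy)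
  · obtain ⟨e, he, hp'⟩ := Set.mem_iUnion₂.mp hp'
    exact not_mem h.symm he hx (D.mem_of_point_mem_arc e x hp')
  · rcases hp' with hp' | ⟨s, hs, hp'⟩
    · exact outer hp' (Or.inl ⟨x, rfl⟩)
    · exact (hε s).1 x (by rintro rfl; exact hB hx hs) hp'
  · obtain ⟨e, he, hp⟩ := Set.mem_iUnion₂.mp hp
    subst hxy
    exact not_mem h he hy (D.mem_of_point_mem_arc e y hp)
  · obtain ⟨e, he, hp⟩ := Set.mem_iUnion₂.mp hp
    obtain ⟨f, hf, hp'⟩ := Set.mem_iUnion₂.mp hp'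
    have hef : e ≠ f := by
      rintro rfl
      obtain ⟨e, h'⟩ := e
      induction e with
      | h u v => exact hB (he u (by simp)) (hf u (by simp))
    obtain ⟨w, rfl⟩ := D.arc_inter_subset e f hef ⟨hp, hp'⟩
    exact not_mem h.symm hf (he w (D.mem_of_point_mem_arc e w hp))
      (D.mem_of_point_mem_arc f w hp')
  · obtain ⟨e, he, hp⟩ := Set.mem_iUnion₂.mp hp
    rcases hp' with hp' | ⟨s, hs, hp'⟩
    · exact outer hp' (Or.inr (Set.mem_iUnion.mpr ⟨e, hp⟩))
    · exact Set.disjoint_left.mp ((hε s).2 e (not_mem h he hs)) hp' hp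
  · subst hxy
    rcases hp with hp | ⟨s, hs, hp⟩
    · exact outer hp (Or.inl ⟨y, rfl⟩)
    · exact (hε s).1 y (by rintro rfl; exact hB hs hy) hp
  · obtain ⟨e, he, hp'⟩ := Set.mem_iUnion₂.mp hp'
    rcases hp with hp | ⟨s, hs, hp⟩
    · exact outer hp (Or.inr (Set.mem_iUnion.mpr ⟨e, hp'⟩))
    · exact Set.disjoint_left.mp ((hε s).2 e (not_mem h.symm he hs)) hp hp'
  · exact hB hn hn'

variable [Finite V]

theorem isCompact_carrier : IsCompact D.carrier :=
  (Set.finite_range D.point).isCompact.union (isCompact_iUnion D.isCompact_arc)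

/-- The carrier lies in a disk, and the connected exterior of this disk lies in a single component
of the complement. Any unbounded component reaches the exterior, hence equals that one. -/
theorem exists_outerFace_eq : ∃ o ∈ D.outerFace,
    D.outerFace = connectedComponentIn D.carrierᶜ o := by
  obtain ⟨R, hR0, hR⟩ := D.isCompact_carrier.isBounded.exists_pos_norm_le
  have hfar : {x : Plane | R < ‖x‖} ⊆ D.carrierᶜ := fun x hx hx' => (hR x hx').not_gt hx
  have hpre := Plane.isPreconnected_norm_gt hR0.le
  obtain ⟨o, ho⟩ : ∃ o : Plane, R < ‖o‖ := NormedSpace.exists_lt_norm ℝ Plane R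
  have hunb : ¬ Bornology.IsBounded {x : Plane | R < ‖x‖} := fun hb => by
    obtain ⟨C, hC⟩ := hb.exists_norm_le
    obtain ⟨z, hz⟩ := NormedSpace.exists_lt_norm ℝ Plane (max C R)
    exact (hC z ((le_max_right _ _).trans_lt hz)).not_gt ((le_max_left _ _).trans_lt hz)
  have hsub := hpre.subset_connectedComponentIn ho hfar
  have hou : ¬ Bornology.IsBounded (connectedComponentIn D.carrierᶜ o) := fun hb =>
    hunb (hb.subset hsub)
  have key : D.outerFace = connectedComponentIn D.carrierᶜ o := by
    ext x
    constructor
    · rintro ⟨hx, hxu⟩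
      obtain ⟨y, hy, hyR⟩ : ∃ y ∈ connectedComponentIn D.carrierᶜ x, R < ‖y‖ := by
        by_contra h
        push Not at h
        exact hxu ((Metric.isBounded_closedBall (x := (0 : Plane)) (r := R)).subset fun y hy => by
          simpa using h y hy)
      rw [connectedComponentIn_eq (hsub hyR), ← connectedComponentIn_eq hy]
      exact mem_connectedComponentIn hx
    · intro hx
      exact ⟨connectedComponentIn_subset _ _ hx, by rwa [← connectedComponentIn_eq hx]⟩
  exact ⟨o, key ▸ mem_connectedComponentIn (hfar ho), key⟩

theorem isOpen_outerFace : IsOpen D.outerFace := by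
  obtain ⟨o, -, h⟩ := D.exists_outerFace_eq
  rw [h]
  exact D.isCompact_carrier.isClosed.isOpen_compl.connectedComponentIn

theorem isPreconnected_outerFace : IsPreconnected D.outerFace := by
  obtain ⟨o, -, h⟩ := D.exists_outerFace_eq
  rw [h]
  exact isPreconnected_connectedComponentIn

theorem exists_radius : ∃ ε > 0, ∀ s : V,
    (∀ v, v ≠ s → D.point v ∉ Metric.ball (D.point s) ε) ∧
    ∀ e : G.edgeSet, s ∉ (e : Sym2 V) → Disjoint (Metric.ball (D.point s) ε) (D.arc e) := by
  have loc : ∀ s : V, ∃ ε > 0,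
      (∀ v, v ≠ s → D.point v ∉ Metric.ball (D.point s) ε) ∧
      ∀ e : G.edgeSet, s ∉ (e : Sym2 V) → Disjoint (Metric.ball (D.point s) ε) (D.arc e) := by
    intro s
    let K : Set Plane := (D.point '' {v | v ≠ s}) ∪
      ⋃ e : {e : G.edgeSet // s ∉ (e : Sym2 V)}, D.arc e.1
    have hK : IsCompact K :=
      ((Set.toFinite _).image _).isCompact.union (isCompact_iUnion fun e => D.isCompact_arc e.1)
    have hs : D.point s ∈ Kᶜ := by
      rintro (⟨v, hv, hvs⟩ | h)
      · exact hv (D.point_injective hvs)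
      · obtain ⟨e, he⟩ := Set.mem_iUnion.mp h
        exact e.2 (D.mem_of_point_mem_arc e.1 s he)
    obtain ⟨ε, hε, hb⟩ := Metric.isOpen_iff.mp hK.isClosed.isOpen_compl _ hs
    refine ⟨ε, hε, fun v hv h => hb h (Or.inl ⟨v, hv, rfl⟩), fun e he => ?_⟩
    exact Set.disjoint_left.mpr fun x hx hx' =>
      hb hx (Or.inr (Set.mem_iUnion.mpr ⟨⟨e, he⟩, hx'⟩))
  choose ε hε h1 h2 using loc
  obtain ⟨δ, hδ, hle⟩ : ∃ δ > 0, ∀ s, δ ≤ ε s := by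
    cases isEmpty_or_nonempty V
    · exact ⟨1, one_pos, fun s => isEmptyElim s⟩
    · obtain ⟨s₀, hs₀⟩ := Finite.exists_min ε
      exact ⟨ε s₀, hε s₀, hs₀⟩
  exact ⟨δ, hδ, fun s => ⟨fun v hv h => h1 s v hv (Metric.ball_subset_ball (hle s) h),
    fun e he => (h2 s e he).mono_left (Metric.ball_subset_ball (hle s))⟩⟩

/-- The cone over the vertices on the boundary of the outer face is realized in the plane. -/
theorem nonempty_planeRealization :
    Nonempty (G.cone D.outerBoundary.verts).PlaneRealization := by
  obtain ⟨ε, hε0, hε⟩ := D.exists_radius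
  obtain ⟨o, ho, -⟩ := D.exists_outerFace_eq
  have hpt : ∀ (B : Set (Option V)) x, some x ∈ B → D.point x ∈ D.coneRegion ε B :=
    fun B x hx => Or.inl (Or.inl ⟨x, hx, rfl⟩)
  have hcone : ∀ s ∈ D.outerBoundary.verts,
      Plane.PolyJoined (D.coneRegion ε {none, some s}) o (D.point s) := by
    intro s hs
    have hs' : D.point s ∈ closure D.outerFace := frontier_subset_closure hs
    obtain ⟨y, hy, hys⟩ := Metric.mem_closure_iff.mp hs' ε hε0
    -- Go inside the face to a point within `ε` of the vertex, then straight to the vertex. The last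
    -- piece may leave the face; the ball belongs to the region, so no accessibility of boundary
    -- points is needed.
    refine ((Plane.polyJoined_of_isPreconnected D.isOpen_outerFace D.isPreconnected_outerFace ho
      hy).mono fun p hp => Or.inr ⟨by simp, Or.inl hp⟩).trans (.of_segment ?_)
    refine ((convex_ball (D.point s) ε).segment_subset ?_ (Metric.mem_ball_self hε0)).trans
      fun p hp => Or.inr ⟨by simp, Or.inr ⟨s, by simp, hp⟩⟩
    rwa [Metric.mem_ball, dist_comm]
  refine ⟨⟨fun d => d.elim o D.point, D.coneRegion ε, D.coneRegion_mono ε, ?_,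
    D.disjoint_coneRegion hε, ?_⟩⟩
  · rintro (_ | x)
    · exact Or.inr ⟨rfl, Or.inl ho⟩
    · exact hpt _ x rfl
  · rintro (_ | x) (_ | y) h
    · exact h.elim
    · exact hcone y h
    · rw [Set.pair_comm]
      exact (hcone x h).symm
    · have h' : G.Adj x y := h
      refine (D.isPolygonalArc x y h').polyJoined.mono fun p hp => Or.inl (Or.inr ?_)
      refine Set.mem_iUnion₂.mpr ⟨⟨s(x, y), h'⟩, ?_, hp⟩
      intro z hz
      rcases Sym2.mem_iff.mp hz with rfl | rfl <;> simp

theorem isDisk : G.IsDisk Set.univ D.outerBoundary.verts := by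
  obtain ⟨R⟩ := D.nonempty_planeRealization
  exact ⟨R.not_minorIn_complete_five _, R.not_minorIn_bipartite_three_three _⟩

end PlaneDrawing

/-! ### Disk graphs -/

namespace SimpleGraph

variable {V : Type*} {G : SimpleGraph V}

/-- Some vertex of `X` is adjacent to some vertex of `Y`. -/
def Touches (G : SimpleGraph V) (X Y : Set V) : Prop := ∃ x ∈ X, ∃ y ∈ Y, G.Adj x y

theorem Touches.symm {X Y : Set V} (h : G.Touches X Y) : G.Touches Y X :=
  let ⟨x, hx, y, hy, hxy⟩ := h
  ⟨y, hy, x, hx, hxy.symm⟩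

theorem touches_singleton {x y : V} (h : G.Adj x y) : G.Touches {x} {y} := ⟨x, rfl, y, rfl, h⟩

/-! ### Reachable sets -/

/-- The vertices that are reachable in `R` from the vertices of `D`. -/
def reach (G : SimpleGraph V) (R D : Set V) : Set V :=
  {b | ∃ a ∈ D, Relation.ReflTransGen (fun p q => G.Adj p q ∧ q ∈ R) a b}

theorem subset_reach (R D : Set V) : D ⊆ G.reach R D := fun a ha => ⟨a, ha, .refl⟩

theorem reach_closed {R D : Set V} {a b : V} (ha : a ∈ G.reach R D) (hb : b ∈ R)
    (h : G.Adj a b) : b ∈ G.reach R D :=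
  let ⟨d, hd, hda⟩ := ha
  ⟨d, hd, hda.tail ⟨h, hb⟩⟩

theorem reach_subset {R D A : Set V} (hD : D ⊆ A)
    (h : ∀ a ∈ A, ∀ b ∈ R, G.Adj a b → b ∈ A) : G.reach R D ⊆ A := by
  rintro b ⟨a, ha, hab⟩
  induction hab with
  | refl => exact hD ha
  | tail _ hbc ih => exact h _ ih _ hbc.2 hbc.1

theorem reach_subset_self {R D : Set V} (hD : D ⊆ R) : G.reach R D ⊆ R :=
  reach_subset hD fun _ _ _ hb _ => hb

theorem reach_isConnSet {R D : Set V} (hD : G.IsConnSet D) :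
    G.IsConnSet (G.reach R D) := by
  refine ⟨hD.1.mono (subset_reach R D), fun A hA ⟨a, ha⟩ hcl => ?_⟩
  have hmeet : (D ∩ A).Nonempty := by
    obtain ⟨d, hd, hda⟩ := hA ha
    have : ∀ b, Relation.ReflTransGen (fun p q => G.Adj p q ∧ q ∈ R) d b → b ∈ A → d ∈ A := by
      intro b hb
      induction hb with
      | refl => exact id
      | tail hpre hbc ih => exact fun hcA => ih (hcl _ hcA _ ⟨d, hd, hpre⟩ hbc.1.symm)
    exact ⟨d, hd, this a hda ha⟩
  have hDA : D ⊆ A := (hD.2 (D ∩ A) Set.inter_subset_left hmeet fun c hc d hd hcd =>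
    ⟨hd, hcl c hc.2 d (subset_reach R D hd) hcd⟩).trans Set.inter_subset_right
  rintro b ⟨d, hd, hdb⟩
  induction hdb with
  | refl => exact hDA hd
  | tail hpre hbc ih => exact hcl _ ih _ ⟨d, hd, hpre.tail hbc⟩ hbc.1

theorem IsConnSet.subset_of_inter {X A : Set V} (h : G.IsConnSet X) (hne : (X ∩ A).Nonempty)
    (hcl : ∀ a ∈ X, a ∈ A → ∀ b ∈ X, G.Adj a b → b ∈ A) : X ⊆ A :=
  (h.2 (X ∩ A) Set.inter_subset_left hne fun a ha b hb hab =>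
    ⟨hb, hcl a ha.1 ha.2 b hb hab⟩).trans Set.inter_subset_right

theorem IsConnSet.subset_reach {X R D : Set V} (h : G.IsConnSet X) (hXR : X ⊆ R)
    (hne : (X ∩ G.reach R D).Nonempty) : X ⊆ G.reach R D :=
  h.subset_of_inter hne fun _ _ ha _ hb hab => reach_closed ha (hXR hb) hab

theorem isConnSet_pair {x y : V} (h : G.Adj x y) : G.IsConnSet {x, y} := by
  rw [Set.pair_comm]
  exact (G.isConnSet_singleton x).insert rfl h

theorem isConnSet_of_star {P : Set V} {v : V} (hv : v ∈ P)
    (h : ∀ p ∈ P, p ≠ v → G.Adj v p) : G.IsConnSet P := by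
  refine ⟨⟨v, hv⟩, fun A hA ⟨a, ha⟩ hcl => ?_⟩
  have hvA : v ∈ A := by
    by_cases hav : a = v
    · exact hav ▸ ha
    · exact hcl a ha v hv (h a (hA ha) hav).symm
  intro p hp
  by_cases hpv : p = v
  · exact hpv ▸ hvA
  · exact hcl v hvA p hp (h p hp hpv)

namespace IsDisk

variable {W S : Set V}

/-- The apex is the fifth branch set; it is adjacent to the others because they meet `S`. -/
theorem false_of_complete (h : G.IsDisk W S) {X₁ X₂ X₃ X₄ : Set V} (c₁ : G.IsConnSet X₁)
    (c₂ : G.IsConnSet X₂) (c₃ : G.IsConnSet X₃) (c₄ : G.IsConnSet X₄) (w₁ : X₁ ⊆ W) (w₂ : X₂ ⊆ W)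
    (w₃ : X₃ ⊆ W) (w₄ : X₄ ⊆ W) (s₁ : (X₁ ∩ S).Nonempty) (s₂ : (X₂ ∩ S).Nonempty)
    (s₃ : (X₃ ∩ S).Nonempty) (s₄ : (X₄ ∩ S).Nonempty) (d₁₂ : Disjoint X₁ X₂)
    (d₁₃ : Disjoint X₁ X₃) (d₁₄ : Disjoint X₁ X₄) (d₂₃ : Disjoint X₂ X₃) (d₂₄ : Disjoint X₂ X₄)
    (d₃₄ : Disjoint X₃ X₄) (t₁₂ : G.Touches X₁ X₂) (t₁₃ : G.Touches X₁ X₃)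
    (t₁₄ : G.Touches X₁ X₄) (t₂₃ : G.Touches X₂ X₃) (t₂₄ : G.Touches X₂ X₄)
    (t₃₄ : G.Touches X₃ X₄) : False := by
  let X : Fin 4 → Set V := ![X₁, X₂, X₃, X₄]
  have c : ∀ i, G.IsConnSet (X i) := by
    intro i; fin_cases i <;> assumption
  have w : ∀ i, X i ⊆ W := by
    intro i; fin_cases i <;> assumption
  have s : ∀ i, (X i ∩ S).Nonempty := by
    intro i; fin_cases i <;> assumption
  have d : ∀ i j, i ≠ j → Disjoint (X i) (X j) := by
    intro i j hij
    fin_cases i <;> fin_cases j <;>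
      first | exact absurd rfl hij | assumption | (apply Disjoint.symm; assumption)
  have t : ∀ i j, i ≠ j → G.Touches (X i) (X j) := by
    intro i j hij
    fin_cases i <;> fin_cases j <;>
      first | exact absurd rfl hij | assumption | (apply Touches.symm; assumption)
  refine h.not_complete ⟨Fin.cons {none} fun i => some '' X i, ?_, ?_, ?_, ?_⟩
  · exact Fin.cases (isConnSet_singleton _ _) fun i => (c i).cone S
  · refine Fin.cases (by simp) fun i => ?_
    rintro _ ⟨x, hx, rfl⟩
    simpa using w i hx
  · intro i j
    cases i using Fin.cases <;> cases j using Fin.cases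
    · intro hij; exact absurd rfl hij
    · intro; simp
    · intro; simp
    · intro hij
      exact (Set.disjoint_image_iff (Option.some_injective V)).mpr
        (d _ _ fun e => hij (congrArg Fin.succ e))
  · intro i j hij
    cases i using Fin.cases <;> cases j using Fin.cases
    · exact absurd rfl hij
    · rename_i j
      obtain ⟨x, hx, hxS⟩ := s j
      exact ⟨none, rfl, some x, ⟨x, hx, rfl⟩, hxS⟩
    · rename_i j
      obtain ⟨x, hx, hxS⟩ := s j
      exact ⟨some x, ⟨x, hx, rfl⟩, none, rfl, hxS⟩
    · rename_i i j
      obtain ⟨x, hx, y, hy, hxy⟩ := t i j fun e => hij (congrArg Fin.succ e)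
      exact ⟨some x, ⟨x, hx, rfl⟩, some y, ⟨y, hy, rfl⟩, hxy⟩

/-- The apex joins the side of `X₁` and `X₂`, so only the three sets on the opposite side have to
meet `S`. -/
theorem false_of_bipartite (h : G.IsDisk W S) {X₁ X₂ Y₁ Y₂ Y₃ : Set V} (c₁ : G.IsConnSet X₁)
    (c₂ : G.IsConnSet X₂) (e₁ : G.IsConnSet Y₁) (e₂ : G.IsConnSet Y₂) (e₃ : G.IsConnSet Y₃)
    (w₁ : X₁ ⊆ W) (w₂ : X₂ ⊆ W) (v₁ : Y₁ ⊆ W) (v₂ : Y₂ ⊆ W) (v₃ : Y₃ ⊆ W)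
    (s₁ : (Y₁ ∩ S).Nonempty) (s₂ : (Y₂ ∩ S).Nonempty) (s₃ : (Y₃ ∩ S).Nonempty)
    (d : Disjoint X₁ X₂) (d₁₂ : Disjoint Y₁ Y₂) (d₁₃ : Disjoint Y₁ Y₃) (d₂₃ : Disjoint Y₂ Y₃)
    (f₁₁ : Disjoint X₁ Y₁) (f₁₂ : Disjoint X₁ Y₂) (f₁₃ : Disjoint X₁ Y₃) (f₂₁ : Disjoint X₂ Y₁)
    (f₂₂ : Disjoint X₂ Y₂) (f₂₃ : Disjoint X₂ Y₃) (t₁₁ : G.Touches X₁ Y₁)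
    (t₁₂ : G.Touches X₁ Y₂) (t₁₃ : G.Touches X₁ Y₃) (t₂₁ : G.Touches X₂ Y₁)
    (t₂₂ : G.Touches X₂ Y₂) (t₂₃ : G.Touches X₂ Y₃) : False := by
  let X : Fin 2 → Set V := ![X₁, X₂]
  let Y : Fin 3 → Set V := ![Y₁, Y₂, Y₃]
  have cX : ∀ i, G.IsConnSet (X i) := by
    intro i; fin_cases i <;> assumption
  have cY : ∀ i, G.IsConnSet (Y i) := by
    intro i; fin_cases i <;> assumption
  have wX : ∀ i, X i ⊆ W := by
    intro i; fin_cases i <;> assumption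
  have wY : ∀ i, Y i ⊆ W := by
    intro i; fin_cases i <;> assumption
  have s : ∀ i, (Y i ∩ S).Nonempty := by
    intro i; fin_cases i <;> assumption
  have dX : ∀ i j, i ≠ j → Disjoint (X i) (X j) := by
    intro i j hij
    fin_cases i <;> fin_cases j <;>
      first | exact absurd rfl hij | assumption | (apply Disjoint.symm; assumption)
  have dY : ∀ i j, i ≠ j → Disjoint (Y i) (Y j) := by
    intro i j hij
    fin_cases i <;> fin_cases j <;>
      first | exact absurd rfl hij | assumption | (apply Disjoint.symm; assumption)
  have dXY : ∀ i j, Disjoint (X i) (Y j) := by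
    intro i j
    fin_cases i <;> fin_cases j <;> assumption
  have t : ∀ i j, G.Touches (X i) (Y j) := by
    intro i j
    fin_cases i <;> fin_cases j <;> assumption
  let B : Fin 3 → Set (Option V) := Fin.cons {none} fun i => some '' X i
  have hXY : ∀ i j, Disjoint (B i) (some '' Y j) := by
    intro i j
    cases i using Fin.cases
    · simp [B]
    · exact (Set.disjoint_image_iff (Option.some_injective V)).mpr (dXY _ _)
  have ht : ∀ i j, ∃ x ∈ B i, ∃ y ∈ some '' Y j, (G.cone S).Adj x y := by
    intro i j
    cases i using Fin.cases
    · obtain ⟨x, hx, hxS⟩ := s j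
      exact ⟨none, rfl, some x, ⟨x, hx, rfl⟩, hxS⟩
    · rename_i i
      obtain ⟨x, hx, y, hy, hxy⟩ := t i j
      exact ⟨some x, ⟨x, hx, rfl⟩, some y, ⟨y, hy, rfl⟩, hxy⟩
  refine h.not_bipartite ⟨Sum.elim B fun i => some '' Y i, ?_, ?_, ?_, ?_⟩
  · rintro (i | i)
    · cases i using Fin.cases
      · exact isConnSet_singleton _ _
      · exact (cX _).cone S
    · exact (cY i).cone S
  · rintro (i | i)
    · cases i using Fin.cases
      · simp [B]
      · rintro _ ⟨x, hx, rfl⟩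
        simpa using wX _ hx
    · rintro _ ⟨x, hx, rfl⟩
      simpa using wY i hx
  · rintro (i | i) (j | j) hij
    · cases i using Fin.cases <;> cases j using Fin.cases
      · exact absurd rfl hij
      · simp [B]
      · simp [B]
      · exact (Set.disjoint_image_iff (Option.some_injective V)).mpr
          (dX _ _ fun e => hij (congrArg (fun k : Fin 2 => Sum.inl k.succ) e))
    · exact hXY i j
    · exact (hXY j i).symm
    · exact (Set.disjoint_image_iff (Option.some_injective V)).mpr
        (dY _ _ fun e => hij (by rw [e]))
  · rintro (i | i) (j | j) hij
    · simp at hij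
    · exact ht i j
    · obtain ⟨x, hx, y, hy, hxy⟩ := ht j i
      exact ⟨y, hy, x, hx, hxy.symm⟩
    · simp at hij

theorem transfer {G' : SimpleGraph V} {W' S' : Set V} (h : G.IsDisk W S)
    (φ : Option V → Set (Option V)) (hconn : ∀ d ∈ coneSet W', (G.cone S).IsConnSet (φ d))
    (hsub : ∀ d ∈ coneSet W', φ d ⊆ coneSet W)
    (hdisj : ∀ d ∈ coneSet W', ∀ e ∈ coneSet W', d ≠ e → Disjoint (φ d) (φ e))
    (hadj : ∀ d ∈ coneSet W', ∀ e ∈ coneSet W', (G'.cone S').Adj d e →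
      ∃ x ∈ φ d, ∃ y ∈ φ e, (G.cone S).Adj x y) : G'.IsDisk W' S' :=
  ⟨fun h' => h.not_complete (h'.transfer φ hconn hsub hdisj hadj),
    fun h' => h.not_bipartite (h'.transfer φ hconn hsub hdisj hadj)⟩

/-- Contract a connected set `Y` of vertices of the cone to the apex, and a connected set `Z` of
vertices to the vertex `z`. -/
theorem contract₂ {G' : SimpleGraph V} {W' S' : Set V} (h : G.IsDisk W S) {Y : Set (Option V)}
    {Z : Set V} {z : V} (hY : (G.cone S).IsConnSet Y) (hYW : Y ⊆ coneSet W) (hZ : G.IsConnSet Z)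
    (hZW : Z ⊆ W) (hYZ : ∀ x ∈ Z, some x ∉ Y) (hW' : ∀ x ∈ W', x ≠ z → x ∈ W ∧ some x ∉ Y ∧ x ∉ Z)
    (hadj : ∀ x ∈ W', x ≠ z → ∀ y ∈ W', y ≠ z → G'.Adj x y → G.Adj x y)
    (hz : ∀ x ∈ W', x ≠ z → G'.Adj z x → ∃ y ∈ Z, G.Adj y x)
    (hS : ∀ x ∈ W', x ≠ z → x ∈ S' → ∃ y ∈ Y, (G.cone S).Adj y (some x))
    (hzS : z ∈ W' → z ∈ S' → ∃ y ∈ Y, ∃ x ∈ Z, (G.cone S).Adj y (some x)) :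
    G'.IsDisk W' S' := by
  classical
  let φ : Option V → Set (Option V) := fun d => d.elim Y fun x => some '' if x = z then Z else {x}
  have φz : φ (some z) = some '' Z := by simp [φ]
  have φx : ∀ {x}, x ≠ z → φ (some x) = {some x} := fun hx => by simp [φ, hx]
  refine h.transfer φ ?_ ?_ ?_ ?_
  · rintro (_ | x) hd
    · exact hY
    · by_cases hx : x = z
      · rw [hx, φz]; exact hZ.cone S
      · rw [φx hx]; exact isConnSet_singleton _ _
  · rintro (_ | x) hd
    · exact hYW
    · by_cases hx : x = z
      · rw [hx, φz]
        rintro _ ⟨y, hy, rfl⟩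
        simpa using hZW hy
      · rw [φx hx]
        simpa using (hW' x (by simpa using hd) hx).1
  · have dYx : ∀ x, x ∈ W' → Disjoint Y (φ (some x)) := by
      intro x hd
      by_cases hx : x = z
      · rw [hx, φz, Set.disjoint_right]
        rintro _ ⟨y, hy, rfl⟩
        exact hYZ y hy
      · rw [φx hx, Set.disjoint_singleton_right]
        exact (hW' x hd hx).2.1
    have dZx : ∀ x, x ∈ W' → x ≠ z → Disjoint (φ (some z)) (φ (some x)) := by
      intro x hd hx
      rw [φx hx, φz, Set.disjoint_singleton_right]
      simpa using (hW' x hd hx).2.2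
    rintro (_ | x) hx (_ | y) hy hxy
    · exact absurd rfl hxy
    · exact dYx y (by simpa using hy)
    · exact (dYx x (by simpa using hx)).symm
    · have hx' : x ∈ W' := by simpa using hx
      have hy' : y ∈ W' := by simpa using hy
      have hxy' : x ≠ y := fun e => hxy (congrArg some e)
      by_cases h1 : x = z
      · rw [h1]; exact dZx y hy' fun e => hxy' (h1.trans e.symm)
      · by_cases h2 : y = z
        · rw [h2]; exact (dZx x hx' h1).symm
        · rw [φx h1, φx h2]
          simpa using hxy'
  · have key : ∀ x ∈ W', x ∈ S' → ∃ y ∈ Y, ∃ a ∈ φ (some x), (G.cone S).Adj y a := by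
      intro x hx hxS
      by_cases h1 : x = z
      · subst h1
        obtain ⟨y, hy, a, ha, hya⟩ := hzS hx hxS
        exact ⟨y, hy, some a, by rw [φz]; exact ⟨a, ha, rfl⟩, hya⟩
      · obtain ⟨y, hy, hyx⟩ := hS x hx h1 hxS
        exact ⟨y, hy, some x, by rw [φx h1]; rfl, hyx⟩
    have keyz : ∀ x ∈ W', x ≠ z → G'.Adj z x →
        ∃ y ∈ φ (some z), ∃ a ∈ φ (some x), (G.cone S).Adj y a := by
      intro x hx h1 hzx
      obtain ⟨y, hy, hyx⟩ := hz x hx h1 hzx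
      exact ⟨some y, by rw [φz]; exact ⟨y, hy, rfl⟩, some x, by rw [φx h1]; rfl, hyx⟩
    rintro (_ | x) hx (_ | y) hy hxy
    · exact hxy.elim
    · exact key y (by simpa using hy) hxy
    · obtain ⟨a, ha, b, hb, hab⟩ := key x (by simpa using hx) hxy
      exact ⟨b, hb, a, ha, hab.symm⟩
    · have hx' : x ∈ W' := by simpa using hx
      have hy' : y ∈ W' := by simpa using hy
      have hxy' : G'.Adj x y := hxy
      by_cases h1 : x = z
      · subst h1
        exact keyz y hy' hxy'.ne' hxy'
      · by_cases h2 : y = z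
        · subst h2
          obtain ⟨a, ha, b, hb, hab⟩ := keyz x hx' h1 hxy'.symm
          exact ⟨b, hb, a, ha, hab.symm⟩
        · exact ⟨some x, by rw [φx h1]; rfl, some y, by rw [φx h2]; rfl,
            hadj x hx' h1 y hy' h2 hxy'⟩

/-- Contract a connected set `Y` of vertices of the cone to the apex. -/
theorem contract {W' S' : Set V} (h : G.IsDisk W S) {Y : Set (Option V)}
    (hY : (G.cone S).IsConnSet Y) (hYW : Y ⊆ coneSet W) (hW' : ∀ x ∈ W', x ∈ W ∧ some x ∉ Y)
    (hS : ∀ x ∈ W', x ∈ S' → ∃ y ∈ Y, (G.cone S).Adj y (some x)) : G.IsDisk W' S' := by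
  rcases W'.eq_empty_or_nonempty with rfl | ⟨z, hz⟩
  · refine h.transfer (fun _ => Y) (fun _ _ => hY) (fun _ _ => hYW) ?_ ?_
    · rintro (_ | x) hx (_ | y) hy hxy <;> simp at hx hy hxy
    · rintro (_ | x) hx (_ | y) hy hxy <;> first | exact hxy.elim | simp at hx hy
  -- Contracting a single vertex `z` to itself changes nothing, so any `z` in `W'` will do.
  · refine h.contract₂ hY hYW (G.isConnSet_singleton z) (by simpa using (hW' z hz).1)
      (by simpa using (hW' z hz).2) (fun x hx hxz => ⟨(hW' x hx).1, (hW' x hx).2, hxz⟩)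
      (fun x _ _ y _ _ hxy => hxy) (fun x _ _ hzx => ⟨z, rfl, hzx⟩) (fun x hx _ hxS => hS x hx hxS)
      fun hzW hzS => ?_
    obtain ⟨y, hy, hyz⟩ := hS z hzW hzS
    exact ⟨y, hy, z, rfl, hyz⟩

theorem mono {W' S' : Set V} (h : G.IsDisk W S) (hW : W' ⊆ W) (hS : S' ⊆ S) :
    G.IsDisk W' S' :=
  h.contract (Y := {none}) (isConnSet_singleton _ _) (by simp) (fun x hx => ⟨hW hx, by simp⟩)
    fun x _ hxS => ⟨none, rfl, hS hxS⟩

/-- Delete a set of outer vertices; their neighbors become outer vertices. -/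
theorem delete {W' S' X : Set V} (h : G.IsDisk W S) (hX : X ⊆ S) (hXW : X ⊆ W)
    (hW : W' ⊆ W \ X) (hS : ∀ x ∈ W', x ∈ S' → x ∈ S ∨ ∃ y ∈ X, G.Adj y x) :
    G.IsDisk W' S' := by
  -- All of `X` is adjacent to the apex, so the apex and `X` form a connected set even if `X` itself
  -- is disconnected.
  refine h.contract (Y := coneSet X) ?_ ?_ (fun x hx => ⟨(hW hx).1, by simpa using (hW hx).2⟩) ?_
  · refine ⟨⟨none, by simp⟩, fun A hA ⟨a, ha⟩ hcl => ?_⟩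
    have hn : none ∈ A := by
      cases a with
      | none => exact ha
      | some x => exact hcl _ ha none (by simp) (hX (by simpa using hA ha))
    rintro (_ | x) hx
    · exact hn
    · exact hcl _ hn _ hx (hX (by simpa using hx))
  · rintro (_ | x) hx
    · simp
    · simpa using hXW (by simpa using hx)
  · intro x hx hxS
    rcases hS x hx hxS with h | ⟨y, hy, hyx⟩
    · exact ⟨none, by simp, h⟩
    · exact ⟨some y, by simpa using hy, hyx⟩

/-- Contract a connected set of vertices that contains an outer vertex to the apex. -/
theorem absorb {W' S' X : Set V} (h : G.IsDisk W S) (hX : G.IsConnSet X) (hXS : (X ∩ S).Nonempty)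
    (hXW : X ⊆ W) (hW : W' ⊆ W \ X) (hS : ∀ x ∈ W', x ∈ S' → x ∈ S ∨ ∃ y ∈ X, G.Adj y x) :
    G.IsDisk W' S' := by
  obtain ⟨s, hs, hsS⟩ := hXS
  refine h.contract (Y := coneSet X) ?_ ?_ (fun x hx => ⟨(hW hx).1, by simpa using (hW hx).2⟩) ?_
  · exact (hX.cone S).insert (x := some s) ⟨s, hs, rfl⟩ hsS
  · rintro (_ | x) hx
    · simp
    · simpa using hXW (by simpa using hx)
  · intro x hx hxS
    rcases hS x hx hxS with h | ⟨y, hy, hyx⟩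
    · exact ⟨none, by simp, h⟩
    · exact ⟨some y, by simpa using hy, hyx⟩

/-- Replace the apex by a vertex `v` and its neighbors as outer vertices. -/
theorem delete_vertex {W' S' : Set V} (h : G.IsDisk W S) {v : V} (hv : v ∈ W)
    (hW : W' ⊆ W \ {v}) (hS : ∀ x ∈ W', x ∈ S' → G.Adj v x) : G.IsDisk W' S' :=
  h.contract (Y := {some v}) (isConnSet_singleton _ _) (by simpa using hv)
    (fun x hx => ⟨(hW hx).1, by simpa using (hW hx).2⟩) fun x hx hxS => ⟨some v, rfl, hS x hx hxS⟩

end IsDisk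

end SimpleGraph

/-! ### List colorings of disk graphs with a precolored star -/

namespace SimpleGraph

variable {V C : Type*} {G : SimpleGraph V}

/-- A disk graph on `W` with outer vertices `S`, lists `L`, and a star `P` of at most three outer
vertices that is precolored by `f`. -/
structure Precolored (G : SimpleGraph V) (W S P : Set V) (L : V → Finset C) (f : V → C) :
    Prop where
  disk : G.IsDisk W S
  subS : P ⊆ S
  subW : S ⊆ W
  card_le : P.ncard ≤ 3
  star : P.Nonempty → ∃ v ∈ P, ∀ p ∈ P, p ≠ v → G.Adj v p
  five : ∀ x ∈ W, x ∉ S → 5 ≤ (L x).card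
  three : ∀ x ∈ W, x ∉ P → 3 ≤ (L x).card
  indep : ∀ x ∈ W, x ∉ P → ∀ y ∈ W, y ∉ P → G.Adj x y → (L x).card = 3 → (L y).card ≠ 3
  proper : ∀ p ∈ P, ∀ q ∈ P, G.Adj p q → f p ≠ f q
  not_bad : P.ncard = 3 → ∀ x ∈ W, x ∉ P → (∀ p ∈ P, G.Adj x p) → (L x : Set C) ≠ f '' P

/-- The precoloring `f` of `P` extends to a coloring of the subgraph induced by `W` from the
lists `L`. -/
def Extends (G : SimpleGraph V) (W P : Set V) (L : V → Finset C) (f : V → C) : Prop :=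
  ∃ c : V → C, (∀ x ∈ W, x ∉ P → c x ∈ L x) ∧ (∀ p ∈ P, c p = f p) ∧
    ∀ x ∈ W, ∀ y ∈ W, G.Adj x y → c x ≠ c y

/-- A minimal counterexample: a precolored disk graph whose precoloring does not extend, while
those of all smaller precolored disk graphs do. -/
structure Critical (G : SimpleGraph V) (W S P : Set V) (L : V → Finset C) (f : V → C) : Prop
    extends Precolored G W S P L f where
  ih : ∀ (G' : SimpleGraph V) (W' S' P' : Set V) (L' : V → Finset C) (f' : V → C),
    Precolored G' W' S' P' L' f' →
    W'.ncard < W.ncard ∨ (W'.ncard = W.ncard ∧ P.ncard < P'.ncard) → Extends G' W' P' L' f'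
  not_extends : ¬ Extends G W P L f

variable {W S P : Set V} {L : V → Finset C} {f : V → C}

theorem Precolored.restrict (h : Precolored G W S P L f) {A : Set V} (hA : A ⊆ W) (hP : P ⊆ A) :
    Precolored G A (S ∩ A) P L f where
  disk := h.disk.mono hA Set.inter_subset_left
  subS := Set.subset_inter h.subS hP
  subW := Set.inter_subset_right
  card_le := h.card_le
  star := h.star
  five x hx hxS := h.five x (hA hx) fun hS => hxS ⟨hS, hx⟩
  three x hx := h.three x (hA hx)
  indep x hx hxP y hy := h.indep x (hA hx) hxP y (hA hy)
  proper := h.proper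
  not_bad hc x hx := h.not_bad hc x (hA hx)

variable [Finite V]

theorem ncard_image_le_three {Q : Set V} (hQ : Q.ncard ≤ 3) (c : V → C) : (c '' Q).ncard ≤ 3 :=
  (Set.ncard_image_le (Set.toFinite Q)).trans hQ

/-! ### Separations of a minimal counterexample -/

namespace Critical

theorem extends_restrict (h : Critical G W S P L f) {A : Set V} (hA : A ⊆ W) (hP : P ⊆ A)
    (hne : ∃ z ∈ W, z ∉ A) : Extends G A P L f :=
  h.ih _ _ _ _ _ _ (h.restrict hA hP) <| Or.inl <| Set.ncard_lt_ncard
    (Set.ssubset_iff_exists.mpr ⟨hA, hne⟩) (Set.toFinite W)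

/-- Color one side of a separation first, then extend the coloring to the other side. -/
theorem false_of_split (h : Critical G W S P L f) {A B SB : Set V} (hAB : A ∪ B = W)
    (hsep : ∀ a ∈ A, a ∉ B → ∀ b ∈ B, b ∉ A → ¬ G.Adj a b) (hP : P ⊆ A) (hA : ∃ z ∈ W, z ∉ A)
    (hB : ∃ z ∈ W, z ∉ B) (hQ : A ∩ B ⊆ SB) (hSB : S ∩ B ⊆ SB) (hSB' : SB ⊆ B)
    (hd : G.IsDisk B SB) (hcard : (A ∩ B).ncard ≤ 3)
    (hstar : (A ∩ B).Nonempty → ∃ v ∈ A ∩ B, ∀ p ∈ A ∩ B, p ≠ v → G.Adj v p)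
    (hbad : (A ∩ B).ncard = 3 → ∀ t ∈ B, t ∉ A → t ∈ S → (L t).card = 3 →
      ¬ ∀ q ∈ A ∩ B, G.Adj t q) : False := by
  classical
  have hAW : A ⊆ W := hAB ▸ Set.subset_union_left
  have hBW : B ⊆ W := hAB ▸ Set.subset_union_right
  obtain ⟨c, hc1, hc2, hc3⟩ := h.extends_restrict hAW hP hA
  have hnP : ∀ x ∈ B, x ∉ A ∩ B → x ∉ P := fun x hx hxQ hxP => hxQ ⟨hP hxP, hx⟩
  have hpre : Precolored G B SB (A ∩ B) L c :=
    { disk := hd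
      subS := hQ
      subW := hSB'
      card_le := hcard
      star := hstar
      five := fun x hx hxS => h.five x (hBW hx) fun hS => hxS (hSB ⟨hS, hx⟩)
      three := fun x hx hxQ => h.three x (hBW hx) (hnP x hx hxQ)
      indep := fun x hx hxQ y hy hyQ =>
        h.indep x (hBW hx) (hnP x hx hxQ) y (hBW hy) (hnP y hy hyQ)
      proper := fun p hp q hq => hc3 p hp.1 q hq.1
      -- A list that consists of the colors of `A ∩ B` has at most three elements, so its vertex is
      -- outer with exactly three colors. Such a vertex is excluded by `hbad` whatever the coloring
      -- `c` is.
      not_bad := fun h3 x hx hxQ hadj hL => by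
        have hxA : x ∉ A := fun hxA => hxQ ⟨hxA, hx⟩
        have hle : (L x).card ≤ 3 := by
          rw [← Set.ncard_coe_finset, hL]
          exact ncard_image_le_three hcard c
        have hge := h.three x (hBW hx) (hnP x hx hxQ)
        refine hbad h3 x hx hxA ?_ (le_antisymm hle hge) hadj
        by_contra hxS
        have := h.five x (hBW hx) hxS
        omega }
  obtain ⟨c', hc1', hc2', hc3'⟩ := h.ih _ _ _ _ _ _ hpre <| Or.inl <| Set.ncard_lt_ncard
    (Set.ssubset_iff_exists.mpr ⟨hBW, hB⟩) (Set.toFinite W)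
  refine h.not_extends ⟨fun x => if x ∈ A then c x else c' x, ?_, ?_, ?_⟩
  · intro x hx hxP
    by_cases hxA : x ∈ A
    · simpa [hxA] using hc1 x hxA hxP
    · have hxB : x ∈ B := ((hAB ▸ hx : x ∈ A ∪ B)).resolve_left hxA
      simpa [hxA] using hc1' x hxB fun hxQ => hxA hxQ.1
  · intro p hp
    simpa [hP hp] using hc2 p hp
  · have hB' : ∀ x ∈ B, (if x ∈ A then c x else c' x) = c' x := by
      intro x hx
      by_cases hxA : x ∈ A
      · simpa [hxA] using (hc2' x ⟨hxA, hx⟩).symm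
      · simp [hxA]
    intro x hx y hy hxy
    by_cases hxA : x ∈ A
    · by_cases hyA : y ∈ A
      · simpa [hxA, hyA] using hc3 x hxA y hyA hxy
      · have hyB : y ∈ B := ((hAB ▸ hy : y ∈ A ∪ B)).resolve_left hyA
        by_cases hxB : x ∈ B
        · beta_reduce; rw [hB' x hxB, hB' y hyB]; exact hc3' x hxB y hyB hxy
        · exact absurd hxy (hsep x hxA hxB y hyB hyA)
    · have hxB : x ∈ B := ((hAB ▸ hx : x ∈ A ∪ B)).resolve_left hxA
      by_cases hyB : y ∈ B
      · beta_reduce; rw [hB' x hxB, hB' y hyB]; exact hc3' x hxB y hyB hxy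
      · have hyA : y ∈ A := ((hAB ▸ hy : y ∈ A ∪ B)).resolve_right hyB
        exact absurd hxy.symm (hsep y hyA hyB x hxB hxA)

/-- An edge between outer vertices does not cut off a part that avoids the precolored vertices. -/
theorem false_of_chord (h : Critical G W S P L f) {x y : V} (hx : x ∈ S) (hy : y ∈ S)
    (hxy : G.Adj x y) {Z : Set V} (hZ : Z ⊆ W \ {x, y}) (hZne : Z.Nonempty)
    (hcl : ∀ a ∈ Z, ∀ b ∈ W \ {x, y}, G.Adj a b → b ∈ Z) (hP : Disjoint P Z)
    (hrest : ∃ z ∈ W \ {x, y}, z ∉ Z) : False := by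
  have hxW := h.subW hx
  have hyW := h.subW hy
  have hxZ : x ∉ Z := fun h' => (hZ h').2 (by simp)
  have hyZ : y ∉ Z := fun h' => (hZ h').2 (by simp)
  have hQ : (W \ Z) ∩ (Z ∪ {x, y}) = {x, y} := by
    ext z
    simp only [Set.mem_inter_iff, Set.mem_sdiff, Set.mem_union, Set.mem_insert_iff,
      Set.mem_singleton_iff]
    constructor
    · rintro ⟨⟨_, h1⟩, h2⟩; exact h2.resolve_left h1
    · rintro (rfl | rfl)
      · exact ⟨⟨hxW, hxZ⟩, Or.inr (Or.inl rfl)⟩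
      · exact ⟨⟨hyW, hyZ⟩, Or.inr (Or.inr rfl)⟩
  have hBW : Z ∪ {x, y} ⊆ W := Set.union_subset (hZ.trans Set.sdiff_subset)
    (by rintro z (rfl | rfl) <;> assumption)
  obtain ⟨z, hz, hzZ⟩ := hrest
  refine h.false_of_split (A := W \ Z) (B := Z ∪ {x, y}) (SB := S ∩ (Z ∪ {x, y})) ?_ ?_ ?_ ?_ ?_ ?_
    subset_rfl Set.inter_subset_right (h.disk.mono hBW Set.inter_subset_left) ?_ ?_ ?_
  · ext z
    constructor
    · rintro (hz | hz)
      · exact hz.1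
      · exact hBW hz
    · intro hz
      by_cases hzZ : z ∈ Z
      · exact Or.inr (Or.inl hzZ)
      · exact Or.inl ⟨hz, hzZ⟩
  · rintro a ⟨ha, haZ⟩ haB b hb hbA hab
    have hbZ : b ∈ Z := by
      by_contra hbZ
      exact hbA ⟨hBW hb, hbZ⟩
    exact haZ (hcl b hbZ a ⟨ha, fun h' => haB (Or.inr h')⟩ hab.symm)
  · exact fun p hp => ⟨h.subW (h.subS hp), Set.disjoint_left.mp hP hp⟩
  · obtain ⟨z, hz⟩ := hZne
    exact ⟨z, (hZ hz).1, fun h' => h'.2 hz⟩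
  · exact ⟨z, hz.1, by rintro (h' | h'); exacts [hzZ h', hz.2 h']⟩
  · rw [hQ]
    rintro z (rfl | rfl)
    · exact ⟨hx, by simp⟩
    · exact ⟨hy, by simp⟩
  · rw [hQ, Set.ncard_pair hxy.ne]; norm_num
  · rw [hQ]
    refine fun _ => ⟨x, by simp, ?_⟩
    rintro p (rfl | rfl) hp
    · exact absurd rfl hp
    · exact hxy
  · rw [hQ, Set.ncard_pair hxy.ne]; intro h'; omega

/-- A path `q₁ q₂ q₃` that separates a part `C` with all precolored vertices from a nonempty rest
and whose vertices are outer vertices or have neighbors in `C`: some outer vertex of the rest with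
a list of size three is adjacent to the whole path. -/
theorem false_of_path (h : Critical G W S P L f) {q₁ q₂ q₃ : V} (hq₁ : q₁ ∈ W) (hq₂ : q₂ ∈ W)
    (hq₃ : q₃ ∈ W) (h12 : G.Adj q₂ q₁) (h23 : G.Adj q₂ q₃) (hne : P.Nonempty)
    {D : Set V} (hD : G.IsConnSet D) (hDW : D ⊆ W \ {q₁, q₂, q₃}) (hPD : P ⊆ D)
    (hcl : ∀ a ∈ D, ∀ b ∈ W \ {q₁, q₂, q₃}, G.Adj a b → b ∈ D)
    (hS₁ : q₁ ∈ S ∨ ∃ d ∈ D, G.Adj d q₁) (hS₂ : q₂ ∈ S ∨ ∃ d ∈ D, G.Adj d q₂)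
    (hS₃ : q₃ ∈ S ∨ ∃ d ∈ D, G.Adj d q₃) (hrest : ∃ z ∈ W \ {q₁, q₂, q₃}, z ∉ D)
    (hbad : ∀ t ∈ W \ {q₁, q₂, q₃}, t ∉ D → t ∈ S → (L t).card = 3 →
      G.Adj t q₁ → G.Adj t q₂ → G.Adj t q₃ → False) : False := by
  have hQW : ({q₁, q₂, q₃} : Set V) ⊆ W := by rintro z (rfl | rfl | rfl) <;> assumption
  have hQD : ∀ z ∈ ({q₁, q₂, q₃} : Set V), z ∉ D := fun z hz hzD => (hDW hzD).2 hz
  have hQ : (D ∪ {q₁, q₂, q₃}) ∩ (W \ D) = {q₁, q₂, q₃} := by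
    ext z
    constructor
    · rintro ⟨h1, h2⟩; exact h1.resolve_left h2.2
    · exact fun hz => ⟨Or.inr hz, hQW hz, hQD z hz⟩
  obtain ⟨p, hp⟩ := hne
  obtain ⟨z, hz, hzD⟩ := hrest
  have hDS : (D ∩ S).Nonempty := ⟨p, hPD hp, h.subS hp⟩
  refine h.false_of_split (A := D ∪ {q₁, q₂, q₃}) (B := W \ D)
    (SB := (S ∩ (W \ D)) ∪ {q₁, q₂, q₃}) ?_ ?_ ?_ ?_ ?_ ?_
    Set.subset_union_left ?_ ?_ ?_ ?_ ?_
  · ext z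
    constructor
    · rintro ((hz | hz) | hz)
      · exact (hDW hz).1
      · exact hQW hz
      · exact hz.1
    · intro hz
      by_cases hzZ : z ∈ D
      · exact Or.inl (Or.inl hzZ)
      · exact Or.inr ⟨hz, hzZ⟩
  · rintro a ha haB b hb hbA hab
    have haD : a ∈ D := by
      rcases ha with ha | ha
      · exact ha
      · exact absurd ⟨hQW ha, hQD a ha⟩ haB
    exact hb.2 (hcl a haD b ⟨hb.1, fun h' => hbA (Or.inr h')⟩ hab)
  · exact hPD.trans Set.subset_union_left
  · exact ⟨z, hz.1, by rintro (h' | h'); exacts [hzD h', hz.2 h']⟩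
  · exact ⟨p, h.subW (h.subS hp), fun h' => h'.2 (hPD hp)⟩
  · rw [hQ]; exact Set.subset_union_right
  · exact Set.union_subset Set.inter_subset_right fun z hz => ⟨hQW hz, hQD z hz⟩
  -- Contracting `D` to the apex makes its neighbors outer. This is why a path through inner
  -- vertices can be precolored on the other side.
  · refine h.disk.absorb hD hDS (hDW.trans Set.sdiff_subset) subset_rfl ?_
    rintro x hx (hxS | rfl | rfl | rfl)
    · exact Or.inl hxS.1
    · exact hS₁
    · exact hS₂
    · exact hS₃
  · rw [hQ]; exact Set.ncard_insert_le _ _ |>.trans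
      (Nat.succ_le_succ ((Set.ncard_insert_le _ _).trans (by simp)))
  · rw [hQ]
    refine fun _ => ⟨q₂, by simp, ?_⟩
    rintro p (rfl | rfl | rfl) hp
    · exact h12
    · exact absurd rfl hp
    · exact h23
  · rw [hQ]
    intro _ t ht htA htS h3 hadj
    exact hbad t ⟨ht.1, fun h' => htA (Or.inr h')⟩ ht.2 htS h3 (hadj _ (by simp))
      (hadj _ (by simp)) (hadj _ (by simp))

end Critical

end SimpleGraph

namespace SimpleGraph

variable {V C : Type*} {G : SimpleGraph V} {W S P : Set V} {L : V → Finset C} {f : V → C}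

/-- Without such a neighbor, the vertices reached while avoiding `b` would be closed under adjacency
in all of `R`, and `b` would never be reached. -/
theorem exists_adj_of_mem_reach {R D : Set V} {b : V} (hb : b ∈ G.reach R D) (hbD : b ∉ D) :
    ∃ a ∈ G.reach (R \ {b}) D, G.Adj a b := by
  by_contra hno
  push Not at hno
  have hsub : G.reach R D ⊆ G.reach (R \ {b}) D := by
    refine reach_subset (subset_reach _ _) fun a ha c hc hac => ?_
    refine reach_closed ha ⟨hc, ?_⟩ hac
    rintro rfl
    exact hno a ha hac
  have : G.reach (R \ {b}) D ⊆ {x | x ≠ b} :=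
    reach_subset (fun x hx hxb => hbD (hxb ▸ hx)) fun _ _ c hc _ hcb => hc.2 hcb
  exact this (hsub hb) rfl

theorem mem_reach_symm {R : Set V} {a b : V} (ha : a ∈ R) (h : b ∈ G.reach R {a}) :
    a ∈ G.reach R {b} := by
  have hconn := reach_isConnSet (R := R) (G.isConnSet_singleton a)
  exact hconn.subset_reach (reach_subset_self (by simpa using ha))
    ⟨b, h, subset_reach R {b} rfl⟩ (subset_reach R {a} rfl)

theorem exists_mem_not_mem_finset [DecidableEq C] {s t : Finset C} (h : t.card < s.card) :
    ∃ c ∈ s, c ∉ t := by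
  by_contra hno
  push Not at hno
  exact absurd (Finset.card_le_card hno) (not_le.mpr h)

/-! ### Edges between outer vertices -/

/-- The edge from the center `v` of the path `u v w` to the outer vertex `y` separates `u`
from `w`. -/
structure IsCross (G : SimpleGraph V) (W S : Set V) (u v w y : V) : Prop where
  memS : y ∈ S
  adj : G.Adj v y
  ne_left : y ≠ u
  ne_right : y ≠ w
  not_mem : u ∉ G.reach (W \ {v, y}) {w}

theorem IsCross.symm {u v w y : V} (h : G.IsCross W S u v w y) (hu : u ∈ W)
    (huv : u ≠ v) : G.IsCross W S w v u y :=
  ⟨h.memS, h.adj, h.ne_right, h.ne_left, fun h' => h.not_mem (mem_reach_symm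
    ⟨hu, by rintro (h1 | h1); exacts [huv h1, h.ne_left h1.symm]⟩ h')⟩

namespace Critical

variable [Finite V]

/-- Apply `false_of_chord` to `Z` and to its complement in `W \ {x, y}`. -/
theorem inter_nonempty_of_chord (h : Critical G W S P L f) {x y : V} (hx : x ∈ S) (hy : y ∈ S)
    (hxy : G.Adj x y) {Z : Set V} (hZ : Z ⊆ W \ {x, y}) (hZne : Z.Nonempty)
    (hcl : ∀ a ∈ Z, ∀ b ∈ W \ {x, y}, G.Adj a b → b ∈ Z) (hrest : ∃ z ∈ W \ {x, y}, z ∉ Z) :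
    (∃ p ∈ P, p ∈ Z) ∧ ∃ p ∈ P, p ∈ W \ {x, y} ∧ p ∉ Z := by
  constructor
  · by_contra hno
    push Not at hno
    exact h.false_of_chord hx hy hxy hZ hZne hcl (Set.disjoint_left.mpr hno) hrest
  · by_contra hno
    push Not at hno
    obtain ⟨z, hz, hzZ⟩ := hrest
    refine h.false_of_chord hx hy hxy (Z := (W \ {x, y}) \ Z) Set.sdiff_subset ⟨z, hz, hzZ⟩ ?_ ?_ ?_
    · exact fun a ha b hb hab => ⟨hb, fun hbZ => ha.2 (hcl b hbZ a ha.1 hab.symm)⟩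
    · exact Set.disjoint_left.mpr fun p hp hpZ => hpZ.2 (hno p hp hpZ.1)
    · obtain ⟨z', hz'⟩ := hZne
      exact ⟨z', hZ hz', fun h' => h'.2 hz'⟩

/-- Some precolored vertex is cut off from `w`; since `v` is an end of the edge, it must be `u`. -/
theorem isCross_of_not_mem (h : Critical G W S P L f) {u v w : V} (hP : P = {u, v, w})
    (hvw : G.Adj v w) {t z : V} (ht : t ∈ S) (hvt : G.Adj v t) (htw : t ≠ w)
    (hz : z ∈ W \ {v, t}) (hzR : z ∉ G.reach (W \ {v, t}) {w}) : G.IsCross W S u v w t := by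
  have hv : v ∈ S := h.subS (by simp [hP])
  have hw : w ∈ W := h.subW (h.subS (by simp [hP]))
  have hwR : w ∈ W \ {v, t} := ⟨hw, by rintro (h1 | h1); exacts [hvw.ne h1.symm, htw h1.symm]⟩
  obtain ⟨-, p, hp, hpW, hpZ⟩ := h.inter_nonempty_of_chord hv ht hvt
    (Z := G.reach (W \ {v, t}) {w}) (reach_subset_self (by simpa using hwR))
    ⟨w, subset_reach _ _ rfl⟩ (fun a ha b hb hab => reach_closed ha hb hab) ⟨z, hz, hzR⟩
  rw [hP] at hp
  rcases hp with rfl | rfl | rfl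
  · exact ⟨ht, hvt, fun e => hpW.2 (Or.inr e.symm), htw, hpZ⟩
  · exact absurd (Or.inl rfl) hpW.2
  · exact absurd (subset_reach _ {p} rfl) hpZ

/-- If `y` and `w` stay connected after the deletion of `v` and `t`, then `v`, `t`, `w`, the part of
`y` and the apex give a K₅ minor. Otherwise `vt` separates `u` from `w` as well, and its side of `w`
is strictly smaller since it lacks `t`, contrary to the choice of `y`. -/
theorem isCross_no_triangle (h : Critical G W S P L f) {u v w : V} (hP : P = {u, v, w})
    (hvw : G.Adj v w) {y : V} (hy : G.IsCross W S u v w y)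
    (hmin : ∀ y', G.IsCross W S u v w y' →
      (G.reach (W \ {v, y}) {w}).ncard ≤ (G.reach (W \ {v, y'}) {w}).ncard)
    {t : V} (ht : t ∈ S) (hvt : G.Adj t v) (hty : G.Adj t y) (htw : G.Adj t w) : False := by
  have hv : v ∈ S := h.subS (by simp [hP])
  have hw : w ∈ S := h.subS (by simp [hP])
  have hyt : y ∈ W \ {v, t} :=
    ⟨h.subW hy.memS, by rintro (h1 | h1); exacts [hy.adj.ne h1.symm, hty.ne h1.symm]⟩
  have hwt : w ∈ W \ {v, t} :=
    ⟨h.subW hw, by rintro (h1 | h1); exacts [hvw.ne h1.symm, htw.ne h1.symm]⟩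
  by_cases hconn : w ∈ G.reach (W \ {v, t}) {y}
  · obtain ⟨a, ha, haw⟩ := exists_adj_of_mem_reach hconn (fun e => hy.ne_right e.symm)
    have hsub : G.reach ((W \ {v, t}) \ {w}) {y} ⊆ (W \ {v, t}) \ {w} :=
      reach_subset_self (by rintro _ rfl; exact ⟨hyt, hy.ne_right⟩)
    have hym : y ∈ G.reach ((W \ {v, t}) \ {w}) {y} := subset_reach _ _ rfl
    refine h.disk.false_of_complete (X₁ := {v}) (X₂ := {t}) (X₃ := {w})
      (X₄ := G.reach ((W \ {v, t}) \ {w}) {y}) (isConnSet_singleton _ _) (isConnSet_singleton _ _)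
      (isConnSet_singleton _ _) (reach_isConnSet (isConnSet_singleton _ _))
      (by simpa using h.subW hv) (by simpa using h.subW ht) (by simpa using h.subW hw)
      (fun x hx => (hsub hx).1.1) ⟨v, rfl, hv⟩ ⟨t, rfl, ht⟩ ⟨w, rfl, hw⟩ ⟨y, hym, hy.memS⟩
      (by simpa using hvt.ne') (by simpa using hvw.ne) ?_ (by simpa using htw.ne) ?_ ?_
      (touches_singleton hvt.symm) (touches_singleton hvw) ⟨v, rfl, y, hym, hy.adj⟩
      (touches_singleton htw) ⟨t, rfl, y, hym, hty⟩ ⟨w, rfl, a, ha, haw.symm⟩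
    · exact Set.disjoint_singleton_left.mpr fun h' => (hsub h').1.2 (Or.inl rfl)
    · exact Set.disjoint_singleton_left.mpr fun h' => (hsub h').1.2 (Or.inr rfl)
    · exact Set.disjoint_singleton_left.mpr fun h' => (hsub h').2 rfl
  · have hcr := h.isCross_of_not_mem hP hvw ht hvt.symm htw.ne hyt
      fun h' => hconn (mem_reach_symm hwt h')
    have hyR : y ∉ G.reach (W \ {v, t}) {w} := fun h' => hconn (mem_reach_symm hwt h')
    have hsubt : G.reach (W \ {v, t}) {w} ⊆ W \ {v, t} := reach_subset_self (by simpa using hwt)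
    have hsub : G.reach (W \ {v, t}) {w} ⊆ G.reach (W \ {v, y}) {w} := by
      refine (reach_isConnSet (isConnSet_singleton _ _)).subset_reach (fun x hx => ?_)
        ⟨w, subset_reach _ _ rfl, subset_reach _ _ rfl⟩
      refine ⟨(hsubt hx).1, ?_⟩
      rintro (rfl | rfl)
      · exact (hsubt hx).2 (Or.inl rfl)
      · exact hyR hx
    have htR : t ∈ G.reach (W \ {v, y}) {w} := reach_closed (subset_reach _ _ rfl)
      ⟨h.subW ht, by rintro (h1 | h1); exacts [hvt.ne h1, hty.ne h1]⟩ htw.symm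
    refine absurd (hmin t hcr) (not_le.mpr (Set.ncard_lt_ncard
      (Set.ssubset_iff_exists.mpr ⟨hsub, t, htR, fun h' => ?_⟩) (Set.toFinite _)))
    exact (hsubt h').2 (Or.inr rfl)

/-- Extend a coloring of the side of `u` to the side of `w`. -/
theorem false_of_cross (h : Critical G W S P L f) {u v w : V} (hP : P = {u, v, w})
    (huv : G.Adj v u) (hvw : G.Adj v w) {y : V} (hy : G.IsCross W S u v w y) {c : V → C}
    (hc1 : ∀ x ∈ W \ G.reach (W \ {v, y}) {w}, x ∉ P → c x ∈ L x) (hcu : c u = f u)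
    (hcv : c v = f v)
    (hc2 : ∀ x ∈ W \ G.reach (W \ {v, y}) {w}, ∀ x' ∈ W \ G.reach (W \ {v, y}) {w},
      G.Adj x x' → c x ≠ c x')
    (hyw : G.Adj y w → c y ≠ f w)
    (hbad : ∀ t ∈ S, (L t).card = 3 → G.Adj t v → G.Adj t y → G.Adj t w → False) : False := by
  classical
  set R := G.reach (W \ {v, y}) {w} with hR
  have hu : u ∈ S := h.subS (by simp [hP])
  have hv : v ∈ S := h.subS (by simp [hP])
  have hw : w ∈ S := h.subS (by simp [hP])
  have hwR : w ∈ R := subset_reach _ _ rfl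
  have hRW : R ⊆ W \ {v, y} := reach_subset_self (by
    rintro _ rfl
    exact ⟨h.subW hw, by rintro (h1 | h1); exacts [hvw.ne h1.symm, hy.ne_right h1.symm]⟩)
  have hvR : v ∉ R := fun h' => (hRW h').2 (Or.inl rfl)
  have hyR : y ∉ R := fun h' => (hRW h').2 (Or.inr rfl)
  have huR : u ∉ R := hy.not_mem
  have hvy : v ≠ y := hy.adj.ne
  have hQW : ({v, y, w} : Set V) ⊆ W := by
    rintro z (rfl | rfl | rfl)
    exacts [h.subW hv, h.subW hy.memS, h.subW hw]
  set B := R ∪ {v, y} with hB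
  have hvB : v ∈ B := Or.inr (Or.inl rfl)
  have hyB : y ∈ B := Or.inr (Or.inr rfl)
  have huB : u ∉ B := by
    rintro (h' | h' | h')
    exacts [huR h', huv.ne h'.symm, hy.ne_left h'.symm]
  have hBW : B ⊆ W := Set.union_subset (hRW.trans Set.sdiff_subset)
    (by rintro z (rfl | rfl); exacts [h.subW hv, h.subW hy.memS])
  have hnP : ∀ x ∈ B, x ∉ ({v, y, w} : Set V) → x ∉ P := by
    intro x hx hxQ hxP
    rw [hP] at hxP
    rcases hxP with rfl | rfl | rfl
    · exact huB hx
    · exact hxQ (Or.inl rfl)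
    · exact hxQ (Or.inr (Or.inr rfl))
  -- On the side of `w` the path `y v w` is precolored. The map `c` is constrained only on the side
  -- of `u`, so its value at `w` is replaced by `f w`.
  have hgv : Function.update c w (f w) v = c v := Function.update_of_ne hvw.ne _ _
  have hgy : Function.update c w (f w) y = c y := Function.update_of_ne hy.ne_right _ _
  have hgw : Function.update c w (f w) w = f w := Function.update_self _ _ _
  have hcvy : c v ≠ c y := hc2 v ⟨h.subW hv, hvR⟩ y ⟨h.subW hy.memS, hyR⟩ hy.adj
  have hfvw : f v ≠ f w := h.proper v (by simp [hP]) w (by simp [hP]) hvw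
  have hcard : ({v, y, w} : Set V).ncard ≤ 3 := Set.ncard_insert_le _ _ |>.trans
    (Nat.succ_le_succ ((Set.ncard_insert_le _ _).trans (by simp)))
  have hpre : Precolored G B (S ∩ B) {v, y, w} L (Function.update c w (f w)) :=
    { disk := h.disk.mono hBW Set.inter_subset_left
      subS := by
        rintro z (rfl | rfl | rfl)
        exacts [⟨hv, hvB⟩, ⟨hy.memS, hyB⟩, ⟨hw, Or.inl hwR⟩]
      subW := Set.inter_subset_right
      card_le := hcard
      star := fun _ => ⟨v, by simp, by
        rintro p (rfl | rfl | rfl) hp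
        exacts [absurd rfl hp, hy.adj, hvw]⟩
      five := fun x hx hxS => h.five x (hBW hx) fun hS => hxS ⟨hS, hx⟩
      three := fun x hx hxQ => h.three x (hBW hx) (hnP x hx hxQ)
      indep := fun x hx hxQ x' hx' hxQ' =>
        h.indep x (hBW hx) (hnP x hx hxQ) x' (hBW hx') (hnP x' hx' hxQ')
      proper := by
        rintro p (rfl | rfl | rfl) q (rfl | rfl | rfl) hpq <;>
          first | exact absurd rfl hpq.ne | (simp only [hgv, hgy, hgw])
        · exact hcvy
        · exact hcv ▸ hfvw
        · exact hcvy.symm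
        · exact hyw hpq
        · exact hcv ▸ hfvw.symm
        · exact (hyw hpq.symm).symm
      not_bad := fun h3 x hx hxQ hadj hL => by
        have hle : (L x).card ≤ 3 := by
          rw [← Set.ncard_coe_finset, hL]
          exact ncard_image_le_three hcard _
        have hge := h.three x (hBW hx) (hnP x hx hxQ)
        refine hbad x ?_ (le_antisymm hle hge) (hadj _ (by simp)) (hadj _ (by simp))
          (hadj _ (by simp))
        by_contra hxS
        have := h.five x (hBW hx) hxS
        omega }
  obtain ⟨c', hc1', hc2', hc3'⟩ := h.ih _ _ _ _ _ _ hpre <| Or.inl <| Set.ncard_lt_ncard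
    (Set.ssubset_iff_exists.mpr ⟨hBW, u, h.subW hu, huB⟩) (Set.toFinite W)
  have hv' : c' v = c v := (hc2' v (by simp)).trans hgv
  have hy' : c' y = c y := (hc2' y (by simp)).trans hgy
  have hw' : c' w = f w := (hc2' w (by simp)).trans hgw
  have hcross : ∀ x ∈ R, ∀ x' ∈ W, x' ∉ R → G.Adj x x' → c' x ≠ c x' := by
    intro x hx x' hx' hxR' hxx'
    have hvy' : x' ∈ ({v, y} : Set V) := by
      by_contra hno
      exact hxR' (reach_closed hx ⟨hx', hno⟩ hxx')
    have := hc3' x (Or.inl hx) x' (Or.inr hvy') hxx'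
    rcases hvy' with rfl | rfl
    · rwa [hv'] at this
    · rwa [hy'] at this
  refine h.not_extends ⟨fun x => if x ∈ R then c' x else c x, ?_, ?_, ?_⟩
  · intro x hx hxP
    by_cases hxR : x ∈ R
    · have hxQ : x ∉ ({v, y, w} : Set V) := by
        rintro (rfl | rfl | rfl)
        exacts [hvR hxR, hyR hxR, hxP (by simp [hP])]
      simpa [hxR] using hc1' x (Or.inl hxR) hxQ
    · simpa [hxR] using hc1 x ⟨hx, hxR⟩ hxP
  · rw [hP]
    rintro p (rfl | rfl | rfl)
    · simpa [huR] using hcu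
    · simpa [hvR] using hcv
    · simpa [hwR] using hw'
  · intro x hx x' hx' hxx'
    beta_reduce
    split_ifs with h1 h2 h2
    · exact hc3' x (Or.inl h1) x' (Or.inl h2) hxx'
    · exact hcross x h1 x' hx' h2 hxx'
    · exact (hcross x' h2 x hx h1 hxx'.symm).symm
    · exact hc2 x ⟨hx, h1⟩ x' ⟨hx', h2⟩ hxx'

/-- Color the side of `u` with a prescribed color of `y`. -/
theorem exists_coloring_of_cross (h : Critical G W S P L f) {u v w : V} (hP : P = {u, v, w})
    (huv : G.Adj v u) (hvw : G.Adj v w) {y : V} (hy : G.IsCross W S u v w y) {γ : C}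
    (hγ : γ ∈ L y) (hγv : γ ≠ f v) (hγu : G.Adj y u → γ ≠ f u)
    (hbad : ∀ t ∈ S, t ∉ P → t ≠ y → (L t).card = 3 → G.Adj t u → G.Adj t v → G.Adj t y →
      (L t : Set C) = {f u, f v, γ} → False) :
    ∃ c : V → C, (∀ x ∈ W \ G.reach (W \ {v, y}) {w}, x ∉ P → c x ∈ L x) ∧ c u = f u ∧
      c v = f v ∧ c y = γ ∧
      ∀ x ∈ W \ G.reach (W \ {v, y}) {w}, ∀ x' ∈ W \ G.reach (W \ {v, y}) {w},
        G.Adj x x' → c x ≠ c x' := by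
  classical
  set R := G.reach (W \ {v, y}) {w} with hR
  have hu : u ∈ S := h.subS (by simp [hP])
  have hv : v ∈ S := h.subS (by simp [hP])
  have hw : w ∈ S := h.subS (by simp [hP])
  have hwR : w ∈ R := subset_reach _ _ rfl
  have hRW : R ⊆ W \ {v, y} := reach_subset_self (by
    rintro _ rfl
    exact ⟨h.subW hw, by rintro (h1 | h1); exacts [hvw.ne h1.symm, hy.ne_right h1.symm]⟩)
  have huA : u ∈ W \ R := ⟨h.subW hu, hy.not_mem⟩
  have hvA : v ∈ W \ R := ⟨h.subW hv, fun h' => (hRW h').2 (Or.inl rfl)⟩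
  have hyA : y ∈ W \ R := ⟨h.subW hy.memS, fun h' => (hRW h').2 (Or.inr rfl)⟩
  have hyP : y ∉ P := by
    rw [hP]
    rintro (h1 | h1 | h1)
    exacts [hy.ne_left h1, hy.adj.ne h1.symm, hy.ne_right h1]
  have hnP : ∀ x ∈ W \ R, x ∉ ({u, v, y} : Set V) → x ∉ P := by
    intro x hx hxQ hxP
    rw [hP] at hxP
    rcases hxP with rfl | rfl | rfl
    exacts [hxQ (Or.inl rfl), hxQ (Or.inr (Or.inl rfl)), hx.2 hwR]
  have hgu : Function.update f y γ u = f u := Function.update_of_ne hy.ne_left.symm _ _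
  have hgv : Function.update f y γ v = f v := Function.update_of_ne hy.adj.ne _ _
  have hgy : Function.update f y γ y = γ := Function.update_self _ _ _
  have hfuv : f u ≠ f v := h.proper u (by simp [hP]) v (by simp [hP]) huv.symm
  have hcard : ({u, v, y} : Set V).ncard ≤ 3 := Set.ncard_insert_le _ _ |>.trans
    (Nat.succ_le_succ ((Set.ncard_insert_le _ _).trans (by simp)))
  have hpre : Precolored G (W \ R) (S ∩ (W \ R)) {u, v, y} L (Function.update f y γ) :=
    { disk := h.disk.mono Set.sdiff_subset Set.inter_subset_left
      subS := by
        rintro z (rfl | rfl | rfl)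
        exacts [⟨hu, huA⟩, ⟨hv, hvA⟩, ⟨hy.memS, hyA⟩]
      subW := Set.inter_subset_right
      card_le := hcard
      star := fun _ => ⟨v, by simp, by
        rintro p (rfl | rfl | rfl) hp
        exacts [huv, absurd rfl hp, hy.adj]⟩
      five := fun x hx hxS => h.five x hx.1 fun hS => hxS ⟨hS, hx⟩
      three := fun x hx hxQ => h.three x hx.1 (hnP x hx hxQ)
      indep := fun x hx hxQ x' hx' hxQ' =>
        h.indep x hx.1 (hnP x hx hxQ) x' hx'.1 (hnP x' hx' hxQ')
      proper := by
        rintro p (rfl | rfl | rfl) q (rfl | rfl | rfl) hpq <;>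
          first | exact absurd rfl hpq.ne | (simp only [hgv, hgy, hgu])
        · exact hfuv
        · exact (hγu hpq.symm).symm
        · exact hfuv.symm
        · exact hγv.symm
        · exact hγu hpq
        · exact hγv
      not_bad := fun h3 x hx hxQ hadj hL => by
        have hle : (L x).card ≤ 3 := by
          rw [← Set.ncard_coe_finset, hL]
          exact ncard_image_le_three hcard _
        have hge := h.three x hx.1 (hnP x hx hxQ)
        have hxS : x ∈ S := by
          by_contra hxS
          have := h.five x hx.1 hxS
          omega
        refine hbad x hxS (hnP x hx hxQ) (fun e => hxQ (by simp [e])) (le_antisymm hle hge)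
          (hadj _ (by simp)) (hadj _ (by simp)) (hadj _ (by simp)) ?_
        rw [hL, Set.image_insert_eq, Set.image_pair, hgu, hgv, hgy] }
  obtain ⟨c, hc1, hc2, hc3⟩ := h.ih _ _ _ _ _ _ hpre <| Or.inl <| Set.ncard_lt_ncard
    (Set.ssubset_iff_exists.mpr ⟨Set.sdiff_subset, w, h.subW hw, fun h' => h'.2 hwR⟩)
    (Set.toFinite W)
  refine ⟨c, fun x hx hxP => ?_, (hc2 u (by simp)).trans hgu, (hc2 v (by simp)).trans hgv,
    (hc2 y (by simp)).trans hgy, hc3⟩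
  by_cases hxy : x = y
  · rw [hxy, hc2 y (by simp), hgy]; exact hγ
  · refine hc1 x hx ?_
    rintro (rfl | rfl | rfl)
    exacts [hxP (by simp [hP]), hxP (by simp [hP]), hxy rfl]

/-- If `y` is a separating neighbor of the center closest to `w`, then it is adjacent to `w`. -/
theorem isCross_adj_right (h : Critical G W S P L f) {u v w : V} (hP : P = {u, v, w})
    (huv : G.Adj v u) (hvw : G.Adj v w) {y : V} (hy : G.IsCross W S u v w y)
    (hmin : ∀ y', G.IsCross W S u v w y' →
      (G.reach (W \ {v, y}) {w}).ncard ≤ (G.reach (W \ {v, y'}) {w}).ncard) : G.Adj y w := by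
  by_contra hyw
  have hwR : w ∈ G.reach (W \ {v, y}) {w} := subset_reach _ _ rfl
  have hu : u ∈ S := h.subS (by simp [hP])
  have hv : v ∈ S := h.subS (by simp [hP])
  have hw : w ∈ S := h.subS (by simp [hP])
  have hvR : v ∉ G.reach (W \ {v, y}) {w} := fun h' => (reach_subset_self (by
    rintro _ rfl
    exact ⟨h.subW hw, by rintro (h1 | h1); exacts [hvw.ne h1.symm, hy.ne_right h1.symm]⟩) h').2
      (Or.inl rfl)
  set A := W \ G.reach (W \ {v, y}) {w} with hA
  have hnP : ∀ x ∈ A, x ∉ ({u, v} : Set V) → x ∉ P := by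
    intro x hx hxQ hxP
    rw [hP] at hxP
    rcases hxP with rfl | rfl | rfl
    exacts [hxQ (Or.inl rfl), hxQ (Or.inr rfl), hx.2 hwR]
  -- If `y` and `w` are not adjacent, any color of `y` is acceptable for the other side, so only `u`
  -- and `v` are precolored on the side of `u`.
  have hpre : Precolored G A (S ∩ A) {u, v} L f :=
    { disk := h.disk.mono Set.sdiff_subset Set.inter_subset_left
      subS := by
        rintro z (rfl | rfl)
        exacts [⟨hu, h.subW hu, hy.not_mem⟩, ⟨hv, h.subW hv, hvR⟩]
      subW := Set.inter_subset_right
      card_le := by rw [Set.ncard_pair huv.ne']; omega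
      star := fun _ => ⟨v, by simp, by
        rintro p (rfl | rfl) hp
        exacts [huv, absurd rfl hp]⟩
      five := fun x hx hxS => h.five x hx.1 fun hS => hxS ⟨hS, hx⟩
      three := fun x hx hxQ => h.three x hx.1 (hnP x hx hxQ)
      indep := fun x hx hxQ x' hx' hxQ' =>
        h.indep x hx.1 (hnP x hx hxQ) x' hx'.1 (hnP x' hx' hxQ')
      proper := fun p hp q hq => h.proper p (by rw [hP]; rcases hp with rfl | rfl <;> simp) q
        (by rw [hP]; rcases hq with rfl | rfl <;> simp)
      not_bad := fun h3 => by rw [Set.ncard_pair huv.ne'] at h3; omega }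
  obtain ⟨c, hc1, hc2, hc3⟩ := h.ih _ _ _ _ _ _ hpre <| Or.inl <| Set.ncard_lt_ncard
    (Set.ssubset_iff_exists.mpr ⟨Set.sdiff_subset, w, h.subW hw, fun h' => h'.2 hwR⟩)
    (Set.toFinite W)
  refine h.false_of_cross hP huv hvw hy (c := c) (fun x hx hxP => hc1 x hx ?_) (hc2 u (by simp))
    (hc2 v (by simp)) hc3 (fun h' => absurd h' hyw)
    fun t ht _ h1 h2 h3 => h.isCross_no_triangle hP hvw hy hmin ht h1 h2 h3
  rintro (rfl | rfl)
  exacts [hxP (by simp [hP]), hxP (by simp [hP])]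

/-- Take `y` closest to `w` and `y'` closest to `u`; then `y` is adjacent to `w` and `y'` to `u`. A
suitable color of `y` extends first to the side of `u`, then to the side of `w`, where no vertex
sees all of `v`, `y`, `w`. If `y = y'`, this vertex sees all of `P`, and `not_bad` provides a color.
If `y ≠ y'`, only `y'` can obstruct the side of `u`. -/
theorem not_isCross (h : Critical G W S P L f) {u v w : V} (hP : P = {u, v, w}) (huw : u ≠ w)
    (huv : G.Adj v u) (hvw : G.Adj v w) (y₀ : V) : ¬ G.IsCross W S u v w y₀ := by
  classical
  intro hy₀
  have hu : u ∈ S := h.subS (by simp [hP])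
  have hv : v ∈ S := h.subS (by simp [hP])
  have hw : w ∈ S := h.subS (by simp [hP])
  have hP' : P = {w, v, u} := by rw [hP]; ext; simp; tauto
  have hcard : P.ncard = 3 := Set.ncard_eq_three.mpr ⟨u, v, w, huv.ne', huw, hvw.ne, hP⟩
  obtain ⟨y, hy, hmin⟩ := Set.exists_min_image {y | G.IsCross W S u v w y}
    (fun y => (G.reach (W \ {v, y}) {w}).ncard) (Set.toFinite _) ⟨y₀, hy₀⟩
  obtain ⟨y', hy', hmin'⟩ := Set.exists_min_image {y | G.IsCross W S w v u y}
    (fun y => (G.reach (W \ {v, y}) {u}).ncard) (Set.toFinite _)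
    ⟨y₀, hy₀.symm (h.subW hu) huv.ne'⟩
  have hyw := h.isCross_adj_right hP huv hvw hy hmin
  have hyu := h.isCross_adj_right hP' hvw huv hy' hmin'
  have hyP : y ∉ P := by
    rw [hP]
    rintro (h1 | h1 | h1)
    exacts [hy.ne_left h1, hy.adj.ne h1.symm, hy.ne_right h1]
  have hy3 := h.three y (h.subW hy.memS) hyP
  have fin : ∀ γ ∈ L y, γ ≠ f v → γ ≠ f w → (G.Adj y u → γ ≠ f u) →
      (∀ t ∈ S, t ∉ P → t ≠ y → (L t).card = 3 → G.Adj t u → G.Adj t v → G.Adj t y →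
        (L t : Set C) = {f u, f v, γ} → False) → False := by
    intro γ hγ hγv hγw hγu hbad
    obtain ⟨c, hc1, hcu, hcv, hcy, hc2⟩ :=
      h.exists_coloring_of_cross hP huv hvw hy hγ hγv hγu hbad
    exact h.false_of_cross hP huv hvw hy hc1 hcu hcv hc2 (fun _ => hcy ▸ hγw)
      fun t ht _ h1 h2 h3 => h.isCross_no_triangle hP hvw hy hmin ht h1 h2 h3
  by_cases hyy : y = y'
  · subst hyy
    obtain ⟨γ, hγ, hγn⟩ : ∃ γ ∈ L y, γ ∉ ({f u, f v, f w} : Finset C) := by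
      by_contra hno
      push Not at hno
      have heq := Finset.eq_of_subset_of_card_le hno (Finset.card_le_three.trans hy3)
      refine h.not_bad hcard y (h.subW hy.memS) hyP ?_ ?_
      · rw [hP]
        rintro p (rfl | rfl | rfl)
        exacts [hyu, hy.adj.symm, hyw]
      · rw [heq, hP, Set.image_insert_eq, Set.image_pair]
        simp
    simp only [Finset.mem_insert, Finset.mem_singleton, not_or] at hγn
    exact fin γ hγ hγn.2.1 hγn.2.2 (fun _ => hγn.1) fun t ht _ _ _ h1 h2 h3 _ =>
      h.isCross_no_triangle hP' huv hy' hmin' ht h2 h3 h1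
  -- Such a `t` would give a connection from `u` through `t` and `y` to `w` that avoids `v` and
  -- `y'`.
  · have sep : ∀ t, t ∈ S → t ≠ v → t ≠ y' → G.Adj y w → (t = y ∨ G.Adj t y) → G.Adj t u →
        False := by
      intro t ht htv hty' hyw h1 h2
      refine hy'.not_mem ?_
      have uR : u ∈ G.reach (W \ {v, y'}) {u} := subset_reach _ _ rfl
      have tR := reach_closed uR (b := t)
        ⟨h.subW ht, by rintro (h3 | h3); exacts [htv h3, hty' h3]⟩ h2.symm
      have yR : y ∈ G.reach (W \ {v, y'}) {u} := by
        rcases h1 with rfl | h1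
        · exact tR
        · exact reach_closed tR ⟨h.subW hy.memS,
            by rintro (h3 | h3); exacts [hy.adj.ne h3.symm, hyy h3]⟩ h1
      exact reach_closed yR ⟨h.subW hw,
        by rintro (h3 | h3); exacts [hvw.ne h3.symm, hy'.ne_left h3.symm]⟩ hyw
    have hynu : ¬ G.Adj y u := fun h' =>
      sep y hy.memS hy.adj.ne' hyy hyw (Or.inl rfl) h'
    have hbad : ∀ γ, (∀ t, t = y' → (L t).card = 3 → G.Adj t y →
        (L t : Set C) = {f u, f v, γ} → False) →
        (∀ t ∈ S, t ∉ P → t ≠ y → (L t).card = 3 → G.Adj t u → G.Adj t v → G.Adj t y →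
        (L t : Set C) = {f u, f v, γ} → False) := by
      intro γ hγ t ht htP hty h3 htu htv htadj hL
      by_cases hty' : t = y'
      · exact hγ t hty' h3 htadj hL
      · exact sep t ht htv.ne hty' hyw (Or.inr htadj) htu
    obtain ⟨γ, hγ, hγn⟩ := exists_mem_not_mem_finset (s := L y) (t := {f v, f w})
      (lt_of_le_of_lt Finset.card_le_two hy3)
    simp only [Finset.mem_insert, Finset.mem_singleton, not_or] at hγn
    -- If `y'` obstructs `γ`, it has three colors and is adjacent to `y`, so `y` has a fourth color
    -- `δ`. If `y'` obstructed `δ` too, then `δ = f u`, and its list would have only two colors.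
    by_cases hcase : (L y').card = 3 ∧ G.Adj y' y ∧ (L y' : Set C) = {f u, f v, γ}
    · obtain ⟨h3, hadj, hL⟩ := hcase
      have hy'P : y' ∉ P := by
        rw [hP]
        rintro (h1 | h1 | h1)
        exacts [hy'.ne_right h1, hy'.adj.ne h1.symm, hy'.ne_left h1]
      have hy4 : (L y).card ≠ 3 := h.indep y' (h.subW hy'.memS) hy'P y (h.subW hy.memS) hyP hadj h3
      obtain ⟨δ, hδ, hδn⟩ := exists_mem_not_mem_finset (s := L y) (t := {f v, f w, γ})
        (lt_of_le_of_lt Finset.card_le_three (by omega))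
      simp only [Finset.mem_insert, Finset.mem_singleton, not_or] at hδn
      refine fin δ hδ hδn.1 hδn.2.1 (fun h' => absurd h' hynu) (hbad δ ?_)
      rintro t rfl - - hL'
      have hδL : δ ∈ ({f u, f v, γ} : Set C) := by rw [← hL, hL']; simp
      have hδu : δ = f u := by
        rcases hδL with h1 | h1 | h1
        exacts [h1, absurd h1 hδn.1, absurd h1 hδn.2.2]
      have : ((L t : Set C)).ncard ≤ 2 := by
        rw [hL', hδu]
        have : ({f u, f v, f u} : Set C) = {f u, f v} := by ext; simp; tauto
        rw [this]
        exact Set.ncard_insert_le _ _ |>.trans (by simp)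
      rw [Set.ncard_coe_finset] at this
      omega
    · refine fin γ hγ hγn.1 hγn.2 (fun h' => absurd h' hynu) (hbad γ ?_)
      rintro t rfl h3 hadj hL
      exact hcase ⟨h3, hadj, hL⟩

/-- Deleting the ends of an edge between outer vertices does not disconnect the graph. -/
theorem subset_of_chord (h : Critical G W S P L f) {x y : V} (hx : x ∈ S) (hy : y ∈ S)
    (hxy : G.Adj x y) {Z : Set V} (hZ : Z ⊆ W \ {x, y}) (hZne : Z.Nonempty)
    (hcl : ∀ a ∈ Z, ∀ b ∈ W \ {x, y}, G.Adj a b → b ∈ Z) : W \ {x, y} ⊆ Z := by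
  by_contra hno
  obtain ⟨z, hz, hzZ⟩ := Set.not_subset.mp hno
  obtain ⟨⟨p, hp, hpZ⟩, q, hq, hqW, hqZ⟩ :=
    h.inter_nonempty_of_chord hx hy hxy hZ hZne hcl ⟨z, hz, hzZ⟩
  obtain ⟨v, hv, hstar⟩ := h.star ⟨p, hp⟩
  -- There are precolored vertices on both sides, and the star is connected through its center, so
  -- the center is an end of the edge. Hence `P` is a path whose ends are separated by an edge at
  -- its center.
  have hvxy : v ∈ ({x, y} : Set V) := by
    by_contra hvn
    have hvW : v ∈ W \ {x, y} := ⟨h.subW (h.subS hv), hvn⟩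
    have hvZ : v ∈ Z := by
      by_cases hpv : p = v
      · exact hpv ▸ hpZ
      · exact hcl p hpZ v hvW (hstar p hp hpv).symm
    by_cases hqv : q = v
    · exact hqZ (hqv ▸ hvZ)
    · exact hqZ (hcl v hvZ q hqW (hstar q hq hqv))
  have hpq : p ≠ q := fun e => hqZ (e ▸ hpZ)
  have hpv : p ≠ v := fun e => (hZ hpZ).2 (e ▸ hvxy)
  have hqv : q ≠ v := fun e => hqW.2 (e ▸ hvxy)
  have hP : P = {p, v, q} := by
    refine (Set.eq_of_subset_of_ncard_le ?_ ?_ (Set.toFinite P)).symm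
    · rintro z (rfl | rfl | rfl) <;> assumption
    · rw [Set.ncard_eq_three.mpr ⟨p, v, q, hpv, hpq, hqv.symm, rfl⟩]
      exact h.card_le
  have main : ∀ y' ∈ S, G.Adj v y' → ({x, y} : Set V) = {v, y'} → False := by
    intro y' hy' hvy' he
    rw [he] at hZ hcl hqW
    refine h.not_isCross hP hpq (hstar p hp hpv) (hstar q hq hqv) y' ⟨hy', hvy', ?_, ?_, ?_⟩
    · rintro rfl; exact (hZ hpZ).2 (Or.inr rfl)
    · rintro rfl; exact hqW.2 (Or.inr rfl)
    · intro hmem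
      have hsub : G.reach (W \ {v, y'}) {q} ⊆ {b | b ∈ W \ {v, y'} ∧ b ∉ Z} := by
        refine reach_subset (by rintro _ rfl; exact ⟨hqW, hqZ⟩) fun a ha b hb hab => ⟨hb, ?_⟩
        exact fun hbZ => ha.2 (hcl b hbZ a ha.1 hab.symm)
      exact (hsub hmem).2 hpZ
  rcases hvxy with rfl | rfl
  · exact main y hy hxy rfl
  · exact main x hx hxy.symm (Set.pair_comm _ _)

end Critical

end SimpleGraph

namespace SimpleGraph

variable {V C : Type*} {G : SimpleGraph V} {W S P : Set V} {L : V → Finset C} {f : V → C}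

/-! ### Coloring and deleting vertices -/

open scoped Classical in
/-- The lists that remain after the vertices of `X` are colored by `φ`. -/
noncomputable def residual (G : SimpleGraph V) (L : V → Finset C) (X : Set V) (φ : V → C) (y : V) :
    Finset C :=
  {c ∈ L y | ∀ x ∈ X, G.Adj x y → φ x ≠ c}

theorem mem_residual {X : Set V} {φ : V → C} {y : V} {c : C} :
    c ∈ residual G L X φ y ↔ c ∈ L y ∧ ∀ x ∈ X, G.Adj x y → φ x ≠ c := by
  simp [residual]

theorem residual_eq {X : Set V} {φ : V → C} {y : V} (h : ∀ x ∈ X, G.Adj x y → φ x ∉ L y) :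
    residual G L X φ y = L y := by
  ext c
  rw [mem_residual]
  exact ⟨fun hc => hc.1, fun hc => ⟨hc, fun x hx hxy e => h x hx hxy (e ▸ hc)⟩⟩

theorem le_card_residual {X : Set V} {φ : V → C} {y : V} (K : Finset C)
    (h : ∀ x ∈ X, G.Adj x y → φ x ∈ K) : (L y).card - K.card ≤ (residual G L X φ y).card := by
  classical
  refine (Finset.le_card_sdiff K (L y)).trans (Finset.card_le_card fun c hc => ?_)
  rw [Finset.mem_sdiff] at hc
  exact mem_residual.mpr ⟨hc.1, fun x hx hxy e => hc.2 (e ▸ h x hx hxy)⟩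

/-- The outer vertices after the deletion of `X`. -/
def outerAfter (G : SimpleGraph V) (W S X : Set V) : Set V :=
  {y | (y ∈ W ∧ y ∉ X) ∧ (y ∈ S ∨ ∃ x ∈ X, G.Adj x y)}

namespace Critical

theorem disk_outerAfter (h : Critical G W S P L f) {X : Set V} (hX : X ⊆ S) :
    G.IsDisk (W \ X) (outerAfter G W S X) :=
  h.disk.delete hX (hX.trans h.subW) subset_rfl fun _ _ hx => hx.2

/-- The lists after the deletion of `p` if all outer neighbors of `p` are precolored. -/
theorem residual_center (h : Critical G W S P L f) {p : V} (hno : ∀ y ∈ S, y ∉ P → ¬ G.Adj p y)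
    {y : V} (hy : y ∈ W) (hyP : y ∉ P) :
    (y ∈ S ∧ residual G L {p} f y = L y) ∨ 4 ≤ (residual G L {p} f y).card := by
  by_cases hyS : y ∈ S
  · refine Or.inl ⟨hyS, residual_eq fun x hx hxy => ?_⟩
    obtain rfl : x = p := hx
    exact absurd hxy (hno y hyS hyP)
  · have := le_card_residual (G := G) (L := L) (X := {p}) (φ := f) (y := y) {f p}
      (by rintro x rfl _; simp)
    have := h.five y hy hyS
    rw [Finset.card_singleton] at *
    omega

variable [Finite V]

/-- By `subset_of_chord`, deleting `v` and one of `a`, `b`, `c` leaves a connected graph. So the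
part `A` of `a` in `W \ {v, b, c}` touches both `b` and `c`, and `b` is connected to `c` outside `v`
and `a`, by an edge or through a part `K`. An edge `bc` gives K₅ on `v`, `A`, `b`, `c` and the apex.
If `K` touches `a`, then `v`, `K` and the apex against `a`, `b`, `c` give K₃,₃. Otherwise `K` is
disjoint from `A`, and K₅ arises with `b` enlarged by `K`. -/
theorem outer_degree_le_two (h : Critical G W S P L f) {v a b c : V} (hv : v ∈ S) (ha : a ∈ S)
    (hb : b ∈ S) (hc : c ∈ S) (hva : G.Adj v a) (hvb : G.Adj v b) (hvc : G.Adj v c)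
    (hab : a ≠ b) (hac : a ≠ c) (hbc : b ≠ c) : False := by
  have conn : ∀ {x y z : V}, x ∈ S → y ∈ S → z ∈ S → G.Adj v x → G.Adj v y → G.Adj v z → x ≠ y →
      y ≠ z → y ∈ S → z ∈ G.reach (W \ {v, y}) {x} ∨ z = x := by
    intro x y z hx hy hz hvx hvy hvz hxy hyz _
    by_cases hzx : z = x
    · exact Or.inr hzx
    have hxW : x ∈ W \ {v, y} :=
      ⟨h.subW hx, by rintro (h1 | h1); exacts [hvx.ne h1.symm, hxy h1]⟩
    refine Or.inl (h.subset_of_chord hv hy hvy (Z := G.reach (W \ {v, y}) {x})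
      (reach_subset_self (by simpa using hxW)) ⟨x, subset_reach _ {x} rfl⟩ (fun p hp q hq hpq => reach_closed hp hq hpq)
      ⟨h.subW hz, by rintro (h1 | h1); exacts [hvz.ne h1.symm, hyz h1.symm]⟩)
  have eqA : (W \ {v, b}) \ {c} = W \ {v, b, c} := by
    ext z; simp only [Set.mem_sdiff, Set.mem_insert_iff, Set.mem_singleton_iff]; tauto
  have eqA' : (W \ {v, c}) \ {b} = W \ {v, b, c} := by
    ext z; simp only [Set.mem_sdiff, Set.mem_insert_iff, Set.mem_singleton_iff]; tauto
  have eqK : ((W \ {v, a}) \ {c}) \ {b} = W \ {v, a, b, c} := by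
    ext z; simp only [Set.mem_sdiff, Set.mem_insert_iff, Set.mem_singleton_iff]; tauto
  set A := G.reach (W \ {v, b, c}) {a} with hA
  have haA : a ∈ A := subset_reach _ _ rfl
  have hAW : A ⊆ W \ {v, b, c} := reach_subset_self (by
    rintro _ rfl
    exact ⟨h.subW ha, by rintro (h1 | h1 | h1); exacts [hva.ne h1.symm, hab h1, hac h1]⟩)
  have hAconn : G.IsConnSet A := reach_isConnSet (isConnSet_singleton _ _)
  obtain ⟨a₁, ha₁, ha₁c⟩ : ∃ x ∈ A, G.Adj x c := by
    rw [hA, ← eqA]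
    exact exists_adj_of_mem_reach ((conn ha hb hc hva hvb hvc hab hbc hb).resolve_right hac.symm)
      hac.symm
  obtain ⟨a₂, ha₂, ha₂b⟩ : ∃ x ∈ A, G.Adj x b := by
    rw [hA, ← eqA']
    exact exists_adj_of_mem_reach
      ((conn ha hc hb hva hvc hvb hac hbc.symm hc).resolve_right hab.symm) hab.symm
  obtain ⟨k, hk, hkc⟩ := exists_adj_of_mem_reach
    ((conn hb ha hc hvb hva hvc hab.symm hac ha).resolve_right hbc.symm) (D := {b}) hbc.symm
  have hbR : b ∈ (W \ {v, a}) \ {c} :=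
    ⟨⟨h.subW hb, by rintro (h1 | h1); exacts [hvb.ne h1.symm, hab h1.symm]⟩, hbc⟩
  have hvA : v ∉ A := fun h' => (hAW h').2 (by simp)
  have hbA : b ∉ A := fun h' => (hAW h').2 (by simp)
  have hcA : c ∉ A := fun h' => (hAW h').2 (by simp)
  by_cases hkb : k = b
  · subst hkb
    exact h.disk.false_of_complete (X₁ := {v}) (X₂ := A) (X₃ := {k}) (X₄ := {c})
      (isConnSet_singleton _ _) hAconn (isConnSet_singleton _ _) (isConnSet_singleton _ _)
      (by simpa using h.subW hv) (hAW.trans Set.sdiff_subset) (by simpa using h.subW hb)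
      (by simpa using h.subW hc) ⟨v, rfl, hv⟩ ⟨a, haA, ha⟩ ⟨k, rfl, hb⟩ ⟨c, rfl, hc⟩
      (by simpa using hvA) (by simpa using hvb.ne) (by simpa using hvc.ne) (by simpa using hbA)
      (by simpa using hcA) (by simpa using hbc) ⟨v, rfl, a, haA, hva⟩ (touches_singleton hvb)
      (touches_singleton hvc) ⟨a₂, ha₂, k, rfl, ha₂b⟩ ⟨a₁, ha₁, c, rfl, ha₁c⟩
      (touches_singleton hkc)
  · have hkR : k ∈ (W \ {v, a}) \ {c} := reach_subset_self (by simpa using hbR) hk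
    set K := G.reach (W \ {v, a, b, c}) {k} with hK
    have hkK : k ∈ K := subset_reach _ _ rfl
    have hKW : K ⊆ W \ {v, a, b, c} := by
      rw [hK, ← eqK]
      exact reach_subset_self (by rintro _ rfl; exact ⟨hkR, hkb⟩)
    have hKconn : G.IsConnSet K := reach_isConnSet (isConnSet_singleton _ _)
    obtain ⟨k₁, hk₁, hk₁b⟩ : ∃ x ∈ K, G.Adj x b := by
      rw [hK, ← eqK]
      exact exists_adj_of_mem_reach (mem_reach_symm hbR hk) (fun e => hkb e.symm)
    have hvK : v ∉ K := fun h' => (hKW h').2 (by simp)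
    have haK : a ∉ K := fun h' => (hKW h').2 (by simp)
    have hbK : b ∉ K := fun h' => (hKW h').2 (by simp)
    have hcK : c ∉ K := fun h' => (hKW h').2 (by simp)
    by_cases hKa : ∃ x ∈ K, G.Adj x a
    · obtain ⟨k₂, hk₂, hk₂a⟩ := hKa
      exact h.disk.false_of_bipartite (X₁ := {v}) (X₂ := K) (Y₁ := {a}) (Y₂ := {b}) (Y₃ := {c})
        (isConnSet_singleton _ _) hKconn (isConnSet_singleton _ _) (isConnSet_singleton _ _)
        (isConnSet_singleton _ _) (by simpa using h.subW hv) (hKW.trans Set.sdiff_subset)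
        (by simpa using h.subW ha) (by simpa using h.subW hb) (by simpa using h.subW hc)
        ⟨a, rfl, ha⟩ ⟨b, rfl, hb⟩ ⟨c, rfl, hc⟩ (by simpa using hvK) (by simpa using hab)
        (by simpa using hac) (by simpa using hbc) (by simpa using hva.ne) (by simpa using hvb.ne)
        (by simpa using hvc.ne) (by simpa using haK) (by simpa using hbK) (by simpa using hcK)
        (touches_singleton hva) (touches_singleton hvb) (touches_singleton hvc)
        ⟨k₂, hk₂, a, rfl, hk₂a⟩ ⟨k₁, hk₁, b, rfl, hk₁b⟩ ⟨k, hkK, c, rfl, hkc⟩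
    · push Not at hKa
      have hdAK : Disjoint A K := by
        rw [Set.disjoint_left]
        intro z hzA hzK
        refine haK (hAconn.subset_of_inter (A := K) ⟨z, hzA, hzK⟩ (fun p hp hpK q hq hpq => ?_) haA)
        by_cases hqa : q = a
        · exact absurd (hqa ▸ hpq) (hKa p hpK)
        · refine reach_closed hpK ⟨(hAW hq).1, ?_⟩ hpq
          rintro (h1 | h1 | h1 | h1)
          exacts [hvA (h1 ▸ hq), hqa h1, hbA (h1 ▸ hq), hcA (h1 ▸ hq)]
      exact h.disk.false_of_complete (X₁ := {v}) (X₂ := A) (X₃ := insert b K) (X₄ := {c})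
        (isConnSet_singleton _ _) hAconn (hKconn.insert hk₁ hk₁b) (isConnSet_singleton _ _)
        (by simpa using h.subW hv) (hAW.trans Set.sdiff_subset)
        (Set.insert_subset (h.subW hb) (hKW.trans Set.sdiff_subset))
        (by simpa using h.subW hc) ⟨v, rfl, hv⟩ ⟨a, haA, ha⟩ ⟨b, Or.inl rfl, hb⟩ ⟨c, rfl, hc⟩
        (by simpa using hvA) (by simp [hvb.ne, hvK]) (by simpa using hvc.ne)
        (by rw [Set.disjoint_insert_right]; exact ⟨hbA, hdAK⟩)
        (by simpa using hcA) (by simp [hbc.symm, hcK]) ⟨v, rfl, a, haA, hva⟩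
        ⟨v, rfl, b, Or.inl rfl, hvb⟩ (touches_singleton hvc) ⟨a₂, ha₂, b, Or.inl rfl, ha₂b⟩
        ⟨a₁, ha₁, c, rfl, ha₁c⟩ ⟨k, Or.inr hkK, c, rfl, hkc⟩

/-- Color and delete the vertices of `X`. -/
theorem false_of_delete (h : Critical G W S P L f) {X P' : Set V} {φ f' : V → C} (hX : X ⊆ W)
    (hXne : X.Nonempty) (hd : G.IsDisk (W \ X) (outerAfter G W S X))
    (hP' : P' ⊆ outerAfter G W S X) (hPP' : P \ X ⊆ P') (hφ : ∀ x ∈ X, x ∉ P → φ x ∈ L x)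
    (hφP : ∀ x ∈ X, x ∈ P → φ x = f x) (hφX : ∀ x ∈ X, ∀ y ∈ X, G.Adj x y → φ x ≠ φ y)
    (hf : ∀ p ∈ P', p ∈ P → f' p = f p) (hfL : ∀ p ∈ P', p ∉ P → f' p ∈ L p)
    (hfφ : ∀ p ∈ P', ∀ x ∈ X, G.Adj x p → φ x ≠ f' p)
    (hcard : P'.ncard ≤ 3) (hstar : P'.Nonempty → ∃ v ∈ P', ∀ p ∈ P', p ≠ v → G.Adj v p)
    (hproper : ∀ p ∈ P', ∀ q ∈ P', G.Adj p q → f' p ≠ f' q)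
    (hthree : ∀ y ∈ W, y ∉ X → y ∉ P' → 3 ≤ (residual G L X φ y).card)
    (hindep : ∀ x ∈ W, x ∉ X → x ∉ P' → ∀ y ∈ W, y ∉ X → y ∉ P' → G.Adj x y →
      (residual G L X φ x).card = 3 → (residual G L X φ y).card ≠ 3)
    (hbad : P'.ncard = 3 → ∀ x ∈ W, x ∉ X → x ∉ P' → (∀ p ∈ P', G.Adj x p) →
      (residual G L X φ x : Set C) ≠ f' '' P') : False := by
  classical
  have hpre : Precolored G (W \ X) (outerAfter G W S X) P' (residual G L X φ) f' :=
    { disk := hd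
      subS := hP'
      subW := fun y hy => hy.1
      card_le := hcard
      star := hstar
      -- A vertex that is still inner has no neighbor in `X`, so it keeps its whole list.
      five := fun x hx hxS => by
        rw [residual_eq fun y hy hyx => absurd ⟨hx, Or.inr ⟨y, hy, hyx⟩⟩ hxS]
        exact h.five x hx.1 fun hS => hxS ⟨hx, Or.inl hS⟩
      three := fun x hx hxP => hthree x hx.1 hx.2 hxP
      indep := fun x hx hxP y hy hyP => hindep x hx.1 hx.2 hxP y hy.1 hy.2 hyP
      proper := hproper
      not_bad := fun h3 x hx hxP => hbad h3 x hx.1 hx.2 hxP }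
  obtain ⟨x₀, hx₀⟩ := hXne
  obtain ⟨c, hc1, hc2, hc3⟩ := h.ih _ _ _ _ _ _ hpre <| Or.inl <| Set.ncard_lt_ncard
    (Set.ssubset_iff_exists.mpr ⟨Set.sdiff_subset, x₀, hX hx₀, fun h' => h'.2 hx₀⟩)
    (Set.toFinite W)
  have hcross : ∀ x ∈ X, ∀ y ∈ W, y ∉ X → G.Adj x y → φ x ≠ c y := by
    intro x hx y hy hyX hxy
    by_cases hyP : y ∈ P'
    · rw [hc2 y hyP]; exact hfφ y hyP x hx hxy
    · exact (mem_residual.mp (hc1 y ⟨hy, hyX⟩ hyP)).2 x hx hxy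
  refine h.not_extends ⟨fun x => if x ∈ X then φ x else c x, ?_, ?_, ?_⟩
  · intro x hx hxP
    by_cases hxX : x ∈ X
    · simpa [hxX] using hφ x hxX hxP
    · by_cases hxP' : x ∈ P'
      · simpa [hxX, hc2 x hxP'] using hfL x hxP' hxP
      · simpa [hxX] using (mem_residual.mp (hc1 x ⟨hx, hxX⟩ hxP')).1
  · intro p hp
    by_cases hpX : p ∈ X
    · simpa [hpX] using hφP p hpX hp
    · simpa [hpX, hc2 p (hPP' ⟨hp, hpX⟩)] using hf p (hPP' ⟨hp, hpX⟩) hp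
  · intro x hx y hy hxy
    beta_reduce
    split_ifs with h1 h2 h2
    · exact hφX x h1 y h2 hxy
    · exact hcross x h1 y hy h2 hxy
    · exact (hcross y h2 x hx h1 hxy.symm).symm
    · exact hc3 x ⟨hx, h1⟩ y ⟨hy, h2⟩ hxy

/-- Color and delete outer vertices that are not precolored. -/
theorem false_of_delete_outer (h : Critical G W S P L f) {X : Set V} {φ : V → C} (hX : X ⊆ S)
    (hXP : Disjoint X P) (hXne : X.Nonempty) (hφ : ∀ x ∈ X, φ x ∈ L x)
    (hφX : ∀ x ∈ X, ∀ y ∈ X, G.Adj x y → φ x ≠ φ y)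
    (hφP : ∀ x ∈ X, ∀ p ∈ P, G.Adj x p → φ x ≠ f p)
    (hthree : ∀ y ∈ W, y ∉ X → y ∉ P → 3 ≤ (residual G L X φ y).card)
    (hindep : ∀ x ∈ W, x ∉ X → x ∉ P → ∀ y ∈ W, y ∉ X → y ∉ P → G.Adj x y →
      (residual G L X φ x).card = 3 → (residual G L X φ y).card ≠ 3)
    (hbad : P.ncard = 3 → ∀ x ∈ W, x ∉ X → x ∉ P → (∀ p ∈ P, G.Adj x p) →
      (residual G L X φ x : Set C) ≠ f '' P) : False :=
  h.false_of_delete (P' := P) (f' := f) (hX.trans h.subW) hXne (h.disk_outerAfter hX)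
    (fun _ hp => ⟨⟨h.subW (h.subS hp), Set.disjoint_right.mp hXP hp⟩, Or.inl (h.subS hp)⟩)
    (fun _ hp => hp.1) (fun x hx _ => hφ x hx)
    (fun _ hx hxP => absurd hxP (Set.disjoint_left.mp hXP hx)) hφX (fun _ _ _ => rfl)
    (fun _ hp hp' => absurd hp hp') (fun p hp x hx => hφP x hx p hp) h.card_le h.star h.proper
    hthree hindep hbad

theorem center_outer (h : Critical G W S P L f) {u v w : V} (hP : P = {u, v, w}) (huw : u ≠ w)
    (huv : G.Adj v u) (hvw : G.Adj v w) {x : V} (hx : x ∈ S) (hvx : G.Adj v x) : x ∈ P := by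
  by_contra hxP
  rw [hP] at hxP
  simp only [Set.mem_insert_iff, Set.mem_singleton_iff, not_or] at hxP
  exact h.outer_degree_le_two (h.subS (by simp [hP] : v ∈ P)) (h.subS (by simp [hP] : u ∈ P))
    (h.subS (by simp [hP] : w ∈ P)) hx huv hvw hvx huw (Ne.symm hxP.1) (Ne.symm hxP.2.2)

/-- Such a vertex would be a third outer neighbor of the center of the star. -/
theorem not_adj_all_of_outer (h : Critical G W S P L f) (hcard : P.ncard = 3) {x : V} (hx : x ∈ S)
    (hxP : x ∉ P) : ¬ ∀ p ∈ P, G.Adj x p := by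
  intro hadj
  have hne : P.Nonempty := (Set.ncard_pos (Set.toFinite P)).mp (by omega)
  obtain ⟨v, hv, hstar⟩ := h.star hne
  obtain ⟨a, b, hab, he⟩ := Set.ncard_eq_two.mp
    (show (P \ {v}).ncard = 2 by rw [Set.ncard_sdiff_singleton_of_mem hv, hcard])
  have ha : a ∈ P \ {v} := he ▸ Or.inl rfl
  have hb : b ∈ P \ {v} := he ▸ Or.inr rfl
  exact h.outer_degree_le_two (h.subS hv) (h.subS ha.1) (h.subS hb.1) hx (hstar a ha.1 ha.2)
    (hstar b hb.1 hb.2) (hadj v hv).symm hab (by rintro rfl; exact hxP ha.1)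
    (by rintro rfl; exact hxP hb.1)

/-- Color and delete one outer vertex that is not precolored. -/
theorem false_of_delete_one (h : Critical G W S P L f) {s : V} {γ : C} (hs : s ∈ S) (hsP : s ∉ P)
    (hγ : γ ∈ L s) (hγP : ∀ p ∈ P, G.Adj s p → γ ≠ f p)
    (htri : ∀ t ∈ S, t ∉ P → G.Adj s t → ∀ t' ∈ S, t' ∉ P → G.Adj s t' → ¬ G.Adj t t')
    (ht : ∀ t ∈ S, t ∉ P → G.Adj s t → γ ∉ L t ∨ 5 ≤ (L t).card ∨
      (4 ≤ (L t).card ∧ ∀ z ∈ S, z ∉ P → z ≠ s → G.Adj t z → (L z).card ≠ 3)) : False := by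
  have hsX : ∀ {x}, x ∈ ({s} : Set V) ↔ x = s := Iff.rfl
  have same : ∀ y, ¬ G.Adj s y ∨ γ ∉ L y → residual G L {s} (fun _ => γ) y = L y := by
    intro y hy
    refine residual_eq fun x hx hxy => ?_
    rw [hsX] at hx
    subst hx
    exact hy.resolve_left (not_not_intro hxy)
  have lower : ∀ y, (L y).card - 1 ≤ (residual G L {s} (fun _ => γ) y).card := fun y =>
    le_card_residual {γ} fun _ _ _ => by simp
  -- One color is lost at most, so a vertex left with three or fewer is outer. Either its list is
  -- unchanged, or it had exactly four colors and its outer neighbors outside `P` and `s` do not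
  -- have lists of size three.
  have key : ∀ y ∈ W, y ∉ P → (residual G L {s} (fun _ => γ) y).card ≤ 3 →
      (residual G L {s} (fun _ => γ) y = L y) ∨
      (y ∈ S ∧ G.Adj s y ∧ (L y).card = 4 ∧
        ∀ z ∈ S, z ∉ P → z ≠ s → G.Adj y z → (L z).card ≠ 3) := by
    intro y hy hyP h3
    by_cases hyS : y ∈ S
    · by_cases hsy : G.Adj s y
      · have := lower y
        rcases ht y hyS hyP hsy with h1 | h1 | h1
        · exact Or.inl (same y (Or.inr h1))
        · omega
        · exact Or.inr ⟨hyS, hsy, by omega, h1.2⟩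
      · exact Or.inl (same y (Or.inl hsy))
    · have := lower y
      have := h.five y hy hyS
      omega
  have mem3 : ∀ y ∈ W, (L y).card = 3 → y ∈ S := by
    intro y hy h3
    by_contra hyS
    have := h.five y hy hyS
    omega
  refine h.false_of_delete_outer (X := {s}) (φ := fun _ => γ) (by simpa using hs)
    (by simpa using hsP) ⟨s, rfl⟩ ?_ ?_ ?_ ?_ ?_ ?_
  · rintro x rfl; exact hγ
  · rintro x rfl y rfl hxy; exact absurd rfl hxy.ne
  · rintro x rfl p hp hxp; exact hγP p hp hxp
  · intro y hy hys hyP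
    by_contra hlt
    rcases key y hy hyP (by omega) with h1 | ⟨-, -, h4, -⟩
    · rw [h1] at hlt
      exact hlt (h.three y hy hyP)
    · have := lower y
      omega
  · intro x hx hxs hxP y hy hys hyP hxy h3x h3y
    rcases key x hx hxP h3x.le with h1 | ⟨hxS, hsx, h4, hz⟩ <;>
      rcases key y hy hyP h3y.le with h1' | ⟨hyS, hsy, h4', hz'⟩
    · rw [h1] at h3x
      rw [h1'] at h3y
      exact h.indep x hx hxP y hy hyP hxy h3x h3y
    · rw [h1] at h3x
      exact hz' x (mem3 x hx h3x) hxP hxs hxy.symm h3x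
    · rw [h1'] at h3y
      exact hz y (mem3 y hy h3y) hyP hys hxy h3y
    · exact htri x hxS hxP hsx y hyS hyP hsy hxy
  · intro hc x hx hxs hxP hadj hL
    have hle : (residual G L {s} (fun _ => γ) x).card ≤ 3 := by
      rw [← Set.ncard_coe_finset, hL]
      exact ncard_image_le_three h.card_le f
    rcases key x hx hxP hle with h1 | ⟨hxS, -⟩
    · rw [h1] at hL
      exact h.not_bad hc x hx hxP hadj hL
    · exact h.not_adj_all_of_outer hc hxS hxP hadj

/-- Precolor one more vertex. -/
theorem false_of_precolor (h : Critical G W S P L f) {s : V} {γ : C} (hs : s ∈ S) (hsP : s ∉ P)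
    (hγ : γ ∈ L s) (hγP : ∀ p ∈ P, G.Adj s p → γ ≠ f p) (hcard : P.ncard ≤ 2)
    (hstar : ∃ v ∈ insert s P, ∀ p ∈ insert s P, p ≠ v → G.Adj v p)
    (hbad : P.ncard = 2 → ∀ x ∈ S, x ∉ insert s P → ¬ ∀ p ∈ insert s P, G.Adj x p) : False := by
  classical
  have hfs : Function.update f s γ s = γ := Function.update_self _ _ _
  have hfP : ∀ p ∈ P, Function.update f s γ p = f p := fun p hp =>
    Function.update_of_ne (by rintro rfl; exact hsP hp) _ _
  have hins : (insert s P).ncard = P.ncard + 1 := Set.ncard_insert_of_notMem hsP (Set.toFinite P)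
  have hpre : Precolored G W S (insert s P) L (Function.update f s γ) :=
    { disk := h.disk
      subS := Set.insert_subset hs h.subS
      subW := h.subW
      card_le := by omega
      star := fun _ => hstar
      five := h.five
      three := fun x hx hxP => h.three x hx fun h' => hxP (Or.inr h')
      indep := fun x hx hxP y hy hyP =>
        h.indep x hx (fun h' => hxP (Or.inr h')) y hy fun h' => hyP (Or.inr h')
      proper := by
        rintro p (rfl | hp) q (rfl | hq) hpq
        · exact absurd rfl hpq.ne
        · rw [hfs, hfP q hq]; exact hγP q hq hpq
        · rw [hfs, hfP p hp]; exact (hγP p hp hpq.symm).symm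
        · rw [hfP p hp, hfP q hq]; exact h.proper p hp q hq hpq
      not_bad := fun h3 x hx hxP hadj hL => by
        have hle : (L x).card ≤ 3 := by
          rw [← Set.ncard_coe_finset, hL]
          exact ncard_image_le_three h3.le _
        refine hbad (by omega) x ?_ hxP hadj
        by_contra hxS
        have := h.five x hx hxS
        omega }
  obtain ⟨c, hc1, hc2, hc3⟩ := h.ih _ _ _ _ _ _ hpre (Or.inr ⟨rfl, by omega⟩)
  refine h.not_extends ⟨c, fun x hx hxP => ?_, fun p hp => ?_, hc3⟩
  · by_cases hxs : x = s
    · rw [hxs, hc2 s (Or.inl rfl), hfs]; exact hγ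
    · exact hc1 x hx (by rintro (h1 | h1); exacts [hxs h1, hxP h1])
  · rw [hc2 p (Or.inr hp), hfP p hp]

/-- Some outer neighbor of `p` is not precolored, if the other precolored vertices form a star. -/
theorem exists_outer_neighbor (h : Critical G W S P L f) {p : V} (hp : p ∈ P)
    (hstar : (P \ {p}).Nonempty → ∃ v ∈ P \ {p}, ∀ q ∈ P \ {p}, q ≠ v → G.Adj v q) :
    ∃ s ∈ S, s ∉ P ∧ G.Adj p s := by
  by_contra hno
  push Not at hno
  -- Deleting `p` would cost colors only at inner vertices, which keep four, so no new list of size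
  -- three appears.
  have key := fun y (hy : y ∈ W) => h.residual_center hno hy
  have hnP : ∀ {y}, y ∉ ({p} : Set V) → y ∉ P \ {p} → y ∉ P := fun h1 h2 h3 => h2 ⟨h3, h1⟩
  have hcard : (P \ {p}).ncard + 1 = P.ncard := Set.ncard_sdiff_singleton_add_one hp
  have := h.card_le
  refine h.false_of_delete (X := {p}) (P' := P \ {p}) (φ := f) (f' := f)
    (by simpa using h.subW (h.subS hp)) ⟨p, rfl⟩ (h.disk_outerAfter (by simpa using h.subS hp))
    (fun q hq => ⟨⟨h.subW (h.subS hq.1), hq.2⟩, Or.inl (h.subS hq.1)⟩) subset_rfl ?_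
    (fun _ _ _ => rfl) ?_ (fun _ _ _ => rfl) (fun q hq hq' => absurd hq.1 hq') ?_ (by omega)
    hstar (fun q hq r hr => h.proper q hq.1 r hr.1) ?_ ?_ (fun h3 => by omega)
  · rintro x rfl hx; exact absurd hp hx
  · rintro x rfl y rfl hxy; exact absurd rfl hxy.ne
  · rintro q hq x rfl hxq; exact h.proper _ hp q hq.1 hxq
  · intro y hy hyp hyP
    rcases key y hy (hnP hyp hyP) with ⟨-, h1⟩ | h1
    · rw [h1]; exact h.three y hy (hnP hyp hyP)
    · omega
  · intro x hx hxp hxP y hy hyp hyP hxy h3x h3y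
    rcases key x hx (hnP hxp hxP) with ⟨-, h1⟩ | h1
    · rcases key y hy (hnP hyp hyP) with ⟨-, h2⟩ | h2
      · rw [h1] at h3x
        rw [h2] at h3y
        exact h.indep x hx (hnP hxp hxP) y hy (hnP hyp hyP) hxy h3x h3y
      · omega
    · omega

/-- An outer vertex could be precolored at no cost. If there is none, any vertex `v` can be colored
and deleted, with `v` in place of the apex: all remaining lists have at least four colors. -/
theorem nonempty_precolored (h : Critical G W S P L f) : P.Nonempty := by
  by_contra hne
  rw [Set.not_nonempty_iff_eq_empty] at hne
  by_cases hS : S.Nonempty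
  · obtain ⟨s, hs⟩ := hS
    have hsP : s ∉ P := by simp [hne]
    have h3 := h.three s (h.subW hs) hsP
    obtain ⟨γ, hγ⟩ := Finset.card_pos.mp (show 0 < (L s).card by omega)
    refine h.false_of_precolor hs hsP hγ (by simp [hne]) (by simp [hne]) ?_ (by simp [hne])
    exact ⟨s, Or.inl rfl, by rintro p (rfl | hp) hps; exacts [absurd rfl hps, by simp [hne] at hp]⟩
  · rw [Set.not_nonempty_iff_eq_empty] at hS
    by_cases hW : W.Nonempty
    · obtain ⟨v, hv⟩ := hW
      have h5 : ∀ x ∈ W, 5 ≤ (L x).card := fun x hx => h.five x hx (by simp [hS])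
      obtain ⟨γ, hγ⟩ := Finset.card_pos.mp (show 0 < (L v).card by have := h5 v hv; omega)
      have h4 : ∀ x ∈ W, 4 ≤ (residual G L {v} (fun _ => γ) x).card := by
        intro x hx
        have := h5 x hx
        have := le_card_residual (G := G) (L := L) (X := {v}) (φ := fun _ => γ) (y := x) {γ}
          (by simp)
        rw [Finset.card_singleton] at this
        omega
      refine h.false_of_delete (X := {v}) (P' := ∅) (φ := fun _ => γ) (f' := f) (by simpa using hv)
        ⟨v, rfl⟩ (h.disk.delete_vertex hv subset_rfl ?_) (Set.empty_subset _) (by simp [hne]) ?_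
        (by simp [hne]) ?_ (by simp) (by simp) (by simp) (by simp) (by simp) (by simp) ?_ ?_
        (by simp)
      · rintro x hx ⟨-, hxS | ⟨y, rfl, hyx⟩⟩
        · simp [hS] at hxS
        · exact hyx
      · rintro x rfl -; exact hγ
      · rintro x rfl y rfl hxy; exact absurd rfl hxy.ne
      · intro y hy _ _
        have := h4 y hy
        omega
      · intro x hx _ _ y hy _ _ _ h3
        have := h4 x hx
        omega
    · rw [Set.not_nonempty_iff_eq_empty] at hW
      exact h.not_extends ⟨f, by simp [hW], fun _ _ => rfl, by simp [hW]⟩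

/-- In a minimal counterexample a path with three vertices is precolored. -/
theorem exists_path (h : Critical G W S P L f) : ∃ u v w s : V, P = {u, v, w} ∧ u ≠ w ∧
    G.Adj v u ∧ G.Adj v w ∧ ¬ G.Adj u w ∧ s ∈ S ∧ s ∉ P ∧ G.Adj w s := by
  classical
  have hpos := (Set.ncard_pos (Set.toFinite P)).mpr h.nonempty_precolored
  have hle := h.card_le
  have hcases : P.ncard = 1 ∨ P.ncard = 2 ∨ P.ncard = 3 := by omega
  rcases hcases with h1 | h2 | h3
  · exfalso
    obtain ⟨p, rfl⟩ := Set.ncard_eq_one.mp h1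
    obtain ⟨s, hs, hsP, hps⟩ := h.exists_outer_neighbor rfl (by simp)
    have h3 := h.three s (h.subW hs) hsP
    obtain ⟨γ, hγ, hγn⟩ := exists_mem_not_mem_finset (s := L s) (t := {f p})
      (by rw [Finset.card_singleton]; omega)
    refine h.false_of_precolor hs hsP hγ ?_ (by omega) ⟨p, by simp, ?_⟩ (by omega)
    · rintro q rfl _; simpa using hγn
    · rintro q (rfl | rfl) hq; exacts [hps, absurd rfl hq]
  · exfalso
    obtain ⟨v, hv, hstar⟩ := h.star h.nonempty_precolored
    obtain ⟨q, hq⟩ := Set.ncard_eq_one.mp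
      (show (P \ {v}).ncard = 1 by rw [Set.ncard_sdiff_singleton_of_mem hv, h2])
    have hqP : q ∈ P \ {v} := hq ▸ rfl
    have hP : P = {v, q} := by
      rw [← hq, Set.insert_sdiff_singleton, Set.insert_eq_of_mem hv]
    have hvq := hstar q hqP.1 hqP.2
    obtain ⟨s, hs, hsP, hvs⟩ := h.exists_outer_neighbor hv (by rw [hq]; simp)
    have h3 := h.three s (h.subW hs) hsP
    obtain ⟨γ, hγ, hγn⟩ := exists_mem_not_mem_finset (s := L s) (t := {f v, f q})
      (lt_of_le_of_lt Finset.card_le_two h3)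
    simp only [Finset.mem_insert, Finset.mem_singleton, not_or] at hγn
    refine h.false_of_precolor hs hsP hγ ?_ (by omega) ⟨v, Or.inr hv, ?_⟩ ?_
    · rw [hP]
      rintro p (rfl | rfl) _
      exacts [hγn.1, hγn.2]
    · rintro p (rfl | hp) hpv
      exacts [hvs, hstar p hp hpv]
    · intro _ x hx hxP hadj
      exact h.outer_degree_le_two (h.subS hv) hs (h.subS hqP.1) hx hvs hvq
        (hadj v (Or.inr hv)).symm (by rintro rfl; exact hsP hqP.1)
        (by rintro rfl; exact hxP (Or.inl rfl)) (by rintro rfl; exact hxP (Or.inr hqP.1))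
  · obtain ⟨v, hv, hstar⟩ := h.star h.nonempty_precolored
    obtain ⟨u, w, huw, he⟩ := Set.ncard_eq_two.mp
      (show (P \ {v}).ncard = 2 by rw [Set.ncard_sdiff_singleton_of_mem hv, h3])
    have hu : u ∈ P \ {v} := he ▸ Or.inl rfl
    have hw : w ∈ P \ {v} := he ▸ Or.inr rfl
    have hvu := hstar u hu.1 hu.2
    have hvw := hstar w hw.1 hw.2
    have hP : P = {u, v, w} := by
      rw [Set.insert_comm, ← he, Set.insert_sdiff_singleton, Set.insert_eq_of_mem hv]
    -- If `u` and `w` were adjacent, they would form a star without `v`. Then `v` would have an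
    -- outer neighbor that is not precolored, hence three outer neighbors.
    have hnuw : ¬ G.Adj u w := by
      intro hadj
      obtain ⟨s, hs, hsP, hvs⟩ := h.exists_outer_neighbor hv (fun _ => by
        rw [he]
        refine ⟨u, Or.inl rfl, ?_⟩
        rintro q (rfl | rfl) hq
        exacts [absurd rfl hq, hadj])
      exact hsP (h.center_outer hP huw hvu hvw hs hvs)
    obtain ⟨s, hs, hsP, hws⟩ := h.exists_outer_neighbor hw.1 (fun _ => by
      refine ⟨v, ⟨hv, fun e => hw.2 e.symm⟩, ?_⟩
      rintro q ⟨hq, -⟩ hqv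
      exact hstar q hq hqv)
    exact ⟨u, v, w, s, hP, huw, hvu, hvw, hnuw, hs, hsP, hws⟩

end Critical

end SimpleGraph

namespace SimpleGraph

variable {V C : Type*} {G : SimpleGraph V} {W S P : Set V} {L : V → Finset C} {f : V → C}

namespace Critical

variable [Finite V]

/-- No inner vertex is adjacent to all precolored vertices, if no outer vertex is adjacent to both
ends of the precolored path. -/
theorem not_adj_all_of_inner (h : Critical G W S P L f) {u v w : V} (hP : P = {u, v, w})
    (huw : u ≠ w) (hvu : G.Adj v u) (hvw : G.Adj v w) (hnuw : ¬ G.Adj u w)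
    (hz : ∀ z ∈ S, z ∉ P → G.Adj z u → ¬ G.Adj z w) {x : V} (hx : x ∈ W) (hxS : x ∉ S)
    (hxu : G.Adj x u) (hxv : G.Adj x v) (hxw : G.Adj x w) : False := by
  classical
  have hu : u ∈ P := by simp [hP]
  have hv : v ∈ P := by simp [hP]
  have hw : w ∈ P := by simp [hP]
  have hxP : x ∉ P := fun h' => hxS (h.subS h')
  have hno : ∀ y ∈ S, y ∉ P → ¬ G.Adj v y := fun y hy hyP hvy =>
    hyP (h.center_outer hP huw hvu hvw hy hvy)
  have h5 := h.five x hx hxS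
  obtain ⟨γ, hγ, hγn⟩ := exists_mem_not_mem_finset (s := L x) (t := {f u, f v, f w})
    (Finset.card_le_three.trans_lt (by omega))
  simp only [Finset.mem_insert, Finset.mem_singleton, not_or] at hγn
  obtain ⟨hγu, hγv, hγw⟩ := hγn
  have fx : Function.update f x γ x = γ := Function.update_self _ _ _
  have fP : ∀ p ∈ P, Function.update f x γ p = f p := fun p hp =>
    Function.update_of_ne (by rintro rfl; exact hxP hp) _ _
  have hnP : ∀ {y}, y ∉ ({v} : Set V) → y ∉ ({u, x, w} : Set V) → y ∉ P := by
    intro y h1 h2 h3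
    rw [hP] at h3
    rcases h3 with rfl | h3 | rfl
    exacts [h2 (by simp), h1 h3, h2 (by simp)]
  have hc3 : ({u, x, w} : Set V).ncard ≤ 3 := (Set.ncard_insert_le _ _).trans
    (Nat.succ_le_succ ((Set.ncard_insert_le _ _).trans (by simp)))
  -- The vertex `x` takes the place of `v`: the new precolored path is `u x w`. Inner vertices keep
  -- four colors, so a bad vertex would be outer and adjacent to `u` and `w`, which `hz` excludes.
  refine h.false_of_delete (X := {v}) (P' := {u, x, w}) (φ := f) (f' := Function.update f x γ)
    (by simpa using h.subW (h.subS hv)) ⟨v, rfl⟩ (h.disk_outerAfter (by simpa using h.subS hv))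
    ?_ ?_ ?_ (fun _ _ _ => rfl) ?_ (fun p _ hp => fP p hp) ?_ ?_ hc3 ?_ ?_ ?_ ?_ ?_
  · rintro p (rfl | rfl | rfl)
    · exact ⟨⟨h.subW (h.subS hu), hvu.ne'⟩, Or.inl (h.subS hu)⟩
    · exact ⟨⟨hx, hxv.ne⟩, Or.inr ⟨v, rfl, hxv.symm⟩⟩
    · exact ⟨⟨h.subW (h.subS hw), hvw.ne'⟩, Or.inl (h.subS hw)⟩
  · rintro p ⟨hp, hpv⟩
    rw [hP] at hp
    rcases hp with rfl | rfl | rfl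
    exacts [by simp, absurd rfl hpv, by simp]
  · rintro y rfl hy; exact absurd hv hy
  · rintro y rfl z rfl hyz; exact absurd rfl hyz.ne
  · rintro p (rfl | rfl | rfl) hp
    exacts [absurd hu hp, fx.symm ▸ hγ, absurd hw hp]
  · rintro p hp _ rfl hvp
    rcases hp with rfl | rfl | rfl
    · rw [fP _ hu]; exact h.proper _ hv _ hu hvp
    · rw [fx]; exact Ne.symm hγv
    · rw [fP _ hw]; exact h.proper _ hv _ hw hvp
  · refine fun _ => ⟨x, by simp, ?_⟩
    rintro p (rfl | rfl | rfl) hp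
    exacts [hxu, absurd rfl hp, hxw]
  · rintro p (rfl | rfl | rfl) q (rfl | rfl | rfl) hpq
    · exact absurd rfl hpq.ne
    · rw [fx, fP _ hu]; exact Ne.symm hγu
    · exact absurd hpq hnuw
    · rw [fx, fP _ hu]; exact hγu
    · exact absurd rfl hpq.ne
    · rw [fx, fP _ hw]; exact hγw
    · exact absurd hpq.symm hnuw
    · rw [fx, fP _ hw]; exact Ne.symm hγw
    · exact absurd rfl hpq.ne
  · intro y hy hyv hyP'
    rcases h.residual_center hno hy (hnP hyv hyP') with ⟨-, h1⟩ | h1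
    · rw [h1]; exact h.three y hy (hnP hyv hyP')
    · omega
  · intro y hy hyv hyP' z hz hzv hzP' hyz h3y h3z
    rcases h.residual_center hno hy (hnP hyv hyP') with ⟨-, h1⟩ | h1
    · rcases h.residual_center hno hz (hnP hzv hzP') with ⟨-, h2⟩ | h2
      · rw [h1] at h3y
        rw [h2] at h3z
        exact h.indep y hy (hnP hyv hyP') z hz (hnP hzv hzP') hyz h3y h3z
      · omega
    · omega
  · intro _ y hy hyv hyP' hadj hL
    rcases h.residual_center hno hy (hnP hyv hyP') with ⟨hyS, -⟩ | h1
    · exact hz y hyS (hnP hyv hyP') (hadj u (by simp)) (hadj w (by simp))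
    · have : (residual G L {v} f y).card ≤ 3 := by
        rw [← Set.ncard_coe_finset, hL]
        exact ncard_image_le_three hc3 _
      omega

/-! ### Inner vertices near an edge of outer vertices -/

/-- The outer neighbors of an outer vertex are two given ones. -/
theorem eq_or_eq_of_outer (h : Critical G W S P L f) {y₀ y₁ y₂ t : V} (hy₀ : y₀ ∈ S)
    (hy₁ : y₁ ∈ S) (hy₂ : y₂ ∈ S) (h10 : G.Adj y₁ y₀) (h12 : G.Adj y₁ y₂) (h02 : y₀ ≠ y₂)
    (ht : t ∈ S) (h1t : G.Adj y₁ t) : t = y₀ ∨ t = y₂ := by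
  by_contra hno
  rw [not_or] at hno
  exact h.outer_degree_le_two hy₁ hy₀ hy₂ ht h10 h12 h1t h02 (Ne.symm hno.1) (Ne.symm hno.2)

/-- A triangle with two outer vertices does not separate. -/
theorem false_of_triangle (h : Critical G W S P L f) {y₀ y₁ y₂ x : V} (hy₀ : y₀ ∈ S)
    (hy₁ : y₁ ∈ S) (hy₂ : y₂ ∈ S) (hx : x ∈ W) (h10 : G.Adj y₁ y₀) (h12 : G.Adj y₁ y₂)
    (hx1 : G.Adj x y₁) (hx2 : G.Adj x y₂) {D : Set V} (hD : G.IsConnSet D) (hPD : P ⊆ D)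
    (hDW : D ⊆ W \ {y₁, x, y₂}) (hcl : ∀ a ∈ D, ∀ b ∈ W \ {y₁, x, y₂}, G.Adj a b → b ∈ D)
    (hD₀ : y₀ ∈ D) (hrest : ∃ z ∈ W \ {y₁, x, y₂}, z ∉ D) : False := by
  have h02 : y₀ ≠ y₂ := by rintro rfl; exact (hDW hD₀).2 (by simp)
  -- Otherwise the edge `y₁ y₂` alone would separate. With this neighbor, `y₁ x y₂` can serve as a
  -- precolored path; it admits no bad vertex, because the outer neighbors of `y₁` are `y₀`, which
  -- lies in `D`, and `y₂`.
  have hxD : ∃ d ∈ D, G.Adj d x := by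
    by_contra hno
    push Not at hno
    have hsub := h.subset_of_chord hy₁ hy₂ h12 (Z := D)
      (fun d hd => ⟨(hDW hd).1, fun h' => (hDW hd).2 (by rcases h' with rfl | rfl <;> simp)⟩)
      ⟨y₀, hD₀⟩ (fun a ha b hb hab => hcl a ha b ⟨hb.1, by
        rintro (rfl | rfl | rfl)
        exacts [hb.2 (by simp), hno a ha hab, hb.2 (by simp)]⟩ hab)
    exact (hDW (hsub ⟨hx, by rintro (rfl | rfl); exacts [hx1.ne rfl, hx2.ne rfl]⟩)).2 (by simp)
  refine h.false_of_path (h.subW hy₁) hx (h.subW hy₂) hx1 hx2 h.nonempty_precolored hD hDW hPD hcl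
    (Or.inl hy₁) (Or.inr hxD) (Or.inl hy₂) hrest ?_
  intro t ht htD htS _ ht1 _ _
  rcases h.eq_or_eq_of_outer hy₀ hy₁ hy₂ h10 h12 h02 htS ht1.symm with rfl | rfl
  · exact htD hD₀
  · exact ht.2 (by simp)

/-- Two adjacent outer vertices have at most one common inner neighbor. -/
theorem inner_neighbor_unique (h : Critical G W S P L f) {y₀ y₁ y₂ x x' : V} (hy₀ : y₀ ∈ S)
    (hy₁ : y₁ ∈ S) (hy₂ : y₂ ∈ S) (hx : x ∈ W) (hx' : x' ∈ W) (h10 : G.Adj y₁ y₀)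
    (h12 : G.Adj y₁ y₂) (hx1 : G.Adj x y₁) (hx2 : G.Adj x y₂) (hx'1 : G.Adj x' y₁)
    (hx'2 : G.Adj x' y₂) {D : Set V} (hD : G.IsConnSet D) (hPD : P ⊆ D)
    (hDW : D ⊆ W \ {y₁, y₂, x, x'}) (hD₀ : y₀ ∈ D) : x = x' := by
  by_contra hxx
  have hC := reach_isConnSet (R := W \ {y₁, y₂, x, x'}) hD
  have hCW := reach_subset_self (G := G) hDW
  have hDC := subset_reach (G := G) (W \ {y₁, y₂, x, x'}) D
  have hcl : ∀ a ∈ G.reach (W \ {y₁, y₂, x, x'}) D, ∀ b ∈ W \ {y₁, y₂, x, x'}, G.Adj a b →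
      b ∈ G.reach (W \ {y₁, y₂, x, x'}) D := fun a ha b hb hab => reach_closed ha hb hab
  generalize G.reach (W \ {y₁, y₂, x, x'}) D = K at hC hCW hDC hcl
  -- If `K` did not touch `b`, the triangle `y₁ a y₂` would cut `b` off. So `K` touches both `x` and
  -- `x'`, and these with the apex form a K₃,₃ minor against `y₁`, `y₂`, `K`.
  have side : ∀ {a b : V}, a ∈ W → b ∈ W → G.Adj a y₁ → G.Adj a y₂ → G.Adj b y₁ → G.Adj b y₂ →
      a ≠ b → (W \ {y₁, y₂, a, b}) = W \ {y₁, y₂, x, x'} → ∃ d ∈ K, G.Adj d b := by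
    intro a b ha hb ha1 ha2 hb1 hb2 hab he
    by_contra hno
    push Not at hno
    rw [← he] at hCW hcl
    refine h.false_of_triangle hy₀ hy₁ hy₂ ha h10 h12 ha1 ha2 hC (hPD.trans hDC)
      (fun d hd => ⟨(hCW hd).1, fun h' => (hCW hd).2 (by rcases h' with rfl | rfl | rfl <;> simp)⟩)
      (fun c hc d hd hcd => hcl c hc d ⟨hd.1, ?_⟩ hcd) (hDC hD₀)
      ⟨b, ⟨hb, ?_⟩, fun hbK => (hCW hbK).2 (by simp)⟩
    · rintro (rfl | rfl | rfl | rfl)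
      exacts [hd.2 (by simp), hd.2 (by simp), hd.2 (by simp), hno c hc hcd]
    · rintro (rfl | rfl | rfl)
      exacts [hb1.ne rfl, hab rfl, hb2.ne rfl]
  obtain ⟨d', hd', hdx'⟩ := side hx hx' hx1 hx2 hx'1 hx'2 hxx rfl
  obtain ⟨d, hd, hdx⟩ := side hx' hx hx'1 hx'2 hx1 hx2 (Ne.symm hxx) (by rw [Set.pair_comm x' x])
  have nK : ∀ z ∈ ({y₁, y₂, x, x'} : Set V), z ∉ K := fun z hz hzK => (hCW hzK).2 hz
  exact h.disk.false_of_bipartite (X₁ := {x}) (X₂ := {x'}) (Y₁ := {y₁}) (Y₂ := {y₂}) (Y₃ := K)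
    (isConnSet_singleton _ _) (isConnSet_singleton _ _) (isConnSet_singleton _ _)
    (isConnSet_singleton _ _) hC (by simpa using hx) (by simpa using hx')
    (by simpa using h.subW hy₁) (by simpa using h.subW hy₂) (hCW.trans Set.sdiff_subset)
    ⟨y₁, rfl, hy₁⟩ ⟨y₂, rfl, hy₂⟩ ⟨y₀, hDC hD₀, hy₀⟩ (by simpa using hxx) (by simpa using h12.ne)
    (by simpa using nK y₁ (by simp)) (by simpa using nK y₂ (by simp)) (by simpa using hx1.ne)
    (by simpa using hx2.ne) (by simpa using nK x (by simp)) (by simpa using hx'1.ne)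
    (by simpa using hx'2.ne) (by simpa using nK x' (by simp)) (touches_singleton hx1)
    (touches_singleton hx2) ⟨x, rfl, d, hd, hdx.symm⟩ (touches_singleton hx'1)
    (touches_singleton hx'2) ⟨x', rfl, d', hd', hdx'.symm⟩

end Critical

/-- Delete all edges at `w` and join `w` to `y` and `z`. -/
def reattach (G : SimpleGraph V) (w y z : V) (hy : y ≠ w) (hz : z ≠ w) : SimpleGraph V where
  Adj a b := (a ≠ w ∧ b ≠ w ∧ G.Adj a b) ∨ (a = w ∧ (b = y ∨ b = z)) ∨ (b = w ∧ (a = y ∨ a = z))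
  symm := ⟨by
    rintro a b (⟨h1, h2, h3⟩ | h | h)
    exacts [Or.inl ⟨h2, h1, h3.symm⟩, Or.inr (Or.inr h), Or.inr (Or.inl h)]⟩
  loopless := ⟨by
    rintro a (⟨-, -, h⟩ | ⟨rfl, rfl | rfl⟩ | ⟨rfl, rfl | rfl⟩)
    exacts [h.ne rfl, hy rfl, hz rfl, hy rfl, hz rfl]⟩

namespace Critical

variable [Finite V]

/-- Two nonadjacent outer vertices do not separate if both are adjacent to the part with all
precolored vertices. -/
theorem false_of_two_cut (h : Critical G W S P L f) (hcard : P.ncard = 3) {y z : V} (hy : y ∈ S)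
    (hz : z ∈ S) (hyz : y ≠ z) (hnyz : ¬ G.Adj y z) {D : Set V} (hD : G.IsConnSet D) (hPD : P ⊆ D)
    (hDW : D ⊆ W \ {y, z}) (hcl : ∀ a ∈ D, ∀ b ∈ W \ {y, z}, G.Adj a b → b ∈ D)
    (hDy : ∃ d ∈ D, G.Adj d y) (hDz : ∃ d ∈ D, G.Adj d z) (hrest : ∃ t ∈ W \ {y, z}, t ∉ D) :
    False := by
  classical
  have hyD : y ∉ D := fun h' => (hDW h').2 (by simp)
  have hzD : z ∉ D := fun h' => (hDW h').2 (by simp)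
  obtain ⟨t, ht, htD⟩ := hrest
  obtain ⟨c, hc1, hc2, hc3⟩ := h.extends_restrict (A := D ∪ {y, z})
    (Set.union_subset (hDW.trans Set.sdiff_subset)
      (by rintro a (rfl | rfl); exacts [h.subW hy, h.subW hz]))
    (hPD.trans Set.subset_union_left) ⟨t, ht.1, by rintro (h' | h'); exacts [htD h', ht.2 h']⟩
  -- After coloring the side of `D`, this side is contracted to its vertex `w`; the loss of `p`
  -- makes the new graph smaller than `W`.
  obtain ⟨w, p, hw, hp, hwp⟩ := (Set.one_lt_ncard_iff (Set.toFinite P)).mp (by omega)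
  have hwD := hPD hw
  have hyw : y ≠ w := by rintro rfl; exact hyD hwD
  have hzw : z ≠ w := by rintro rfl; exact hzD hwD
  have h3 := h.three y (h.subW hy) fun h' => hyD (hPD h')
  -- Any color different from those of `y` and `z` will do for `w`; the list of `y` is merely a
  -- supply of three colors.
  obtain ⟨γ, -, hγn⟩ := exists_mem_not_mem_finset (s := L y) (t := {c y, c z})
    (lt_of_le_of_lt Finset.card_le_two h3)
  simp only [Finset.mem_insert, Finset.mem_singleton, not_or] at hγn
  obtain ⟨hγy, hγz⟩ := hγn
  set f' := Function.update c w γ with hf'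
  have fw : f' w = γ := Function.update_self _ _ _
  have fy : f' y = c y := Function.update_of_ne hyw _ _
  have fz : f' z = c z := Function.update_of_ne hzw _ _
  set G' := G.reattach w y z hyw hzw with hG'
  have adj_w : ∀ {x}, G'.Adj w x → x = y ∨ x = z := by
    rintro x (⟨h1, -, -⟩ | ⟨-, h1⟩ | ⟨rfl, h1⟩)
    exacts [absurd rfl h1, h1, h1]
  have adj_G : ∀ {a b}, a ≠ w → b ≠ w → G'.Adj a b → G.Adj a b := by
    rintro a b ha hb (⟨-, -, h1⟩ | ⟨h1, -⟩ | ⟨h1, -⟩)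
    exacts [h1, absurd h1 ha, absurd h1 hb]
  have hsubW : insert w (W \ D) ⊆ W :=
    Set.insert_subset (h.subW (h.subS (hw))) Set.sdiff_subset
  have out : ∀ {x}, x ∈ insert w (W \ D) → x ∉ ({y, w, z} : Set V) →
      x ≠ w ∧ x ∈ W ∧ x ∉ D ∧ x ∉ P := by
    intro x hx hxQ
    have hxw : x ≠ w := by rintro rfl; exact hxQ (by simp)
    have hxD := hx.resolve_left hxw
    exact ⟨hxw, hxD.1, hxD.2, fun h' => hxD.2 (hPD h')⟩
  have hpre : Precolored G' (insert w (W \ D)) ({y, w, z} ∪ S \ D) {y, w, z} L f' :=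
    { disk := by
        refine h.disk.contract₂ (Y := {none}) (Z := D) (z := w) (isConnSet_singleton _ _) (by simp)
          hD (hDW.trans Set.sdiff_subset) (by simp) ?_ ?_ ?_ ?_ ?_
        · exact fun x hx hxw => ⟨hsubW hx, by simp, (hx.resolve_left hxw).2⟩
        · exact fun x _ hxw a _ haw hxa => adj_G hxw haw hxa
        · intro x _ _ hwx
          rcases adj_w hwx with rfl | rfl
          exacts [hDy, hDz]
        · rintro x - hxw ((rfl | rfl | rfl) | hx)
          exacts [⟨none, rfl, hy⟩, absurd rfl hxw, ⟨none, rfl, hz⟩, ⟨none, rfl, hx.1⟩]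
        · exact fun _ _ => ⟨none, rfl, w, hwD, h.subS hw⟩
      subS := Set.subset_union_left
      subW := by
        rintro x ((rfl | rfl | rfl) | hx)
        exacts [Or.inr ⟨h.subW hy, hyD⟩, Or.inl rfl, Or.inr ⟨h.subW hz, hzD⟩,
          Or.inr ⟨h.subW hx.1, hx.2⟩]
      card_le := (Set.ncard_insert_le _ _).trans
        (Nat.succ_le_succ ((Set.ncard_insert_le _ _).trans (by simp)))
      star := fun _ => ⟨w, by simp, by
        rintro q (rfl | rfl | rfl) hq
        exacts [Or.inr (Or.inl ⟨rfl, Or.inl rfl⟩), absurd rfl hq,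
          Or.inr (Or.inl ⟨rfl, Or.inr rfl⟩)]⟩
      five := fun x hx hxS => by
        obtain ⟨-, h1, h2, -⟩ := out hx fun h' => hxS (Or.inl h')
        exact h.five x h1 fun h' => hxS (Or.inr ⟨h', h2⟩)
      three := fun x hx hxQ => h.three x (out hx hxQ).2.1 (out hx hxQ).2.2.2
      indep := fun x hx hxQ a ha haQ hxa =>
        h.indep x (out hx hxQ).2.1 (out hx hxQ).2.2.2 a (out ha haQ).2.1 (out ha haQ).2.2.2
          (adj_G (out hx hxQ).1 (out ha haQ).1 hxa)
      proper := by
        rintro q (rfl | rfl | rfl) r (rfl | rfl | rfl) hqr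
        · exact absurd rfl hqr.ne
        · rw [fw, fy]; exact Ne.symm hγy
        · exact absurd (adj_G hyw hzw hqr) hnyz
        · rw [fw, fy]; exact hγy
        · exact absurd rfl hqr.ne
        · rw [fw, fz]; exact hγz
        · exact absurd (adj_G hyw hzw hqr.symm) hnyz
        · rw [fw, fz]; exact Ne.symm hγz
        · exact absurd rfl hqr.ne
      -- The contracted vertex has no neighbors besides `y` and `z`, so no vertex sees the whole
      -- path.
      not_bad := fun _ x _ hxQ hadj _ => by
        rcases adj_w (hadj w (by simp)).symm with rfl | rfl <;> exact hxQ (by simp) }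
  obtain ⟨c', hc1', hc2', hc3'⟩ := h.ih _ _ _ _ _ _ hpre <| Or.inl <| Set.ncard_lt_ncard
    (Set.ssubset_iff_exists.mpr ⟨hsubW, p, h.subW (h.subS hp), by
      rintro (h' | h'); exacts [hwp h'.symm, h'.2 (hPD hp)]⟩) (Set.toFinite W)
  have hy' : c' y = c y := (hc2' y (by simp)).trans fy
  have hz' : c' z = c z := (hc2' z (by simp)).trans fz
  have hcross : ∀ a ∈ D, ∀ b ∈ W, b ∉ D → G.Adj a b → c a ≠ c' b := by
    intro a ha b hb hbD hab
    by_cases hbQ : b ∈ ({y, z} : Set V)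
    · have hcb : c' b = c b := by rcases hbQ with rfl | rfl <;> assumption
      rw [hcb]
      exact hc3 a (Or.inl ha) b (Or.inr hbQ) hab
    · exact absurd (hcl a ha b ⟨hb, hbQ⟩ hab) hbD
  have hne : ∀ {a}, a ∉ D → a ≠ w := by rintro a ha rfl; exact ha hwD
  refine h.not_extends ⟨fun x => if x ∈ D then c x else c' x, ?_, ?_, ?_⟩
  · intro x hx hxP
    by_cases hxD : x ∈ D
    · simpa [hxD] using hc1 x (Or.inl hxD) hxP
    · by_cases hxQ : x ∈ ({y, w, z} : Set V)
      · have hcx : c' x = c x := by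
          rcases hxQ with rfl | rfl | rfl
          exacts [hy', absurd rfl (hne hxD), hz']
        have hxQ' : x ∈ ({y, z} : Set V) := by
          rcases hxQ with rfl | rfl | rfl
          exacts [by simp, absurd rfl (hne hxD), by simp]
        simpa [hxD, hcx] using hc1 x (Or.inr hxQ') hxP
      · simpa [hxD] using hc1' x (Or.inr ⟨hx, hxD⟩) hxQ
  · intro q hq
    simpa [hPD hq] using hc2 q hq
  · intro a ha b hb hab
    beta_reduce
    split_ifs with h1 h2 h2
    · exact hc3 a (Or.inl h1) b (Or.inl h2) hab
    · exact hcross a h1 b hb h2 hab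
    · exact (hcross b h2 a ha h1 hab.symm).symm
    · exact hc3' a (Or.inr ⟨ha, h1⟩) b (Or.inr ⟨hb, h2⟩) (Or.inl ⟨hne h1, hne h2, hab⟩)

/-- A common inner neighbor of two adjacent outer vertices has no further outer neighbor. -/
theorem no_third_outer_neighbor (h : Critical G W S P L f) (hcard : P.ncard = 3)
    {y₀ y₁ y₂ x z : V} (hy₀ : y₀ ∈ S) (hy₁ : y₁ ∈ S) (hy₂ : y₂ ∈ S) (hz : z ∈ S) (hx : x ∈ W)
    (h10 : G.Adj y₁ y₀) (h12 : G.Adj y₁ y₂) (hx1 : G.Adj x y₁) (hx2 : G.Adj x y₂)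
    (hxz : G.Adj x z) (hz1 : z ≠ y₁) (hz2 : z ≠ y₂) (hL : (L y₂).card ≠ 3) {D : Set V}
    (hD : G.IsConnSet D) (hPD : P ⊆ D) (hDW : D ⊆ W \ {y₁, y₂, x, z}) (hD₀ : y₀ ∈ D) : False := by
  have hC := reach_isConnSet (R := W \ {y₁, y₂, x, z}) hD
  have hCW := reach_subset_self (G := G) hDW
  have hDC := subset_reach (G := G) (W \ {y₁, y₂, x, z}) D
  have hcl : ∀ a ∈ G.reach (W \ {y₁, y₂, x, z}) D, ∀ b ∈ W \ {y₁, y₂, x, z}, G.Adj a b →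
      b ∈ G.reach (W \ {y₁, y₂, x, z}) D := fun a ha b hb hab => reach_closed ha hb hab
  generalize G.reach (W \ {y₁, y₂, x, z}) D = K at hC hCW hDC hcl
  have nK : ∀ z' ∈ ({y₁, y₂, x, z} : Set V), z' ∉ K := fun z' hz' hzK => (hCW hzK).2 hz'
  have h0 : y₀ ∈ K := hDC hD₀
  have h02 : y₀ ≠ y₂ := by rintro rfl; exact nK _ (by simp) h0
  have h0z : z ≠ y₀ := by rintro rfl; exact nK _ (by simp) h0
  have hsub : ∀ {Q : Set V}, Q ⊆ {y₁, y₂, x, z} → K ⊆ W \ Q := fun hQ d hd =>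
    ⟨(hCW hd).1, fun h' => (hCW hd).2 (hQ h')⟩
  have hs1 : ({y₁, x, y₂} : Set V) ⊆ {y₁, y₂, x, z} := by rintro a (rfl | rfl | rfl) <;> simp
  have hs2 : ({y₁, x, z} : Set V) ⊆ {y₁, y₂, x, z} := by rintro a (rfl | rfl | rfl) <;> simp
  have hs3 : ({y₁, z} : Set V) ⊆ {y₁, y₂, x, z} := by rintro a (rfl | rfl) <;> simp
  have hn1z : ¬ G.Adj y₁ z := fun hadj => by
    rcases h.eq_or_eq_of_outer hy₀ hy₁ hy₂ h10 h12 h02 hz hadj with h1 | h1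
    exacts [h0z h1, hz2 h1]
  -- If `K` touches `z` and `y₂`, then `y₁`, `{z, x}`, `y₂`, `K` and the apex form K₅. If it touches
  -- `z` only, then `y₂` is cut off by the path `y₁ x z`, whose one possible bad vertex `y₂` is
  -- excluded by `hL`, or by `y₁` and `z` alone. If it does not touch `z`, the triangle `y₁ x y₂`
  -- cuts off `z`.
  by_cases hzK : ∃ d ∈ K, G.Adj d z
  · by_cases h2K : ∃ d ∈ K, G.Adj d y₂
    · obtain ⟨d, hd, hdz⟩ := hzK
      obtain ⟨e, he, he2⟩ := h2K
      exact h.disk.false_of_complete (X₁ := {y₁}) (X₂ := {z, x}) (X₃ := {y₂}) (X₄ := K)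
        (isConnSet_singleton _ _) (isConnSet_pair hxz.symm) (isConnSet_singleton _ _) hC
        (by simpa using h.subW hy₁) (Set.insert_subset (h.subW hz) (by simpa using hx))
        (by simpa using h.subW hy₂) (hCW.trans Set.sdiff_subset) ⟨y₁, rfl, hy₁⟩
        ⟨z, by simp, hz⟩ ⟨y₂, rfl, hy₂⟩ ⟨y₀, h0, hy₀⟩ (by simp [hz1.symm, hx1.ne'])
        (by simpa using h12.ne) (by simpa using nK y₁ (by simp)) (by simp [hz2.symm, hx2.ne'])
        (by
          rw [Set.disjoint_left]
          rintro a (rfl | rfl) <;> exact nK _ (by simp))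
        (by simpa using nK y₂ (by simp)) ⟨y₁, rfl, x, by simp, hx1.symm⟩ (touches_singleton h12)
        ⟨y₁, rfl, y₀, h0, h10⟩ ⟨x, by simp, y₂, rfl, hx2⟩ ⟨z, by simp, d, hd, hdz.symm⟩
        ⟨y₂, rfl, e, he, he2.symm⟩
    · push Not at h2K
      by_cases hxK : ∃ d ∈ K, G.Adj d x
      · refine h.false_of_path (h.subW hy₁) hx (h.subW hz) hx1 hxz h.nonempty_precolored hC
          (hsub hs2) (hPD.trans hDC) ?_ (Or.inl hy₁) (Or.inr hxK) (Or.inl hz)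
          ⟨y₂, ⟨h.subW hy₂, ?_⟩, nK y₂ (by simp)⟩ ?_
        · refine fun a ha b hb hab => hcl a ha b ⟨hb.1, ?_⟩ hab
          rintro (rfl | rfl | rfl | rfl)
          exacts [hb.2 (by simp), h2K a ha hab, hb.2 (by simp), hb.2 (by simp)]
        · rintro (h' | h' | h')
          exacts [h12.ne h'.symm, hx2.ne h'.symm, hz2 h'.symm]
        · intro t _ htK htS h3 ht1 _ _
          rcases h.eq_or_eq_of_outer hy₀ hy₁ hy₂ h10 h12 h02 htS ht1.symm with rfl | rfl
          exacts [htK h0, hL h3]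
      · push Not at hxK
        refine h.false_of_two_cut hcard hy₁ hz (Ne.symm hz1) hn1z hC (hPD.trans hDC) (hsub hs3) ?_
          ⟨y₀, h0, h10.symm⟩ hzK ⟨y₂, ⟨h.subW hy₂, ?_⟩, nK y₂ (by simp)⟩
        · refine fun a ha b hb hab => hcl a ha b ⟨hb.1, ?_⟩ hab
          rintro (rfl | rfl | rfl | rfl)
          exacts [hb.2 (by simp), h2K a ha hab, hxK a ha hab, hb.2 (by simp)]
        · rintro (h' | h')
          exacts [h12.ne h'.symm, hz2 h'.symm]
  · push Not at hzK
    refine h.false_of_triangle hy₀ hy₁ hy₂ hx h10 h12 hx1 hx2 hC (hPD.trans hDC) (hsub hs1) ?_ h0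
      ⟨z, ⟨h.subW hz, ?_⟩, nK z (by simp)⟩
    · refine fun a ha b hb hab => hcl a ha b ⟨hb.1, ?_⟩ hab
      rintro (rfl | rfl | rfl | rfl)
      exacts [hb.2 (by simp), hb.2 (by simp), hb.2 (by simp), hzK a ha hab]
    · rintro (h' | h' | h')
      exacts [hz1 h', hxz.ne h'.symm, hz2 h']

end Critical

end SimpleGraph

namespace SimpleGraph

variable {V C : Type*} {G : SimpleGraph V} {W S P : Set V} {L : V → Finset C} {f : V → C}

namespace Critical

theorem isConnSet_precolored [Finite V] (h : Critical G W S P L f) : G.IsConnSet P :=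
  let ⟨_, hv, hstar⟩ := h.star h.nonempty_precolored
  isConnSet_of_star hv hstar

/-- An inner vertex that loses two colors is adjacent to both deleted vertices. -/
theorem adj_of_residual_pair {a b : V} {d e : C} (φ : V → C) (ha : φ a = d)
    (hb : φ b = e) (h : Critical G W S P L f) {y : V} (hy : y ∈ W) (hyS : y ∉ S)
    (h3 : (residual G L {a, b} φ y).card ≤ 3) : G.Adj y a ∧ G.Adj y b := by
  have h5 := h.five y hy hyS
  constructor
  · by_contra hno
    have := le_card_residual (G := G) (L := L) (X := {a, b}) (φ := φ) (y := y) {e} (by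
      rintro x (rfl | rfl) hxy
      exacts [absurd hxy.symm hno, by simp [hb]])
    rw [Finset.card_singleton] at this
    omega
  · by_contra hno
    have := le_card_residual (G := G) (L := L) (X := {a, b}) (φ := φ) (y := y) {d} (by
      rintro x (rfl | rfl) hxy
      exacts [by simp [ha], absurd hxy.symm hno])
    rw [Finset.card_singleton] at this
    omega

/-! ### The outer vertices that follow the precolored path -/

/-- The outer neighbors of the outer vertex `s₁` are the precolored vertex `w` and the vertex `s₂`,
which is not precolored. -/
structure IsStart (G : SimpleGraph V) (S P : Set V) (w s₁ s₂ : V) : Prop where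
  memP : w ∈ P
  memS : s₁ ∈ S
  not_memP : s₁ ∉ P
  adj : G.Adj s₁ w
  memS₂ : s₂ ∈ S
  not_memP₂ : s₂ ∉ P
  adj₂ : G.Adj s₁ s₂
  eq_or_eq : ∀ t ∈ S, G.Adj s₁ t → t = w ∨ t = s₂

namespace IsStart

variable {w s₁ s₂ : V}

theorem eq_left (hs : IsStart G S P w s₁ s₂) {p : V} (hpS : p ∈ S) (hp : p ∈ P)
    (h1p : G.Adj s₁ p) : p = w :=
  (hs.eq_or_eq p hpS h1p).resolve_right fun e => hs.not_memP₂ (e ▸ hp)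

theorem eq_right (hs : IsStart G S P w s₁ s₂) {t : V} (htS : t ∈ S) (ht : t ∉ P)
    (h1t : G.Adj s₁ t) : t = s₂ :=
  (hs.eq_or_eq t htS h1t).resolve_left fun e => ht (e ▸ hs.memP)

theorem exists_color (hs : IsStart G S P w s₁ s₂) (h : Critical G W S P L f) (K : Finset C)
    (hK : K.card ≤ 2) : ∃ γ ∈ L s₁, γ ∉ K := by
  classical
  have := h.three s₁ (h.subW hs.memS) hs.not_memP
  exact exists_mem_not_mem_finset (by omega)

end IsStart

variable [Finite V]

/-- Color and delete outer vertices with at most two colors such that all inner vertices that lose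
two colors are common neighbors of the adjacent outer vertices `y₁` and `y₂`. -/
theorem false_of_delete_two_colors (h : Critical G W S P L f) (hcard : P.ncard = 3)
    (hall : ∀ x ∈ W, x ∉ P → ¬ ∀ p ∈ P, G.Adj x p) {X : Set V} {φ : V → C} (hX : X ⊆ S)
    (hXP : Disjoint X P) (hφ : ∀ x ∈ X, φ x ∈ L x)
    (hφX : ∀ x ∈ X, ∀ y ∈ X, G.Adj x y → φ x ≠ φ y)
    (hφP : ∀ x ∈ X, ∀ p ∈ P, G.Adj x p → φ x ≠ f p) {K : Finset C} (hK : K.card ≤ 2)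
    (hφK : ∀ x ∈ X, φ x ∈ K) {y₀ y₁ y₂ : V} (hy₁ : y₁ ∈ X) (hy₂ : y₂ ∈ X) (h10 : G.Adj y₁ y₀)
    (h12 : G.Adj y₁ y₂) (hL : (L y₂).card ≠ 3) {D : Set V} (hD : G.IsConnSet D) (hPD : P ⊆ D)
    (hDS : D ⊆ S) (hD₀ : y₀ ∈ D) (hD₁ : y₁ ∉ D) (hD₂ : y₂ ∉ D)
    (houter : ∀ y ∈ S, y ∉ X → y ∉ P → (residual G L X φ y = L y ∧ y ∉ D) ∨
      (3 ≤ (residual G L X φ y).card ∧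
        ∀ z ∈ W, z ∉ X → z ∉ P → G.Adj y z → (residual G L X φ z).card ≠ 3))
    (hinner : ∀ y ∈ W, y ∉ S → (residual G L X φ y).card ≤ 3 → G.Adj y y₁ ∧ G.Adj y y₂) :
    False := by
  have hS₁ := hX hy₁
  have hS₂ := hX hy₂
  -- An inner vertex left with three colors is a common neighbor of `y₁` and `y₂`, so
  -- `no_third_outer_neighbor` keeps it away from the other outer vertices outside `D`. Two such
  -- inner vertices would contradict `inner_neighbor_unique`.
  have mixed : ∀ x ∈ S, x ∉ X → x ∉ D → ∀ y ∈ W, y ∉ S → G.Adj y x →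
      (residual G L X φ y).card ≠ 3 := by
    intro x hx hxX hxD y hy hyS hyx h3
    obtain ⟨h1, h2⟩ := hinner y hy hyS h3.le
    refine h.no_third_outer_neighbor hcard (hDS hD₀) hS₁ hS₂ hx hy h10 h12 h1 h2 hyx
      (by rintro rfl; exact hxX hy₁) (by rintro rfl; exact hxX hy₂) hL hD hPD
      (fun a ha => ⟨h.subW (hDS ha), ?_⟩) hD₀
    rintro (rfl | rfl | rfl | rfl)
    exacts [hD₁ ha, hD₂ ha, hyS (hDS ha), hxD ha]
  refine h.false_of_delete_outer hX hXP ⟨y₁, hy₁⟩ hφ hφX hφP ?_ ?_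
    (fun _ x hx _ hxP hadj => absurd hadj (hall x hx hxP))
  · intro y hy hyX hyP
    by_cases hyS : y ∈ S
    · rcases houter y hyS hyX hyP with h1 | h1
      · rw [h1.1]; exact h.three y hy hyP
      · exact h1.1
    · have := h.five y hy hyS
      have := le_card_residual (G := G) (L := L) (X := X) (φ := φ) (y := y) K
        fun x hx _ => hφK x hx
      omega
  · intro x hx hxX hxP y hy hyX hyP hxy h3x h3y
    by_cases hxS : x ∈ S
    · rcases houter x hxS hxX hxP with hx1 | hx1
      · by_cases hyS : y ∈ S
        · rcases houter y hyS hyX hyP with hy1 | hy1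
          · rw [hx1.1] at h3x
            rw [hy1.1] at h3y
            exact h.indep x hx hxP y hy hyP hxy h3x h3y
          · exact hy1.2 x hx hxX hxP hxy.symm h3x
        · exact mixed x hxS hxX hx1.2 y hy hyS hxy.symm h3y
      · exact hx1.2 y hy hyX hyP hxy h3y
    · by_cases hyS : y ∈ S
      · rcases houter y hyS hyX hyP with hy1 | hy1
        · exact mixed y hyS hyX hy1.2 x hx hxS hxy h3x
        · exact hy1.2 x hx hxX hxP hxy.symm h3x
      · obtain ⟨hx1, hx2⟩ := hinner x hx hxS h3x.le
        obtain ⟨hy1, hy2⟩ := hinner y hy hyS h3y.le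
        refine hxy.ne (h.inner_neighbor_unique (hDS hD₀) hS₁ hS₂ hx hy h10 h12 hx1 hx2 hy1 hy2 hD
          hPD (fun a ha => ⟨h.subW (hDS ha), ?_⟩) hD₀)
        rintro (rfl | rfl | rfl | rfl)
        exacts [hD₁ ha, hD₂ ha, hxS (hDS ha), hyS (hDS ha)]

namespace IsStart

variable {w s₁ s₂ : V}

theorem false_of_delete_first (hs : IsStart G S P w s₁ s₂) (h : Critical G W S P L f) {γ : C}
    (hγ : γ ∈ L s₁) (hγw : γ ≠ f w) (ht : γ ∉ L s₂ ∨ 5 ≤ (L s₂).card ∨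
      (4 ≤ (L s₂).card ∧ ∀ z ∈ S, z ∉ P → z ≠ s₁ → G.Adj s₂ z → (L z).card ≠ 3)) : False := by
  refine h.false_of_delete_one hs.memS hs.not_memP hγ ?_ ?_ ?_
  · intro p hp h1p
    rw [hs.eq_left (h.subS hp) hp h1p]
    exact hγw
  · intro t htS htP h1t t' ht'S ht'P h1t' htt'
    exact htt'.ne ((hs.eq_right htS htP h1t).trans (hs.eq_right ht'S ht'P h1t').symm)
  · intro t htS htP h1t
    rw [hs.eq_right htS htP h1t]
    exact ht

/-- The vertex `s₁` needs no care: it keeps three of its four colors, and `s₂` was its only outer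
neighbor without a prescribed color. -/
theorem false_of_delete_second (hs : IsStart G S P w s₁ s₂) (h : Critical G W S P L f) {e : C}
    (h4 : 4 ≤ (L s₁).card) (he : e ∈ L s₂) (heP : ∀ p ∈ P, G.Adj s₂ p → e ≠ f p)
    (ht : ∀ t ∈ S, t ∉ P → t ≠ s₁ → G.Adj s₂ t → e ∉ L t ∨ 5 ≤ (L t).card ∨
      (4 ≤ (L t).card ∧ ∀ z ∈ S, z ∉ P → z ≠ s₂ → G.Adj t z → (L z).card ≠ 3)) : False := by
  refine h.false_of_delete_one hs.memS₂ hs.not_memP₂ he heP ?_ ?_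
  · intro t htS htP h2t t' ht'S ht'P h2t' htt'
    by_cases h1 : t = s₁
    · subst h1
      exact h2t'.ne (hs.eq_right ht'S ht'P htt').symm
    · by_cases h1' : t' = s₁
      · subst h1'
        exact h2t.ne (hs.eq_right htS htP htt'.symm).symm
      · exact h.outer_degree_le_two hs.memS₂ hs.memS htS ht'S hs.adj₂.symm h2t h2t' (Ne.symm h1)
          (Ne.symm h1') htt'.ne
  · intro t htS htP h2t
    by_cases h1 : t = s₁
    · subst h1
      exact Or.inr (Or.inr ⟨h4, fun z hzS hzP hz2 h1z => absurd (hs.eq_right hzS hzP h1z) hz2⟩)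
    · exact ht t htS htP h1 h2t

theorem eq_or_eq_second (hs : IsStart G S P w s₁ s₂) (h : Critical G W S P L f) {s₃ t : V}
    (h3 : s₃ ∈ S) (h13 : s₃ ≠ s₁) (h23 : G.Adj s₂ s₃) (ht : t ∈ S) (h2t : G.Adj s₂ t) :
    t = s₁ ∨ t = s₃ :=
  h.eq_or_eq_of_outer hs.memS hs.memS₂ h3 hs.adj₂.symm h23 (Ne.symm h13) ht h2t

/-- If `s₁` has three colors, then `s₂` has more. Deleting `s₁` succeeds unless `s₂` has exactly
four and another neighbor `s₃` with three. In that case give `s₂` a color outside `L s₃` and delete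
`s₁` and `s₂` together. -/
theorem card_first_ne_three (hs : IsStart G S P w s₁ s₂) (h : Critical G W S P L f)
    (hcard : P.ncard = 3) (hall : ∀ x ∈ W, x ∉ P → ¬ ∀ p ∈ P, G.Adj x p) :
    (L s₁).card ≠ 3 := by
  classical
  intro h13
  have h2 := h.three s₂ (h.subW hs.memS₂) hs.not_memP₂
  have h2' := h.indep _ (h.subW hs.memS) hs.not_memP _ (h.subW hs.memS₂) hs.not_memP₂ hs.adj₂ h13
  obtain ⟨γ, hγ, hγn⟩ := hs.exists_color h {f w} (by simp)
  rw [Finset.mem_singleton] at hγn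
  by_cases hz : ∃ z ∈ S, z ∉ P ∧ z ≠ s₁ ∧ G.Adj s₂ z ∧ (L z).card = 3
  · by_cases h5 : 5 ≤ (L s₂).card
    · exact hs.false_of_delete_first h hγ hγn (Or.inr (Or.inl h5))
    · obtain ⟨s₃, hs₃, hs₃P, hs₃1, h23, h33⟩ := hz
      obtain ⟨d, hd, hdn⟩ := exists_mem_not_mem_finset (s := L s₂) (t := L s₃) (by omega)
      obtain ⟨e, he, hen⟩ := hs.exists_color h {f w, d} Finset.card_le_two
      simp only [Finset.mem_insert, Finset.mem_singleton, not_or] at hen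
      have φ₂ : Function.update (fun _ => e) s₂ d s₂ = d := Function.update_self _ _ _
      have φ₁ : Function.update (fun _ => e) s₂ d s₁ = e := Function.update_of_ne hs.adj₂.ne _ _
      generalize Function.update (fun _ => e) s₂ d = φ at φ₁ φ₂
      refine h.false_of_delete_two_colors hcard hall (X := {s₁, s₂}) (φ := φ) ?_ ?_ ?_ ?_ ?_
        (K := {e, d}) Finset.card_le_two ?_ (Or.inl rfl) (Or.inr rfl) hs.adj hs.adj₂ (by omega)
        h.isConnSet_precolored subset_rfl h.subS hs.memP hs.not_memP hs.not_memP₂ ?_ ?_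
      · rintro x (rfl | rfl); exacts [hs.memS, hs.memS₂]
      · rw [Set.disjoint_left]; rintro x (rfl | rfl); exacts [hs.not_memP, hs.not_memP₂]
      · rintro x (rfl | rfl); exacts [φ₁ ▸ he, φ₂ ▸ hd]
      · rintro x (rfl | rfl) y (rfl | rfl) hxy
        · exact absurd rfl hxy.ne
        · rw [φ₁, φ₂]; exact hen.2
        · rw [φ₁, φ₂]; exact Ne.symm hen.2
        · exact absurd rfl hxy.ne
      · rintro x (rfl | rfl) p hp hxp
        · rw [hs.eq_left (h.subS hp) hp hxp, φ₁]; exact hen.1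
        · rcases hs.eq_or_eq_second h hs₃ hs₃1 h23 (h.subS hp) hxp with rfl | rfl
          exacts [absurd hp hs.not_memP, absurd hp hs₃P]
      · rintro x (rfl | rfl) <;> simp [φ₁, φ₂]
      · refine fun y hyS hyX hyP => Or.inl ⟨residual_eq ?_, hyP⟩
        rintro x (rfl | rfl) hxy
        · exact absurd (Or.inr (hs.eq_right hyS hyP hxy)) hyX
        · rcases hs.eq_or_eq_second h hs₃ hs₃1 h23 hyS hxy with rfl | rfl
          · exact absurd (Or.inl rfl) hyX
          · rwa [φ₂]
      · exact fun y hy hyS h3 => adj_of_residual_pair φ φ₁ φ₂ h hy hyS h3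
  · push Not at hz
    exact hs.false_of_delete_first h hγ hγn (Or.inr (Or.inr ⟨by omega, hz⟩))

/-- Suppose that `s₂` has more than three colors. If a neighbor `s₃` beyond it has three, delete
`s₂` with a color outside `L s₃`; otherwise delete `s₁`. -/
theorem card_second_eq_three (hs : IsStart G S P w s₁ s₂) (h : Critical G W S P L f)
    (h14 : 4 ≤ (L s₁).card) : (L s₂).card = 3 := by
  classical
  have h2 := h.three s₂ (h.subW hs.memS₂) hs.not_memP₂
  by_contra h2'
  by_cases hz : ∃ z ∈ S, z ∉ P ∧ z ≠ s₁ ∧ G.Adj s₂ z ∧ (L z).card = 3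
  · obtain ⟨s₃, hs₃, hs₃P, hs₃1, h23, h33⟩ := hz
    obtain ⟨d, hd, hdn⟩ := exists_mem_not_mem_finset (s := L s₂) (t := L s₃) (by omega)
    refine hs.false_of_delete_second h h14 hd ?_ ?_
    · intro p hp h2p
      rcases hs.eq_or_eq_second h hs₃ hs₃1 h23 (h.subS hp) h2p with rfl | rfl
      exacts [absurd hp hs.not_memP, absurd hp hs₃P]
    · intro t htS htP ht1 h2t
      rw [(hs.eq_or_eq_second h hs₃ hs₃1 h23 htS h2t).resolve_left ht1]
      exact Or.inl hdn
  · push Not at hz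
    obtain ⟨γ, hγ, hγn⟩ := hs.exists_color h {f w} (by simp)
    rw [Finset.mem_singleton] at hγn
    exact hs.false_of_delete_first h hγ hγn (Or.inr (Or.inr ⟨by omega, hz⟩))

/-- A color of `s₁` other than `f w` that is missing in `L s₂` would allow the deletion of `s₁`. So
`L s₂` contains the at least three colors of `L s₁` without `f w`, and by its size it equals that
set. -/
theorem subset_first (hs : IsStart G S P w s₁ s₂) (h : Critical G W S P L f)
    (h14 : 4 ≤ (L s₁).card) : L s₂ ⊆ L s₁ ∧ f w ∉ L s₂ := by
  classical
  have h23 := hs.card_second_eq_three h h14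
  have hsub : (L s₁).erase (f w) ⊆ L s₂ := by
    intro c hc
    rw [Finset.mem_erase] at hc
    by_contra hcn
    exact hs.false_of_delete_first h hc.2 hc.1 (Or.inl hcn)
  have hle := Finset.pred_card_le_card_erase (s := L s₁) (a := f w)
  have heq := Finset.eq_of_subset_of_card_le hsub (by omega)
  rw [← heq]
  exact ⟨Finset.erase_subset _ _, Finset.notMem_erase _ _⟩

/-- The next two outer vertices exist, and their lists have four and three colors. -/
theorem exists_next (hs : IsStart G S P w s₁ s₂) (h : Critical G W S P L f)
    (h14 : 4 ≤ (L s₁).card) : ∃ s₃ s₄ : V, s₃ ∈ S ∧ s₃ ∉ P ∧ s₃ ≠ s₁ ∧ G.Adj s₂ s₃ ∧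
      (L s₃).card = 4 ∧ s₄ ∈ S ∧ s₄ ∉ P ∧ s₄ ≠ s₂ ∧ G.Adj s₃ s₄ ∧ (L s₄).card = 3 := by
  classical
  have h23 := hs.card_second_eq_three h h14
  obtain ⟨e, he⟩ := Finset.card_pos.mp (show 0 < (L s₂).card by omega)
  by_cases hz : ∃ z ∈ S, z ≠ s₁ ∧ G.Adj s₂ z
  · obtain ⟨s₃, hs₃, hs₃1, h23'⟩ := hz
    by_cases hs₃P : s₃ ∈ P
    · exfalso
      obtain ⟨e', he', hen'⟩ := exists_mem_not_mem_finset (s := L s₂) (t := {f s₃})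
        (by rw [Finset.card_singleton]; omega)
      rw [Finset.mem_singleton] at hen'
      refine hs.false_of_delete_second h h14 he' ?_ ?_
      · intro p hp h2p
        rcases hs.eq_or_eq_second h hs₃ hs₃1 h23' (h.subS hp) h2p with rfl | rfl
        exacts [absurd hp hs.not_memP, hen']
      · intro t htS htP ht1 h2t
        rw [(hs.eq_or_eq_second h hs₃ hs₃1 h23' htS h2t).resolve_left ht1] at htP
        exact absurd hs₃P htP
    · have h33 := h.three s₃ (h.subW hs₃) hs₃P
      have h33' := h.indep _ (h.subW hs.memS₂) hs.not_memP₂ _ (h.subW hs₃) hs₃P h23' h23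
      have hdel : ¬ (5 ≤ (L s₃).card ∨
          (4 ≤ (L s₃).card ∧ ∀ z ∈ S, z ∉ P → z ≠ s₂ → G.Adj s₃ z → (L z).card ≠ 3)) := by
        intro hc
        refine hs.false_of_delete_second h h14 he ?_ ?_
        · intro p hp h2p
          rcases hs.eq_or_eq_second h hs₃ hs₃1 h23' (h.subS hp) h2p with rfl | rfl
          exacts [absurd hp hs.not_memP, absurd hp hs₃P]
        · intro t htS htP ht1 h2t
          rw [(hs.eq_or_eq_second h hs₃ hs₃1 h23' htS h2t).resolve_left ht1]
          exact Or.inr hc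
      rw [not_or] at hdel
      have hex : ∃ z ∈ S, z ∉ P ∧ z ≠ s₂ ∧ G.Adj s₃ z ∧ (L z).card = 3 := by
        by_contra hno
        push Not at hno
        exact hdel.2 ⟨by omega, hno⟩
      obtain ⟨s₄, hs₄, hs₄P, hs₄2, h34, h43⟩ := hex
      exact ⟨s₃, s₄, hs₃, hs₃P, hs₃1, h23', by omega, hs₄, hs₄P, hs₄2, h34, h43⟩
  · push Not at hz
    refine (hs.false_of_delete_second h h14 he ?_ ?_).elim
    · intro p hp h2p
      exact absurd h2p (hz p (h.subS hp) (by rintro rfl; exact hs.not_memP hp))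
    · intro t htS _ ht1 h2t
      exact absurd h2t (hz t htS ht1)

theorem contradiction (hs : IsStart G S P w s₁ s₂) (h : Critical G W S P L f)
    (hcard : P.ncard = 3) (hall : ∀ x ∈ W, x ∉ P → ¬ ∀ p ∈ P, G.Adj x p) : False := by
  classical
  have h14 : 4 ≤ (L s₁).card := by
    have := h.three s₁ (h.subW hs.memS) hs.not_memP
    have := hs.card_first_ne_three h hcard hall
    omega
  have hL2 := hs.card_second_eq_three h h14
  obtain ⟨hsub, hfw⟩ := hs.subset_first h h14
  obtain ⟨s₃, s₄, hs₃, hs₃P, h31, h23, hL3, hs₄, hs₄P, h42, h34, hL4⟩ := hs.exists_next h h14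
  have n2 : ∀ t ∈ S, G.Adj s₂ t → t = s₁ ∨ t = s₃ := fun t ht h2t =>
    hs.eq_or_eq_second h hs₃ h31 h23 ht h2t
  have n3 : ∀ t ∈ S, G.Adj s₃ t → t = s₂ ∨ t = s₄ := fun t ht h3t =>
    h.eq_or_eq_of_outer hs.memS₂ hs₃ hs₄ h23.symm h34 (Ne.symm h42) ht h3t
  have h13 : ¬ G.Adj s₁ s₃ := fun hadj => h23.ne (hs.eq_right hs₃ hs₃P hadj).symm
  have h41 : s₄ ≠ s₁ := by rintro rfl; exact h13 h34.symm
  obtain ⟨d, hd, hdn⟩ := exists_mem_not_mem_finset (s := L s₃) (t := L s₄) (by omega)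
  -- Otherwise `d` is in neither neighboring list, and `s₃` can be deleted with color `d`. Hence `d`
  -- is also a color of `s₁`, different from `f w`, and `s₁` and `s₃` may share it.
  have hd2 : d ∈ L s₂ := by
    by_contra hd2
    refine h.false_of_delete_one hs₃ hs₃P hd ?_ ?_ ?_
    · intro p hp h3p
      rcases n3 p (h.subS hp) h3p with rfl | rfl
      exacts [absurd hp hs.not_memP₂, absurd hp hs₄P]
    · intro t htS _ h3t t' ht'S _ h3t' htt'
      have h24 : ¬ G.Adj s₂ s₄ := fun hadj => by
        rcases n2 s₄ hs₄ hadj with h' | h'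
        exacts [h41 h', h34.ne h'.symm]
      rcases n3 t htS h3t with rfl | rfl <;> rcases n3 t' ht'S h3t' with rfl | rfl
      exacts [htt'.ne rfl, h24 htt', h24 htt'.symm, htt'.ne rfl]
    · intro t htS _ h3t
      rcases n3 t htS h3t with rfl | rfl
      exacts [Or.inl hd2, Or.inl hdn]
  obtain ⟨e, he, hen⟩ := exists_mem_not_mem_finset (s := L s₂) (t := {d})
    (by rw [Finset.card_singleton]; omega)
  rw [Finset.mem_singleton] at hen
  have φ₂ : Function.update (fun _ => d) s₂ e s₂ = e := Function.update_self _ _ _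
  have φ₁ : Function.update (fun _ => d) s₂ e s₁ = d := Function.update_of_ne hs.adj₂.ne _ _
  have φ₃ : Function.update (fun _ => d) s₂ e s₃ = d := Function.update_of_ne h23.ne' _ _
  generalize Function.update (fun _ => d) s₂ e = φ at φ₁ φ₂ φ₃
  have hconn : G.IsConnSet (insert s₁ P) := h.isConnSet_precolored.insert hs.memP hs.adj.symm
  have h2D : s₂ ∉ insert s₁ P := by
    rintro (h' | h'); exacts [hs.adj₂.ne h'.symm, hs.not_memP₂ h']
  have h3D : s₃ ∉ insert s₁ P := by rintro (h' | h'); exacts [h31 h', hs₃P h']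
  -- A common inner neighbor of `s₁`, `s₂`, `s₃` would obstruct the deletion of `s₂` and `s₃` alone,
  -- because `s₁` may drop to three colors. When it exists, `s₁` is deleted too.
  by_cases hx : ∃ x ∈ W, x ∉ S ∧ G.Adj x s₁ ∧ G.Adj x s₂ ∧ G.Adj x s₃
  · obtain ⟨x, hx, hxS, hx1, hx2, hx3⟩ := hx
    refine h.false_of_delete_two_colors hcard hall (X := {s₁, s₂, s₃}) (φ := φ) ?_ ?_ ?_ ?_ ?_
      (K := {d, e}) Finset.card_le_two ?_ (y₁ := s₂) (y₂ := s₃) (by simp) (by simp) hs.adj₂.symm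
      h23 (by omega) hconn (Set.subset_insert _ _) (Set.insert_subset hs.memS h.subS) (Or.inl rfl)
      h2D h3D ?_ ?_
    · rintro x (rfl | rfl | rfl); exacts [hs.memS, hs.memS₂, hs₃]
    · rw [Set.disjoint_left]
      rintro x (rfl | rfl | rfl); exacts [hs.not_memP, hs.not_memP₂, hs₃P]
    · rintro x (rfl | rfl | rfl); exacts [φ₁ ▸ hsub hd2, φ₂ ▸ he, φ₃ ▸ hd]
    · rintro x (rfl | rfl | rfl) y (rfl | rfl | rfl) hxy
      · exact absurd rfl hxy.ne
      · rw [φ₁, φ₂]; exact Ne.symm hen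
      · exact absurd hxy h13
      · rw [φ₁, φ₂]; exact hen
      · exact absurd rfl hxy.ne
      · rw [φ₂, φ₃]; exact hen
      · exact absurd hxy.symm h13
      · rw [φ₂, φ₃]; exact Ne.symm hen
      · exact absurd rfl hxy.ne
    · rintro x (rfl | rfl | rfl) p hp hxp
      · rw [hs.eq_left (h.subS hp) hp hxp, φ₁]
        rintro rfl
        exact hfw hd2
      · rcases n2 p (h.subS hp) hxp with rfl | rfl
        exacts [absurd hp hs.not_memP, absurd hp hs₃P]
      · rcases n3 p (h.subS hp) hxp with rfl | rfl
        exacts [absurd hp hs.not_memP₂, absurd hp hs₄P]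
    · rintro x (rfl | rfl | rfl) <;> simp [φ₁, φ₂, φ₃]
    · refine fun y hyS hyX hyP => Or.inl ⟨residual_eq ?_, ?_⟩
      · rintro x (rfl | rfl | rfl) hxy
        · exact absurd (Or.inr (Or.inl (hs.eq_right hyS hyP hxy))) hyX
        · rcases n2 y hyS hxy with rfl | rfl
          exacts [absurd (Or.inl rfl) hyX, absurd (Or.inr (Or.inr rfl)) hyX]
        · rcases n3 y hyS hxy with rfl | rfl
          · exact absurd (Or.inr (Or.inl rfl)) hyX
          · rwa [φ₃]
      · rintro (rfl | h')
        exacts [hyX (Or.inl rfl), hyP h']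
    · intro y hy hyS hle
      have h5 := h.five y hy hyS
      have hy2 : G.Adj y s₂ := by
        by_contra hno
        have := le_card_residual (G := G) (L := L) (X := {s₁, s₂, s₃}) (φ := φ) (y := y) {d} (by
          rintro x (rfl | rfl | rfl) hxy
          exacts [by simp [φ₁], absurd hxy.symm hno, by simp [φ₃]])
        rw [Finset.card_singleton] at this
        omega
      refine ⟨hy2, ?_⟩
      by_contra hno
      -- A common neighbor of `s₁` and `s₂` is unique, so it is `x`, which is adjacent to `s₃` as
      -- well.
      by_cases hy1 : G.Adj y s₁
      · have hyx : y = x := by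
          refine h.inner_neighbor_unique (h.subS hs.memP) hs.memS hs.memS₂ hy hx hs.adj hs.adj₂ hy1
            hy2 hx1 hx2 h.isConnSet_precolored subset_rfl
            (fun a ha => ⟨h.subW (h.subS ha), ?_⟩) hs.memP
          rintro (rfl | rfl | rfl | rfl)
          exacts [hs.not_memP ha, hs.not_memP₂ ha, hyS (h.subS ha), hxS (h.subS ha)]
        exact hno (hyx ▸ hx3)
      · have := le_card_residual (G := G) (L := L) (X := {s₁, s₂, s₃}) (φ := φ) (y := y) {e} (by
          rintro x (rfl | rfl | rfl) hxy
          exacts [absurd hxy.symm hy1, by simp [φ₂], absurd hxy.symm hno])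
        rw [Finset.card_singleton] at this
        omega
  · push Not at hx
    have hpair := fun (y : V) (hy : y ∈ W) (hyS : y ∉ S) =>
      adj_of_residual_pair φ φ₂ φ₃ h hy hyS
    refine h.false_of_delete_two_colors hcard hall (X := {s₂, s₃}) (φ := φ) ?_ ?_ ?_ ?_ ?_
      (K := {d, e}) Finset.card_le_two ?_ (y₁ := s₂) (y₂ := s₃) (by simp) (by simp) hs.adj₂.symm
      h23 (by omega) hconn (Set.subset_insert _ _) (Set.insert_subset hs.memS h.subS) (Or.inl rfl)
      h2D h3D ?_ hpair
    · rintro x (rfl | rfl); exacts [hs.memS₂, hs₃]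
    · rw [Set.disjoint_left]
      rintro x (rfl | rfl); exacts [hs.not_memP₂, hs₃P]
    · rintro x (rfl | rfl); exacts [φ₂ ▸ he, φ₃ ▸ hd]
    · rintro x (rfl | rfl) y (rfl | rfl) hxy
      · exact absurd rfl hxy.ne
      · rw [φ₂, φ₃]; exact hen
      · rw [φ₂, φ₃]; exact Ne.symm hen
      · exact absurd rfl hxy.ne
    · rintro x (rfl | rfl) p hp hxp
      · rcases n2 p (h.subS hp) hxp with rfl | rfl
        exacts [absurd hp hs.not_memP, absurd hp hs₃P]
      · rcases n3 p (h.subS hp) hxp with rfl | rfl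
        exacts [absurd hp hs.not_memP₂, absurd hp hs₄P]
    · rintro x (rfl | rfl) <;> simp [φ₂, φ₃]
    · intro y hyS hyX hyP
      by_cases hy1 : y = s₁
      -- The remaining vertex `s₁` is not adjacent to `s₃`, so it loses at most the color of `s₂`. A
      -- neighbor with three colors left would be a common inner neighbor of all three vertices.
      · subst hy1
        refine Or.inr ⟨?_, ?_⟩
        · have := le_card_residual (G := G) (L := L) (X := {s₂, s₃}) (φ := φ) (y := y) {e} (by
            rintro x (rfl | rfl) hxy
            exacts [by simp [φ₂], absurd hxy.symm h13])
          rw [Finset.card_singleton] at this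
          omega
        · intro z hz hzX hzP h1z hz3
          by_cases hzS : z ∈ S
          · exact hzX (Or.inl (hs.eq_right hzS hzP h1z))
          · obtain ⟨hz2, hz3'⟩ := hpair z hz hzS hz3.le
            exact hx z hz hzS h1z.symm hz2 hz3'
      · refine Or.inl ⟨residual_eq ?_, by rintro (h' | h'); exacts [hy1 h', hyP h']⟩
        rintro x (rfl | rfl) hxy
        · rcases n2 y hyS hxy with rfl | rfl
          exacts [absurd rfl hy1, absurd (Or.inr rfl) hyX]
        · rcases n3 y hyS hxy with rfl | rfl
          · exact absurd (Or.inl rfl) hyX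
          · rwa [φ₃]

end IsStart

/-- There is no minimal counterexample. -/
theorem contradiction (h : Critical G W S P L f) : False := by
  classical
  obtain ⟨u, v, w, s₁, hP, huw, hvu, hvw, hnuw, hs₁, hs₁P, hws₁⟩ := h.exists_path
  have hu : u ∈ P := by simp [hP]
  have hv : v ∈ P := by simp [hP]
  have hw : w ∈ P := by simp [hP]
  have hcard : P.ncard = 3 := by
    rw [hP, Set.ncard_eq_three]
    exact ⟨u, v, w, hvu.ne', huw, hvw.ne, rfl⟩
  have h3 := h.three s₁ (h.subW hs₁) hs₁P
  have hvs₁ : ¬ G.Adj s₁ v := fun hadj => hs₁P (h.center_outer hP huw hvu hvw hs₁ hadj.symm)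
  have hus₁ : ¬ G.Adj s₁ u := by
    intro hus₁
    obtain ⟨γ, hγ, hγn⟩ := exists_mem_not_mem_finset (s := L s₁) (t := {f u, f w})
      (lt_of_le_of_lt Finset.card_le_two h3)
    simp only [Finset.mem_insert, Finset.mem_singleton, not_or] at hγn
    have hno : ∀ t ∈ S, t ∉ P → ¬ G.Adj s₁ t := by
      intro t ht htP hadj
      rcases h.eq_or_eq_of_outer (h.subS hu) hs₁ (h.subS hw) hus₁ hws₁.symm huw ht hadj
        with rfl | rfl
      exacts [htP hu, htP hw]
    refine h.false_of_delete_one hs₁ hs₁P hγ ?_ (fun t ht htP hadj => absurd hadj (hno t ht htP))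
      fun t ht htP hadj => absurd hadj (hno t ht htP)
    intro p hp hadj
    rw [hP] at hp
    rcases hp with rfl | rfl | rfl
    exacts [hγn.1, absurd hadj hvs₁, hγn.2]
  have hend : ∀ p ∈ P, G.Adj s₁ p → p = w := by
    intro p hp hadj
    rw [hP] at hp
    rcases hp with rfl | rfl | rfl
    exacts [absurd hadj hus₁, absurd hadj hvs₁, rfl]
  have hz : ∀ z ∈ S, z ∉ P → G.Adj z u → ¬ G.Adj z w := by
    intro z hz hzP hzu hzw
    rcases h.eq_or_eq_of_outer (h.subS hv) (h.subS hw) hs₁ hvw.symm hws₁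
      (by rintro rfl; exact hs₁P hv) hz hzw.symm with rfl | rfl
    exacts [hzP hv, hus₁ hzu]
  have hall : ∀ x ∈ W, x ∉ P → ¬ ∀ p ∈ P, G.Adj x p := by
    intro x hx hxP hadj
    by_cases hxS : x ∈ S
    · exact h.not_adj_all_of_outer hcard hxS hxP hadj
    · exact h.not_adj_all_of_inner hP huw hvu hvw hnuw hz hx hxS (hadj u hu) (hadj v hv)
        (hadj w hw)
  by_cases hs : ∃ s₂ ∈ S, s₂ ∉ P ∧ G.Adj s₁ s₂
  · obtain ⟨s₂, hs₂, hs₂P, h12⟩ := hs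
    refine IsStart.contradiction (w := w) (s₁ := s₁) (s₂ := s₂)
      ⟨hw, hs₁, hs₁P, hws₁.symm, hs₂, hs₂P, h12, fun t ht hadj => ?_⟩ h hcard hall
    exact h.eq_or_eq_of_outer (h.subS hw) hs₁ hs₂ hws₁.symm h12 (by rintro rfl; exact hs₂P hw) ht
      hadj
  · push Not at hs
    obtain ⟨γ, hγ, hγn⟩ := exists_mem_not_mem_finset (s := L s₁) (t := {f w})
      (by rw [Finset.card_singleton]; omega)
    rw [Finset.mem_singleton] at hγn
    exact h.false_of_delete_one hs₁ hs₁P hγ (fun p hp hadj => hend p hp hadj ▸ hγn)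
      (fun t ht htP hadj => absurd hadj (hs t ht htP))
      fun t ht htP hadj => absurd hadj (hs t ht htP)

end Critical

/-! ### Conclusion of the induction and return to plane graphs -/

theorem Precolored.extends [Finite V] {G : SimpleGraph V} {W S P : Set V} {L : V → Finset C}
    {f : V → C} (h : Precolored G W S P L f) : Extends G W P L f := by
  -- Since `3 - P.ncard` is at most 3, the weight 4 makes this number order pairs lexicographically:
  -- smaller `W` first, then larger `P`.
  induction hn : 4 * W.ncard + (3 - P.ncard) using Nat.strong_induction_on
    generalizing G W S P L f with
  | _ n ih =>
    by_contra hno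
    refine Critical.contradiction ⟨h, fun G' W' S' P' L' f' h' hlt => ih _ ?_ h' rfl, hno⟩
    have := h.card_le
    have := h'.card_le
    omega

end SimpleGraph

namespace SimpleGraph

theorem Walk.exists_adj_all {V : Type*} {G : SimpleGraph V} {a b : V} (P : G.Walk a b)
    (h : P.length ≤ 2) : ∃ v ∈ P.support, ∀ p ∈ P.support, p ≠ v → G.Adj v p := by
  match P, h with
  | .nil, _ => exact ⟨a, by simp, by simp⟩
  | .cons h₁ .nil, _ => exact ⟨a, by simp, by simp [h₁]⟩
  | .cons (v := c) h₁ (.cons h₂ .nil), _ =>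
    exact ⟨c, by simp, by simp [h₁.symm, h₂]⟩

end SimpleGraph

theorem Set.exists_finset_subset_card_eq_min {C : Type*} (s : Set C) (k : ℕ) :
    ∃ t : Finset C, (t : Set C) ⊆ s ∧ (t.card : ℕ∞) = min s.encard k := by
  obtain ⟨t, hts, ht⟩ := Set.exists_subset_encard_eq (min_le_left s.encard (k : ℕ∞))
  have hfin : t.Finite := Set.finite_of_encard_le_coe (ht.trans_le (min_le_right _ _))
  refine ⟨hfin.toFinset, by simpa using hts, ?_⟩
  rw [← ht, ← Set.encard_coe_eq_coe_finsetCard, hfin.coe_toFinset]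

theorem mainTheorem3 {V C : Type*} [Finite V] (G : SimpleGraph V) (D : PlaneDrawing G)
    {a b : V} (P : G.Walk a b) (hPpath : P.IsPath) (hPlen : P.length ≤ 2)
    (hPF : P.toSubgraph ≤ D.outerBoundary)
    (L : V → Set C)
    (h_i : ∀ v, v ∉ D.outerBoundary.verts → 5 ≤ (L v).encard)
    (h_ii : ∀ v ∈ D.outerBoundary.verts, v ∉ P.support → 3 ≤ (L v).encard)
    (h_iii : ∀ v ∈ P.support, (L v).encard = 1)
    (h_iv : ∀ u v, G.Adj u v → ¬ ((L u).encard = 3 ∧ (L v).encard = 3))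
    (h_v : ∀ u ∈ P.support, ∀ v ∈ P.support, G.Adj u v → L u ≠ L v)
    (h_vi : P.length = 2 → ∀ x, (∀ y ∈ P.support, G.Adj x y) → L x ≠ ⋃ y ∈ P.support, L y) :
    G.IsListColorable L := by
  classical
  have hcard : {v | v ∈ P.support}.ncard = P.length + 1 := by
    have : {v | v ∈ P.support} = (P.support.toFinset : Set V) := by ext; simp
    rw [this, Set.ncard_coe_finset, List.toFinset_card_of_nodup hPpath.support_nodup,
      SimpleGraph.Walk.length_support]
  -- A default color: the values of `f` matter only on the path.
  obtain ⟨c₀, -⟩ := Set.encard_eq_one.mp (h_iii a P.start_mem_support)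
  have hf : ∀ v, ∃ c, v ∈ P.support → L v = {c} := fun v => by
    by_cases hv : v ∈ P.support
    · obtain ⟨c, hc⟩ := Set.encard_eq_one.mp (h_iii v hv)
      exact ⟨c, fun _ => hc⟩
    · exact ⟨c₀, fun h => absurd h hv⟩
  choose f hf using hf
  -- Lists may be infinite, so they are cut down to at most five colors. All lower bounds survive,
  -- and a list left with at most three colors was not shortened, so the conditions on lists of size
  -- three carry over.
  choose T hTL hT using fun v => (L v).exists_finset_subset_card_eq_min 5
  have hle : ∀ {v} {k : ℕ}, k ≤ 5 → (k : ℕ∞) ≤ (L v).encard → k ≤ (T v).card := by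
    intro v k hk h
    exact_mod_cast (le_min h (by exact_mod_cast hk)).trans_eq (hT v).symm
  have hfull : ∀ {v}, (T v).card ≤ 3 → (L v).encard = (T v).card := by
    intro v h
    rcases min_choice (L v).encard ((5 : ℕ) : ℕ∞) with h' | h'
    · rw [hT v, h']
    · have := hT v
      rw [h'] at this
      norm_cast at this
      omega
  have h3 : ∀ v, v ∉ P.support → 3 ≤ (T v).card := by
    intro v hv
    refine hle (by norm_num) ?_
    by_cases hvF : v ∈ D.outerBoundary.verts
    · exact_mod_cast h_ii v hvF hv
    · exact le_trans (by norm_num) (h_i v hvF)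
  have hpre : G.Precolored Set.univ D.outerBoundary.verts {v | v ∈ P.support} T f :=
    { disk := D.isDisk
      subS := fun v hv => hPF.1 (by simpa using hv)
      subW := Set.subset_univ _
      card_le := by omega
      star := fun _ => P.exists_adj_all hPlen
      five := fun v _ hv => hle le_rfl (by exact_mod_cast h_i v hv)
      three := fun v _ hv => h3 v hv
      indep := fun u _ _ v _ _ huv hu hv =>
        h_iv u v huv ⟨by simpa [hu] using hfull hu.le, by simpa [hv] using hfull hv.le⟩
      proper := fun u hu v hv huv e => h_v u hu v hv huv (by rw [hf u hu, hf v hv, e])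
      not_bad := fun hc x _ hx hadj hL => by
        have hx3 : (T x).card ≤ 3 := by
          rw [← Set.ncard_coe_finset, hL]
          exact SimpleGraph.ncard_image_le_three hc.le f
        have hTx : (T x : Set C) = L x :=
          (T x).finite_toSet.eq_of_subset_of_encard_le (hTL x) (by
            rw [hfull hx3, Set.encard_coe_eq_coe_finsetCard])
        refine h_vi (by omega) x hadj ?_
        rw [← hTx, hL]
        ext c
        simp only [Set.mem_image, Set.mem_ofPred_eq, Set.mem_iUnion, exists_prop]
        refine exists_congr fun y => and_congr_right fun hy => ?_
        rw [hf y hy, Set.mem_singleton_iff, eq_comm] }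
  obtain ⟨c, hc1, hc2, hc3⟩ := hpre.extends
  refine ⟨SimpleGraph.Coloring.mk c fun {u v} huv => hc3 u trivial v trivial huv, fun v => ?_⟩
  by_cases hv : v ∈ P.support
  · rw [hf v hv]
    exact hc2 v hv
  · exact hTL v (hc1 v trivial hv)
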